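/- **Setting.** Let $X\in\mathbb R^{n\times d}$ be a fixed design matrix without zero columns, $y\in\mathbb R^n$ a fixed observation vector, and $p\in(0,1)$. Write $\mathbb X=X^\top X$, $\overline{\mathbb X}=\mathbb X-\mathrm{Diag}(\mathbb X)$, $\mathbb X_p=p\mathbb X+(1-p)\mathrm{Diag}(\mathbb X)$ and $\tilde\beta=\mathbb X_p^{-1}X^\top y$; $\|\cdot\|$ denotes the spectral norm of matrices and the Euclidean norm of vectors. Let $D_1,D_2,\ldots$ be i.i.d. random diagonal matrices whose diagonal entries are i.i.d. Bernoulli$(p)$, and for $\alpha>0$ let $$\tilde\beta_k(\alpha)=\tilde\beta_{k-1}(\alpha)+\alpha D_kX^\top\big(y-XD_k\tilde\beta_{k-1}(\alpha)\big),\qquad k\ge 1 .$$ All probabilities, expectations and covariances refer to the randomness of the dropout matrices and of the initialization, with $y$ held fixed (quenched). Consider also the affine recursion $$\beta^\dagger_k(\alpha)-\tilde\beta=(I_d-\alpha p\mathbb X_p)\big(\beta^\dagger_{k-1}(\alpha)-\tilde\beta\big)+\alpha D_k\overline{\mathbb X}(pI_d-D_k)\tilde\beta .$$ For $q>1$ put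 $r_{\alpha,q}=\big(\sup_{\|v\|=1}\mathbb E\|(I_d-\alpha D_1\mathbb XD_1)v\|^q\big)^{1/q}$. **Theorem (Quenched CLT of iterative GD dropout).** Suppose that for every $l\in\{1,\dots,d\}$ there is $m\ne l$ with $\mathbb X_{lm}\neq0$. 1. For every $\alpha\in(0,2/\|\mathbb X\|)$, the recursion for $\tilde\beta_k(\alpha)$ has exactly one stationary law $\pi_\alpha$, and the affine recursion has exactly one stationary law. The latter has finite second moments, and for $\beta^\dagger(\alpha)$ drawn from it, $$\Xi(\alpha):=\mathrm{Cov}\Big(\frac{\beta^\dagger(\alpha)-\tilde\beta}{\sqrt\alpha}\Big)=\frac{\mathbb E\big[(\beta^\dagger(\alpha)-\tilde\beta)(\beta^\dagger(\alpha)-\tilde\beta)^\top\big]}{\alpha}.$$ 2. The limit $\Xi(0)=\lim_{\alpha\downarrow0}\Xi(\alpha)$ exists, is positive semidefinite, and is the unique solution $V\in\mathbb R^{d\times d}$ of the Lyapunov equation $$V(p\mathbb X_p)+(p\mathbb X_p)V=S,\qquad S=\mathrm{Cov}\big(D_1\overline{\mathbb X}(pI_d-D_1)\tilde\beta\big).$$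 3. (Stationary start.) If, for each $\alpha\in(0,2/\|\mathbb X\|)$, $\tilde\beta_0(\alpha)\sim\pi_\alpha$ is independent of $(D_k)_{k\ge1}$, then for every $k\in\mathbb N$, $$\frac{\tilde\beta_k(\alpha)-\tilde\beta}{\sqrt\alpha}\Rightarrow\mathcal N(0,\Xi(0))\qquad\text{as }\alpha\downarrow0 .$$ 4. (Arbitrary start.) Let $\tilde\beta_0\in\mathbb R^d$ be fixed and let $k(\alpha)\in\mathbb N$ be such that, for some $q>1$, $$r_{\alpha,q}^{\,k(\alpha)}\Big(\int\|\tilde\beta_0-u\|^q\,\pi_\alpha(du)\Big)^{1/q}=o(\sqrt\alpha)\qquad\text{as }\alpha\downarrow0 .$$ Then $$\frac{\tilde\beta_{k(\alpha)}(\alpha)-\tilde\beta}{\sqrt\alpha}\Rightarrow\mathcal N(0,\Xi(0))\qquad\text{as }\alpha\downarrow0 .$$ In particular, this convergence holds for every fixed $\tilde\beta_0$ whenever $\alpha k(\alpha)/\log(1/\alpha)\to\infty$. -/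

import Mathlib

open MeasureTheory ProbabilityTheory Filter Topology

namespace DropoutGD

/-- `ℝ^d` with the Euclidean norm. -/
abbrev Vec (d : ℕ) : Type := EuclideanSpace ℝ (Fin d)

/-- The action of a matrix on Euclidean vectors. -/
noncomputable def app {n d : ℕ} (A : Matrix (Fin n) (Fin d) ℝ) (v : Vec d) : Vec n :=
  WithLp.toLp 2 (A.mulVec v.ofLp)

/-- The spectral norm of a square matrix. -/
noncomputable def specNorm {d : ℕ} (A : Matrix (Fin d) (Fin d) ℝ) : ℝ :=
  ‖Matrix.toEuclideanCLM (𝕜 := ℝ) A‖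

/-- The Gram matrix `𝕏 = Xᵀ X`. -/
def gram {n d : ℕ} (X : Matrix (Fin n) (Fin d) ℝ) : Matrix (Fin d) (Fin d) ℝ :=
  X.transpose * X

/-- The off-diagonal part `A - Diag(A)`. -/
def offDiag {d : ℕ} (A : Matrix (Fin d) (Fin d) ℝ) : Matrix (Fin d) (Fin d) ℝ :=
  A - Matrix.diagonal A.diag

/-- `A_p = p A + (1 - p) Diag(A)`. -/
def shrink {d : ℕ} (p : ℝ) (A : Matrix (Fin d) (Fin d) ℝ) : Matrix (Fin d) (Fin d) ℝ :=
  p • A + (1 - p) • Matrix.diagonal A.diag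

/-- A dropout mask: `true` means that the coordinate is kept. -/
abbrev Mask (d : ℕ) : Type := Fin d → Bool

/-- The diagonal `0`/`1` matrix `D` of a mask. -/
def maskMat {d : ℕ} (m : Mask d) : Matrix (Fin d) (Fin d) ℝ :=
  Matrix.diagonal fun i => if m i then 1 else 0

/-- The law of a `p`-dropout matrix: the diagonal entries are i.i.d. Bernoulli(`p`). -/
noncomputable def dropoutLaw (d : ℕ) (p : unitInterval) : Measure (Mask d) :=
  Measure.pi fun _ => bernoulliMeasure true false p

/-- The regularized least-squares estimator `β̃ = 𝕏_p⁻¹ Xᵀ y`. -/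
noncomputable def ridge {n d : ℕ} (X : Matrix (Fin n) (Fin d) ℝ) (y : Vec n) (p : ℝ) : Vec d :=
  app (shrink p (gram X))⁻¹ (app X.transpose y)

/-- One gradient step with dropout: `u ↦ u + α D Xᵀ (y - X D u)`. -/
noncomputable def gdStep {n d : ℕ} (X : Matrix (Fin n) (Fin d) ℝ) (y : Vec n) (α : ℝ)
    (m : Mask d) (u : Vec d) : Vec d :=
  u + α • app (maskMat m) (app X.transpose (y - app X (app (maskMat m) u)))

/-- The iterates `β̃_k(α)` started at `u`; `D k` is the mask used in step `k + 1`. -/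
noncomputable def gdIter {n d : ℕ} (X : Matrix (Fin n) (Fin d) ℝ) (y : Vec n) (α : ℝ)
    (D : ℕ → Mask d) (u : Vec d) : ℕ → Vec d
  | 0 => u
  | k + 1 => gdStep X y α (D k) (gdIter X y α D u k)

/-- `H β̃ = D 𝕏̄ (p I - D) β̃`. -/
noncomputable def noise {n d : ℕ} (X : Matrix (Fin n) (Fin d) ℝ) (y : Vec n) (p : ℝ)
    (m : Mask d) : Vec d :=
  app (maskMat m * offDiag (gram X) * (p • 1 - maskMat m)) (ridge X y p)

/-- One step of the affine recursion: `u - β̃ ↦ (I - α p 𝕏_p) (u - β̃) + α H β̃`. -/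
noncomputable def affineStep {n d : ℕ} (X : Matrix (Fin n) (Fin d) ℝ) (y : Vec n) (p α : ℝ)
    (m : Mask d) (u : Vec d) : Vec d :=
  ridge X y p + app (1 - (α * p) • shrink p (gram X)) (u - ridge X y p) + α • noise X y p m

/-- `π` is a stationary law of the random iteration `u ↦ f m u`, where the mask `m` has law `μ`
and is independent of `u`. -/
def IsStationaryLaw {d : ℕ} (μ : Measure (Mask d)) (f : Mask d → Vec d → Vec d)
    (π : Measure (Vec d)) : Prop :=
  IsProbabilityMeasure π ∧ (μ.prod π).map (fun z => f z.1 z.2) = π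

open Classical in
/-- The stationary law of a random iteration (meaningful where it exists and is unique). -/
noncomputable def stationaryLaw {d : ℕ} (μ : Measure (Mask d)) (f : Mask d → Vec d → Vec d) :
    Measure (Vec d) :=
  if h : ∃ π, IsStationaryLaw μ f π then h.choose else 0

/-- The stationary law `π_α` of gradient descent with dropout. -/
noncomputable def gdLaw {n d : ℕ} (X : Matrix (Fin n) (Fin d) ℝ) (y : Vec n) (p : unitInterval)
    (α : ℝ) : Measure (Vec d) :=
  stationaryLaw (dropoutLaw d p) (gdStep X y α)

/-- The stationary law of the affine recursion. -/
noncomputable def affineLaw {n d : ℕ} (X : Matrix (Fin n) (Fin d) ℝ) (y : Vec n)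
    (p : unitInterval) (α : ℝ) : Measure (Vec d) :=
  stationaryLaw (dropoutLaw d p) (affineStep X y p α)

/-- The covariance matrix of a random vector `Z`. -/
noncomputable def covMat {Ω : Type*} [MeasurableSpace Ω] {d : ℕ} (Z : Ω → Vec d)
    (P : Measure Ω) : Matrix (Fin d) (Fin d) ℝ :=
  Matrix.of fun i j => covariance (fun ω => Z ω i) (fun ω => Z ω j) P

/-- `Ξ(α)`: the covariance matrix of `(β† - β̃) / √α` for `β†` drawn from the stationary law of
the affine recursion. -/
noncomputable def Xi {n d : ℕ} (X : Matrix (Fin n) (Fin d) ℝ) (y : Vec n) (p : unitInterval)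
    (α : ℝ) : Matrix (Fin d) (Fin d) ℝ :=
  covMat (fun u => (Real.sqrt α)⁻¹ • (u - ridge X y p)) (affineLaw X y p α)

/-- The covariance matrix `S` of `D 𝕏̄ (p I - D) β̃`. -/
noncomputable def noiseCov {n d : ℕ} (X : Matrix (Fin n) (Fin d) ℝ) (y : Vec n)
    (p : unitInterval) : Matrix (Fin d) (Fin d) ℝ :=
  covMat (noise X y p) (dropoutLaw d p)

/-- `r_{α,q} = (sup_{‖v‖ = 1} E ‖(I - α D 𝕏 D) v‖^q)^{1/q}`. -/
noncomputable def contraction {n d : ℕ} (X : Matrix (Fin n) (Fin d) ℝ) (p : unitInterval)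
    (α q : ℝ) : ℝ :=
  (⨆ v : Metric.sphere (0 : Vec d) 1,
    ∫ m, ‖app (1 - α • (maskMat m * gram X * maskMat m)) v.1‖ ^ q ∂(dropoutLaw d p)) ^ (1 / q)

/-- The masks `D 0, D 1, …` are i.i.d. `p`-dropout masks. -/
def IsDropoutSeq {Ω : Type*} [MeasurableSpace Ω] {d : ℕ} (p : unitInterval)
    (D : ℕ → Ω → Mask d) (P : Measure Ω) : Prop :=
  (∀ k, HasLaw (D k) (dropoutLaw d p) P) ∧ iIndepFun D P

/-- The rescaled error `(β̃_k(α) - β̃) / √α` of the iterate started at `u`. -/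
noncomputable def scaledError {n d : ℕ} (X : Matrix (Fin n) (Fin d) ℝ) (y : Vec n)
    (p α : ℝ) (D : ℕ → Mask d) (u : Vec d) (k : ℕ) : Vec d :=
  (Real.sqrt α)⁻¹ • (gdIter X y α D u k - ridge X y p)

end DropoutGD

open MeasureTheory ProbabilityTheory Filter Topology
set_option linter.unusedSectionVars false


/-! Centred at `β̃` and divided by `√α`, a dropout step reads `z ↦ (I - α M) z + √α h` with `M = D 𝕏
D` and `h = D 𝕏̄ (p I - D) β̃` (`gdStep_sub_ridge`). Here `M` has mean `G = p 𝕏_p`, and `h` has mean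
zero and covariance `S`. The affine recursion is the same with `M` replaced by `G`.

Existence and uniqueness. A single mask may give a singular `M`, so a step is in general only
nonexpansive. However, `‖(I - α M) v‖²` is bounded by an expression linear in `M`, and `G` is
coercive because `X` has no zero column; averaging therefore gives contraction in mean square. A
fixed point in `L^q` over mask sequences yields a stationary law, and decay of the transition
operator on Lipschitz functions makes it unique.

Central limit theorem. Let `φ` be the characteristic function of the rescaled stationary law and
`s(t) = ⟨t, S t⟩`. Stationarity and a Taylor expansion give `φ(t) = φ(t - α G t) (1 - α s(t) / 2) +
O(α^{3/2} ‖t‖²)`: up to this order `M` acts only through its mean, and uniform second moments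
control the error. If `V G + G V = S`, the function `exp(-⟨t, V t⟩ / 2)` satisfies the same
relation. Iterating `t ↦ t - α G t`, which contracts by `1 - c α`, sums the errors to `O(√α)`
(`norm_charFun_sub_exp_le`), and Lévy's theorem concludes.

Covariance. The exact second moments of the affine recursion satisfy `Ξ G + G Ξ = S + α G Ξ G` with
`Ξ` bounded. Since the Lyapunov operator is invertible, `Ξ(α)` converges to the solution `V`, which
is positive semidefinite as a limit of covariance matrices.

Fixed start. Two chains driven by the same masks approach each other at rate `r_{α,q}`, and the
rescaled character has Lipschitz constant `‖t‖ / √α`; this is where the condition `o(√α)` comes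
from. -/

namespace DropoutGD

/-! ### Random iterations: duality with the transition operator, and uniqueness of stationary laws.
-/

section RandomIteration

variable {ι : Type*} [MeasurableSpace ι] [Finite ι] [MeasurableSingletonClass ι]
variable {E : Type*} [NormedAddCommGroup E] [InnerProductSpace ℝ E] [FiniteDimensional ℝ E]
  [MeasurableSpace E] [BorelSpace E]

/-- The law of `F m u` when `m` has law `μ` and `u` is independent of `m` with law `π`. -/
noncomputable def pushLaw (μ : Measure ι) (F : ι → E → E) (π : Measure E) : Measure E :=
  (μ.prod π).map (fun z => F z.1 z.2)

/-- The transition operator of a random iteration. -/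
noncomputable def transOp (μ : Measure ι) (F : ι → E → E) (f : E → ℂ) (u : E) : ℂ :=
  ∫ m, f (F m u) ∂μ

/-- The iterates of a random iteration driven by the sequence `D`. -/
def randIter {κ V : Type*} (F : κ → V → V) (D : ℕ → κ) (u : V) : ℕ → V
  | 0 => u
  | k + 1 => F (D k) (randIter F D u k)

theorem measurable_uncurry_of_finite {F : ι → E → E} (hF : ∀ m, Continuous (F m)) :
    Measurable (fun z : ι × E => F z.1 z.2) :=
  measurable_from_prod_countable_right fun m => (hF m).measurable

theorem integrable_of_finite' {G : Type*} [NormedAddCommGroup G]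
    (μ : Measure ι) [IsFiniteMeasure μ] (f : ι → G) : Integrable f μ :=
  Integrable.of_finite

variable (μ : Measure ι) [IsProbabilityMeasure μ]

theorem isProbabilityMeasure_pushLaw {F : ι → E → E} (hF : ∀ m, Continuous (F m))
    (π : Measure E) [IsProbabilityMeasure π] : IsProbabilityMeasure (pushLaw μ F π) :=
  Measure.isProbabilityMeasure_map (measurable_uncurry_of_finite hF).aemeasurable

theorem integral_pushLaw {G : Type*} [NormedAddCommGroup G] [NormedSpace ℝ G]
    {F : ι → E → E} (hF : ∀ m, Continuous (F m))
    (π : Measure E) [IsProbabilityMeasure π] {f : E → G} (hf : Integrable f (pushLaw μ F π)) :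
    ∫ x, f x ∂(pushLaw μ F π) = ∫ u, ∫ m, f (F m u) ∂μ ∂π := by
  have hm := measurable_uncurry_of_finite hF
  rw [pushLaw, integral_map hm.aemeasurable hf.aestronglyMeasurable]
  exact integral_prod_symm _ ((integrable_map_measure hf.aestronglyMeasurable hm.aemeasurable).1 hf)

theorem norm_transOp_le {F : ι → E → E} {f : E → ℂ} {C : ℝ} (hC : ∀ u, ‖f u‖ ≤ C) (u : E) :
    ‖transOp μ F f u‖ ≤ C := by
  refine (norm_integral_le_of_norm_le_const (ae_of_all _ fun m => hC (F m u))).trans ?_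
  simp

theorem transOp_lipschitz {F : ι → E → E} {ρ : ℝ}
    (hρ : ∀ u v, ∫ m, ‖F m u - F m v‖ ∂μ ≤ ρ * ‖u - v‖) {f : E → ℂ} {L : ℝ} (hL0 : 0 ≤ L)
    (hL : ∀ u v, ‖f u - f v‖ ≤ L * ‖u - v‖) (u v : E) :
    ‖transOp μ F f u - transOp μ F f v‖ ≤ L * ρ * ‖u - v‖ := by
  rw [transOp, transOp, ← integral_sub (integrable_of_finite' _ _) (integrable_of_finite' _ _)]
  calc _ ≤ ∫ m, ‖f (F m u) - f (F m v)‖ ∂μ := norm_integral_le_integral_norm _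
    _ ≤ ∫ m, L * ‖F m u - F m v‖ ∂μ :=
        integral_mono (integrable_of_finite' _ _) (integrable_of_finite' _ _) fun m => hL _ _
    _ = L * ∫ m, ‖F m u - F m v‖ ∂μ := integral_const_mul _ _
    _ ≤ L * (ρ * ‖u - v‖) := by gcongr; exact hρ u v
    _ = _ := by ring

theorem continuous_of_norm_sub_le {f : E → ℂ} {L : ℝ} (hL0 : 0 ≤ L)
    (hL : ∀ u v, ‖f u - f v‖ ≤ L * ‖u - v‖) : Continuous f :=
  (LipschitzWith.of_dist_le_mul (K := ⟨L, hL0⟩) fun u v => by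
    rw [dist_eq_norm, dist_eq_norm]; exact hL u v).continuous

/-- Contraction in mean passes to test functions: each application of the operator multiplies the
Lipschitz constant by `ρ`, while sup bounds are kept. -/
theorem transOp_iterate_lipschitz {F : ι → E → E} {ρ : ℝ} (hρ0 : 0 ≤ ρ)
    (hρ : ∀ u v, ∫ m, ‖F m u - F m v‖ ∂μ ≤ ρ * ‖u - v‖) (k : ℕ) {f : E → ℂ} {L : ℝ}
    (hL0 : 0 ≤ L) (hL : ∀ u v, ‖f u - f v‖ ≤ L * ‖u - v‖) (u v : E) :
    ‖(transOp μ F)^[k] f u - (transOp μ F)^[k] f v‖ ≤ L * ρ ^ k * ‖u - v‖ := by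
  induction k generalizing f L with
  | zero => simpa using hL u v
  | succ k ih =>
    rw [Function.iterate_succ_apply]
    refine (ih (by positivity) (transOp_lipschitz μ hρ hL0 hL)).trans (le_of_eq ?_)
    ring

theorem norm_transOp_iterate_le {F : ι → E → E} {C : ℝ} (k : ℕ) {f : E → ℂ}
    (hC : ∀ u, ‖f u‖ ≤ C) (u : E) : ‖(transOp μ F)^[k] f u‖ ≤ C := by
  induction k generalizing f with
  | zero => simpa using hC u
  | succ k ih =>
    rw [Function.iterate_succ_apply]
    exact ih (norm_transOp_le μ hC)

theorem integrable_of_lipschitz_bounded {f : E → ℂ} {C L : ℝ} (hL0 : 0 ≤ L)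
    (hL : ∀ u v, ‖f u - f v‖ ≤ L * ‖u - v‖) (hC : ∀ u, ‖f u‖ ≤ C)
    (π : Measure E) [IsProbabilityMeasure π] : Integrable f π :=
  Integrable.of_bound (continuous_of_norm_sub_le hL0 hL).aestronglyMeasurable C (ae_of_all _ hC)

/-- Moving the law forward is dual to moving the test function backward. Bounded Lipschitz functions
form a class stable under `transOp` and integrable against every probability measure, so no moments
are needed. -/
theorem integral_pushLaw_iterate {F : ι → E → E} (hF : ∀ m, Continuous (F m)) {ρ : ℝ}
    (hρ0 : 0 ≤ ρ) (hρ : ∀ u v, ∫ m, ‖F m u - F m v‖ ∂μ ≤ ρ * ‖u - v‖) (k : ℕ)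
    (π : Measure E) [IsProbabilityMeasure π] {f : E → ℂ} {C L : ℝ} (hL0 : 0 ≤ L)
    (hL : ∀ u v, ‖f u - f v‖ ≤ L * ‖u - v‖) (hC : ∀ u, ‖f u‖ ≤ C) :
    ∫ x, f x ∂((pushLaw μ F)^[k] π) = ∫ u, (transOp μ F)^[k] f u ∂π := by
  induction k generalizing π with
  | zero => simp
  | succ k ih =>
    have := isProbabilityMeasure_pushLaw μ hF π
    rw [Function.iterate_succ_apply, ih, integral_pushLaw μ hF π
      (integrable_of_lipschitz_bounded (by positivity) (transOp_iterate_lipschitz μ hρ0 hρ k hL0 hL)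
        (norm_transOp_iterate_le μ k hC) _), Function.iterate_succ_apply']
    rfl

/-- Two chains driven by the same masks approach each other. -/
theorem norm_integral_pushLaw_iterate_sub_le {F : ι → E → E} (hF : ∀ m, Continuous (F m)) {ρ : ℝ}
    (hρ0 : 0 ≤ ρ) (hρ : ∀ u v, ∫ m, ‖F m u - F m v‖ ∂μ ≤ ρ * ‖u - v‖) (k : ℕ)
    (π : Measure E) [IsProbabilityMeasure π] (b : E) (hπ : Integrable (fun u => ‖b - u‖) π)
    {f : E → ℂ} {C L : ℝ} (hL0 : 0 ≤ L)
    (hL : ∀ u v, ‖f u - f v‖ ≤ L * ‖u - v‖) (hC : ∀ u, ‖f u‖ ≤ C) :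
    ‖∫ x, f x ∂((pushLaw μ F)^[k] (Measure.dirac b)) - ∫ x, f x ∂((pushLaw μ F)^[k] π)‖ ≤
      L * ρ ^ k * ∫ u, ‖b - u‖ ∂π := by
  have hi := integrable_of_lipschitz_bounded (by positivity)
    (transOp_iterate_lipschitz μ hρ0 hρ k hL0 hL) (norm_transOp_iterate_le μ k hC) π
  rw [integral_pushLaw_iterate μ hF hρ0 hρ k _ hL0 hL hC,
    integral_pushLaw_iterate μ hF hρ0 hρ k _ hL0 hL hC, integral_dirac]
  have h1 : (transOp μ F)^[k] f b = ∫ _, (transOp μ F)^[k] f b ∂π := by simp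
  rw [h1, ← integral_sub (integrable_const _) hi, ← integral_const_mul]
  refine (norm_integral_le_integral_norm _).trans ?_
  exact integral_mono ((integrable_const _).sub hi).norm (hπ.const_mul _)
    fun u => transOp_iterate_lipschitz μ hρ0 hρ k hL0 hL b u

theorem norm_exp_inner_sub_le (t u v : E) :
    ‖Complex.exp ((inner ℝ u t : ℝ) * Complex.I) - Complex.exp ((inner ℝ v t : ℝ) * Complex.I)‖ ≤
      ‖t‖ * ‖u - v‖ := by
  have h : Complex.exp ((inner ℝ u t : ℝ) * Complex.I) - Complex.exp ((inner ℝ v t : ℝ) * Complex.I)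
      = Complex.exp ((inner ℝ v t : ℝ) * Complex.I) *
        (Complex.exp (Complex.I * (inner ℝ (u - v) t : ℝ)) - 1) := by
    rw [mul_sub, ← Complex.exp_add, inner_sub_left]
    push_cast
    ring_nf
  rw [h, norm_mul, Complex.norm_exp_ofReal_mul_I, one_mul, mul_comm ‖t‖]
  exact Real.norm_exp_I_mul_ofReal_sub_one_le.trans (norm_inner_le_norm (𝕜 := ℝ) (u - v) t)

/-- A random iteration that contracts in mean has at most one stationary law. -/
theorem pushLaw_fixed_unique {F : ι → E → E} (hF : ∀ m, Continuous (F m)) {ρ : ℝ}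
    (hρ0 : 0 ≤ ρ) (hρ1 : ρ < 1) (hρ : ∀ u v, ∫ m, ‖F m u - F m v‖ ∂μ ≤ ρ * ‖u - v‖)
    {π π' : Measure E} [IsProbabilityMeasure π] [IsProbabilityMeasure π']
    (h : pushLaw μ F π = π) (h' : pushLaw μ F π' = π') : π = π' := by
  refine Measure.ext_of_charFun (funext fun t => ?_)
  set f : E → ℂ := fun u => Complex.exp ((inner ℝ u t : ℝ) * Complex.I) with hf
  have hL : ∀ u v, ‖f u - f v‖ ≤ ‖t‖ * ‖u - v‖ := norm_exp_inner_sub_le t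
  have hC : ∀ u, ‖f u‖ ≤ 1 := fun u => (Complex.norm_exp_ofReal_mul_I _).le
  have hLk := fun k => transOp_iterate_lipschitz μ hρ0 hρ k (norm_nonneg t) hL
  have hCk := fun k => norm_transOp_iterate_le μ (F := F) k hC
  have hik : ∀ k (π : Measure E) [IsProbabilityMeasure π],
      Integrable ((transOp μ F)^[k] f) π := fun k π _ =>
    integrable_of_lipschitz_bounded (by positivity) (hLk k) (hCk k) π
  have hfix : ∀ k (π : Measure E) [IsProbabilityMeasure π], pushLaw μ F π = π →
      ∫ u, f u ∂π = ∫ u, (transOp μ F)^[k] f u ∂π := fun k π _ hπ => by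
    rw [← integral_pushLaw_iterate μ hF hρ0 hρ k π (norm_nonneg t) hL hC, Function.iterate_fixed hπ]
  -- No first moment of `π` or `π'` is assumed, so the bound `‖t‖ ρ^k ‖u - v‖` cannot be integrated.
  -- It gives pointwise convergence, and domination by the constant 2 does the rest.
  have hlim : Tendsto (fun k => ∫ z : E × E,
      ((transOp μ F)^[k] f z.1 - (transOp μ F)^[k] f z.2) ∂(π.prod π')) atTop
      (𝓝 (∫ z : E × E, (0 : ℂ) ∂(π.prod π'))) := by
    refine tendsto_integral_of_dominated_convergence (fun _ => 2) (fun k => ?_)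
      (integrable_const _) (fun k => ae_of_all _ fun z => ?_) (ae_of_all _ fun z => ?_)
    · have hc := continuous_of_norm_sub_le (by positivity) (hLk k)
      exact ((hc.comp continuous_fst).sub (hc.comp continuous_snd)).aestronglyMeasurable
    · exact (norm_sub_le _ _).trans (by linarith [hCk k z.1, hCk k z.2])
    · refine squeeze_zero_norm (fun k => hLk k z.1 z.2) ?_
      have := ((tendsto_pow_atTop_nhds_zero_of_lt_one hρ0 hρ1).const_mul ‖t‖).mul_const ‖z.1 - z.2‖
      simpa using this
  have hconst : ∀ k, ∫ z : E × E,
      ((transOp μ F)^[k] f z.1 - (transOp μ F)^[k] f z.2) ∂(π.prod π') =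
        charFun π t - charFun π' t := fun k => by
    rw [integral_sub ((hik k π).comp_fst π') ((hik k π').comp_snd π), charFun_apply, charFun_apply]
    rw [hfix k π h, hfix k π' h', integral_fun_fst, integral_fun_snd]
    simp
  simp only [hconst, integral_zero] at hlim
  exact sub_eq_zero.1 (tendsto_nhds_unique tendsto_const_nhds hlim)

end RandomIteration

/-! ### The shift on i.i.d. sequences. -/

section Shift

variable {ι : Type*} [MeasurableSpace ι] (μ : Measure ι) [IsProbabilityMeasure μ]

/-- Prepending a term to a sequence. -/
def seqCons {ι : Type*} (z : ι × (ℕ → ι)) : ℕ → ι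
  | 0 => z.1
  | k + 1 => z.2 k

theorem measurable_seqCons : Measurable (seqCons (ι := ι)) := by
  refine measurable_pi_iff.2 fun k => ?_
  cases k with
  | zero => exact measurable_fst
  | succ k => exact (measurable_pi_apply k).comp measurable_snd

theorem map_seqCons :
    (μ.prod (Measure.infinitePi fun _ : ℕ => μ)).map seqCons = Measure.infinitePi fun _ => μ := by
  classical
  refine Measure.eq_infinitePi _ fun s t ht => ?_
  obtain ⟨N, hN⟩ : ∃ N, s ⊆ Finset.range (N + 1) := by
    obtain ⟨N, hN⟩ := s.exists_nat_subset_range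
    exact ⟨N, hN.trans (Finset.range_mono (Nat.le_succ N))⟩
  -- Padding with `univ` turns the box over `s` into one over the initial segment `range (N + 1)`,
  -- which splits into index 0 and `N` shifted indices.
  set t' : ℕ → Set ι := fun i => if i ∈ s then t i else Set.univ with ht'
  have hm' : ∀ i, MeasurableSet (t' i) := fun i => by
    simp only [ht']; split_ifs; exacts [ht i, MeasurableSet.univ]
  have h1 : seqCons ⁻¹' (Set.pi s t) =
      t' 0 ×ˢ Set.pi (Finset.range N : Set ℕ) (fun i => t' (i + 1)) := by
    ext ⟨m, w⟩
    simp only [Set.mem_preimage, Set.mem_pi, Set.mem_prod, Finset.mem_coe, Finset.mem_range, ht']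
    constructor
    · intro h
      refine ⟨?_, fun i _ => ?_⟩
      · split_ifs with h0
        exacts [h 0 h0, trivial]
      · split_ifs with h0
        exacts [h (i + 1) h0, trivial]
    · rintro ⟨h0, h⟩ i hi
      cases i with
      | zero => simpa [hi, seqCons] using h0
      | succ i =>
        have hlt := Finset.mem_range.1 (hN hi)
        simpa [hi, seqCons] using h i (by omega)
  have hms : MeasurableSet (Set.pi (s : Set ℕ) t) := MeasurableSet.pi s.countable_toSet fun i _ => ht i
  rw [Measure.map_apply measurable_seqCons hms, h1, Measure.prod_prod,
    Measure.infinitePi_pi _ (fun i _ => hm' (i + 1))]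
  have h2 : ∏ i ∈ s, μ (t i) = ∏ i ∈ Finset.range (N + 1), μ (t' i) := by
    rw [← Finset.prod_subset hN (f := fun i => μ (t' i))]
    · exact Finset.prod_congr rfl fun i hi => by simp [ht', hi]
    · intro i _ hi
      simp [ht', hi]
  rw [h2, Finset.prod_range_succ', mul_comm]

theorem measurePreserving_head_tail :
    MeasurePreserving (fun w : ℕ → ι => (w 0, fun k => w (k + 1)))
      (Measure.infinitePi fun _ => μ) (μ.prod (Measure.infinitePi fun _ : ℕ => μ)) := by
  have hm : Measurable (fun w : ℕ → ι => (w 0, fun k => w (k + 1))) := by fun_prop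
  refine ⟨hm, ?_⟩
  conv_lhs => rw [← map_seqCons μ]
  rw [Measure.map_map hm measurable_seqCons]
  exact Measure.map_id

end Shift

end DropoutGD

namespace DropoutGD

/-! ### Existence of a stationary law, and the law of the iterates. -/

section Existence

open scoped ENNReal NNReal

variable {ι : Type*} [MeasurableSpace ι] [Finite ι] [MeasurableSingletonClass ι]
variable {E : Type*} [NormedAddCommGroup E] [InnerProductSpace ℝ E] [FiniteDimensional ℝ E]
  [MeasurableSpace E] [BorelSpace E] (μ : Measure ι) [IsProbabilityMeasure μ]

/-- The random variable `F (w 0) (Y (w 1, w 2, …))`. -/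
def backStep (F : ι → E → E) (Y : (ℕ → ι) → E) (w : ℕ → ι) : E :=
  F (w 0) (Y fun k => w (k + 1))

theorem measurable_backStep {F : ι → E → E} (hF : ∀ m, Continuous (F m))
    {Y : (ℕ → ι) → E} (hY : Measurable Y) : Measurable (backStep F Y) :=
  ((measurable_uncurry_of_finite hF).comp (measurable_id.prodMap hY)).comp
    (show Measurable (fun w : ℕ → ι => (w 0, fun k => w (k + 1))) by fun_prop)

/-- The head of an i.i.d. sequence is independent of its tail, and the tail has the law of the
whole. Hence an almost sure fixed point of `backStep F` has a law fixed by `pushLaw μ F`. -/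
theorem map_backStep {F : ι → E → E} (hF : ∀ m, Continuous (F m))
    {Y : (ℕ → ι) → E} (hY : Measurable Y) :
    (Measure.infinitePi fun _ => μ).map (backStep F Y) =
      pushLaw μ F ((Measure.infinitePi fun _ => μ).map Y) := by
  have hm := measurable_uncurry_of_finite hF
  have hmp := measurePreserving_head_tail μ
  have h := Measure.map_prod_map μ (Measure.infinitePi fun _ : ℕ => μ) measurable_id hY
  rw [Measure.map_id] at h
  rw [pushLaw, h, ← hmp.map_eq, Measure.map_map hm (measurable_id.prodMap hY),
    Measure.map_map (hm.comp (measurable_id.prodMap hY)) hmp.measurable]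
  rfl

/-- By Tonelli the head is integrated with the tail frozen, where `hκ` applies. -/
theorem lintegral_backStep_sub_le {F : ι → E → E} (hF : ∀ m, Continuous (F m)) {q : ℝ}
    {κ : ℝ≥0∞} (hκ : ∀ u v, ∫⁻ m, ‖F m u - F m v‖ₑ ^ q ∂μ ≤ κ * ‖u - v‖ₑ ^ q)
    {Y Z : (ℕ → ι) → E} (hY : Measurable Y) (hZ : Measurable Z) :
    ∫⁻ w, ‖backStep F Y w - backStep F Z w‖ₑ ^ q ∂(Measure.infinitePi fun _ => μ) ≤
      κ * ∫⁻ w, ‖Y w - Z w‖ₑ ^ q ∂(Measure.infinitePi fun _ => μ) := by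
  have hmp := measurePreserving_head_tail μ
  have hm := measurable_uncurry_of_finite hF
  have hint : Measurable (fun z : ι × (ℕ → ι) => ‖F z.1 (Y z.2) - F z.1 (Z z.2)‖ₑ ^ q) :=
    (((hm.comp (measurable_id.prodMap hY)).sub (hm.comp (measurable_id.prodMap hZ))).enorm).pow_const q
  have e : ∫⁻ w, ‖backStep F Y w - backStep F Z w‖ₑ ^ q ∂(Measure.infinitePi fun _ => μ) =
      ∫⁻ z, ‖F z.1 (Y z.2) - F z.1 (Z z.2)‖ₑ ^ q ∂(μ.prod (Measure.infinitePi fun _ : ℕ => μ)) := by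
    rw [← hmp.map_eq, lintegral_map hint hmp.measurable]
    rfl
  rw [e, lintegral_prod_symm' _ hint,
    ← lintegral_const_mul κ (f := fun w => ‖Y w - Z w‖ₑ ^ q) ((hY.sub hZ).enorm.pow_const q)]
  exact lintegral_mono fun w => hκ _ _

/-- A random iteration that contracts in `L^q` has a stationary law with a moment of order `q`. -/
theorem exists_pushLaw_fixed {F : ι → E → E} (hF : ∀ m, Continuous (F m)) {q : ℝ} (hq : 1 ≤ q)
    {κ : ℝ≥0} (hκ1 : κ < 1)
    (hκ : ∀ u v, ∫⁻ m, ‖F m u - F m v‖ₑ ^ q ∂μ ≤ κ * ‖u - v‖ₑ ^ q) :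
    ∃ π : Measure E, IsProbabilityMeasure π ∧ pushLaw μ F π = π ∧
      MemLp id (ENNReal.ofReal q) π := by
  set Q : Measure (ℕ → ι) := Measure.infinitePi fun _ => μ with hQ
  have hq0 : 0 < q := by linarith
  have : Fact (1 ≤ ENNReal.ofReal q) := ⟨by simpa using hq⟩
  have hsub : ∀ Y Z : (ℕ → ι) → E, Measurable Y → Measurable Z →
      eLpNorm (backStep F Y - backStep F Z) (ENNReal.ofReal q) Q ≤
        (κ ^ (1 / q) : ℝ≥0) * eLpNorm (Y - Z) (ENNReal.ofReal q) Q := fun Y Z hY hZ => by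
    rw [eLpNorm_eq_lintegral_rpow_enorm_toReal (by simpa using hq0) ENNReal.ofReal_ne_top,
      eLpNorm_eq_lintegral_rpow_enorm_toReal (by simpa using hq0) ENNReal.ofReal_ne_top,
      ENNReal.toReal_ofReal hq0.le, ENNReal.coe_rpow_of_nonneg _ (by positivity),
      ← ENNReal.mul_rpow_of_nonneg _ _ (by positivity)]
    exact ENNReal.rpow_le_rpow (lintegral_backStep_sub_le μ hF hκ hY hZ) (by positivity)
  have hmem : ∀ Y : (ℕ → ι) → E, Measurable Y → MemLp Y (ENNReal.ofReal q) Q →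
      MemLp (backStep F Y) (ENNReal.ofReal q) Q := fun Y hYm hY => by
    -- There are finitely many masks, so the image of the zero variable is bounded; the other
    -- variables are compared with it.
    have h0 : MemLp (backStep F (fun _ => (0 : E))) (ENNReal.ofReal q) Q := by
      have hb : ∃ C, ∀ m, ‖F m 0‖ ≤ C := by
        obtain ⟨C, hC⟩ := (Set.finite_range fun m => ‖F m 0‖).bddAbove
        exact ⟨C, fun m => hC ⟨m, rfl⟩⟩
      obtain ⟨C, hC⟩ := hb
      exact MemLp.of_bound (measurable_backStep hF measurable_const).aestronglyMeasurable C
        (ae_of_all _ fun w => hC _)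
    have hd : MemLp (backStep F Y - backStep F (fun _ => (0 : E))) (ENNReal.ofReal q) Q := by
      refine ⟨(measurable_backStep hF hYm).aestronglyMeasurable.sub h0.1, ?_⟩
      refine (hsub _ _ hYm measurable_const).trans_lt ?_
      refine ENNReal.mul_lt_top ENNReal.coe_lt_top ?_
      have : Y - (fun _ => (0 : E)) = Y := by ext; simp
      rw [this]
      exact hY.2
    simpa using hd.add h0
  -- Banach's fixed point theorem in the complete space `L^q` of functions of the mask sequence,
  -- with contraction constant `κ^(1/q)`.
  let Φ : Lp E (ENNReal.ofReal q) Q → Lp E (ENNReal.ofReal q) Q := fun Y =>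
    (hmem Y (Lp.stronglyMeasurable Y).measurable (Lp.memLp Y)).toLp _
  have hΦ : ContractingWith (κ ^ (1 / q)) Φ := by
    refine ⟨NNReal.rpow_lt_one hκ1 (by positivity), fun Y Z => ?_⟩
    rw [Lp.edist_def, Lp.edist_def]
    refine le_trans (le_of_eq (eLpNorm_congr_ae ?_)) (hsub Y Z (Lp.stronglyMeasurable Y).measurable (Lp.stronglyMeasurable Z).measurable)
    exact (MemLp.coeFn_toLp _).sub (MemLp.coeFn_toLp _)
  set Y := ContractingWith.fixedPoint Φ hΦ with hYdef
  have hY : Φ Y = Y := hΦ.fixedPoint_isFixedPt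
  have hYm := (Lp.stronglyMeasurable Y).measurable
  have hae : backStep F Y =ᵐ[Q] Y := by
    have h1 : (Φ Y : (ℕ → ι) → E) =ᵐ[Q] backStep F Y := MemLp.coeFn_toLp _
    rw [hY] at h1
    exact h1.symm
  refine ⟨Q.map Y, Measure.isProbabilityMeasure_map hYm.aemeasurable, ?_, ?_⟩
  · rw [← map_backStep μ hF hYm]
    exact Measure.map_congr hae
  · exact (memLp_map_measure_iff aestronglyMeasurable_id hYm.aemeasurable).2 (Lp.memLp Y)

theorem randIter_seqCons {κ V : Type*} (F : κ → V → V) (z : κ × (ℕ → κ)) (u : V) (k : ℕ) :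
    randIter F (seqCons z) u (k + 1) = randIter F z.2 (F z.1 u) k := by
  induction k with
  | zero => rfl
  | succ k ih =>
    rw [randIter, ih]
    rfl

theorem measurable_randIter {F : ι → E → E} (hF : ∀ m, Continuous (F m)) (k : ℕ) :
    Measurable (fun z : E × (ℕ → ι) => randIter F z.2 z.1 k) := by
  induction k with
  | zero => exact measurable_fst
  | succ k ih =>
    exact (measurable_uncurry_of_finite hF).comp
      (((measurable_pi_apply k).comp measurable_snd).prodMk ih)

/-- The first step is peeled off, not the last: the head mask is absorbed into the start, whose law
becomes `pushLaw μ F π` and which stays independent of the shifted sequence. This is why the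
induction varies `π`. -/
theorem map_randIter_prod {F : ι → E → E} (hF : ∀ m, Continuous (F m)) (k : ℕ)
    (π : Measure E) [IsProbabilityMeasure π] :
    (π.prod (Measure.infinitePi fun _ => μ)).map (fun z => randIter F z.2 z.1 k) =
      (pushLaw μ F)^[k] π := by
  induction k generalizing π with
  | zero =>
    simp only [Function.iterate_zero, id]
    exact (measurePreserving_fst (μ := π) (ν := Measure.infinitePi fun _ : ℕ => μ)).map_eq
  | succ k ih =>
    have := isProbabilityMeasure_pushLaw μ hF π
    have hm := measurable_uncurry_of_finite hF
    rw [Function.iterate_succ_apply, ← ih (pushLaw μ F π)]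
    have hstep : Measurable (fun z : E × (ι × (ℕ → ι)) => (F z.2.1 z.1, z.2.2)) :=
      (hm.comp (measurable_snd.fst.prodMk measurable_fst)).prodMk measurable_snd.snd
    have e1 : π.prod (Measure.infinitePi fun _ => μ) =
        (π.prod (μ.prod (Measure.infinitePi fun _ : ℕ => μ))).map (Prod.map id seqCons) := by
      rw [← Measure.map_prod_map _ _ measurable_id measurable_seqCons, map_seqCons, Measure.map_id]
    have e2 : (pushLaw μ F π).prod (Measure.infinitePi fun _ => μ) =
        (π.prod (μ.prod (Measure.infinitePi fun _ : ℕ => μ))).map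
          (fun z => (F z.2.1 z.1, z.2.2)) := by
      have e3 : (pushLaw μ F π).prod (Measure.infinitePi fun _ => μ) =
          ((μ.prod π).prod (Measure.infinitePi fun _ : ℕ => μ)).map
            (Prod.map (fun z => F z.1 z.2) id) := by
        rw [← Measure.map_prod_map _ _ hm measurable_id, Measure.map_id]
        rfl
      have e4 : (μ.prod π).prod (Measure.infinitePi fun _ : ℕ => μ) =
          ((π.prod μ).prod (Measure.infinitePi fun _ : ℕ => μ)).map (Prod.map Prod.swap id) := by
        rw [← Measure.map_prod_map _ _ measurable_swap measurable_id, Measure.map_id,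
          Measure.prod_swap]
      rw [e3, e4, Measure.map_map (hm.prodMap measurable_id) (measurable_swap.prodMap measurable_id),
        ← (measurePreserving_prodAssoc π μ (Measure.infinitePi fun _ : ℕ => μ)).map_eq,
        Measure.map_map hstep MeasurableEquiv.prodAssoc.measurable]
      rfl
    rw [e1, e2, Measure.map_map (measurable_randIter hF _) (measurable_id.prodMap measurable_seqCons),
      Measure.map_map (measurable_randIter hF _) hstep]
    congr 1
    ext z : 1
    exact randIter_seqCons F z.2 z.1 k

/-- The law of the iterates, for a start that is independent of the driving sequence. -/
theorem map_randIter {Ω : Type*} [MeasurableSpace Ω] {P : Measure Ω} [IsProbabilityMeasure P]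
    {F : ι → E → E} (hF : ∀ m, Continuous (F m)) {D : ℕ → Ω → ι} (hm : ∀ k, AEMeasurable (D k) P)
    (hD : ∀ k, P.map (D k) = μ) (hi : iIndepFun D P) {b : Ω → E} (hb : Measurable b)
    (hbD : IndepFun b (fun ω k => D k ω) P) (k : ℕ) :
    P.map (fun ω => randIter F (fun j => D j ω) (b ω) k) = (pushLaw μ F)^[k] (P.map b) := by
  have := Measure.isProbabilityMeasure_map (μ := P) hb.aemeasurable
  have hDm : AEMeasurable (fun ω k => D k ω) P := aemeasurable_pi_iff.2 hm
  have h1 : P.map (fun ω k => D k ω) = Measure.infinitePi fun _ => μ := by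
    rw [hi.map_fun_eq_infinitePi_map₀ hDm]
    simp_rw [hD]
  rw [← map_randIter_prod μ hF, ← h1,
    ← (indepFun_iff_map_prod_eq_prod_map_map hb.aemeasurable hDm).1 hbD,
    AEMeasurable.map_map_of_aemeasurable (measurable_randIter hF k).aemeasurable
      (hb.aemeasurable.prodMk hDm)]
  rfl

theorem aemeasurable_randIter {Ω : Type*} [MeasurableSpace Ω] {P : Measure Ω}
    {F : ι → E → E} (hF : ∀ m, Continuous (F m)) {D : ℕ → Ω → ι} (hm : ∀ k, AEMeasurable (D k) P)
    {b : Ω → E} (hb : Measurable b) (k : ℕ) :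
    AEMeasurable (fun ω => randIter F (fun j => D j ω) (b ω) k) P :=
  (measurable_randIter hF k).comp_aemeasurable
    (hb.aemeasurable.prodMk (aemeasurable_pi_iff.2 hm : AEMeasurable (fun ω k => D k ω) P))

end Existence

end DropoutGD

namespace DropoutGD

/-! ### Taylor bounds for `exp(i x)`. -/

section ExpBounds

theorem norm_exp_mul_I_sub_one_le (x : ℝ) : ‖Complex.exp (x * Complex.I) - 1‖ ≤ |x| := by
  rw [mul_comm]; exact Real.norm_exp_I_mul_ofReal_sub_one_le

/-- Taylor's remainder covers `|x| ≤ 1`, where `exp |x| ≤ 4`, and the triangle inequality the rest.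
The bound must hold for every real `x`, since it is later integrated over an unbounded state. -/
theorem norm_exp_mul_I_sub_one_sub_le (x : ℝ) :
    ‖Complex.exp (x * Complex.I) - 1 - x * Complex.I‖ ≤ 4 * x ^ 2 := by
  have hn : ‖(x : ℂ) * Complex.I‖ = |x| := by simp
  rcases le_or_gt |x| 1 with h | h
  · have h1 := Complex.norm_exp_sub_sum_le_norm_mul_exp (x * Complex.I) 2
    rw [hn] at h1
    simp only [Finset.sum_range_succ, Finset.sum_range_zero, Nat.factorial, pow_zero, pow_one] at h1
    have h2 : Real.exp |x| ≤ 4 := (Real.exp_le_exp.2 h).trans (by linarith [Real.exp_one_lt_d9])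
    calc _ ≤ |x| ^ 2 * Real.exp |x| := by
          refine le_trans (le_of_eq ?_) h1
          congr 1; push_cast; ring
      _ ≤ |x| ^ 2 * 4 := by gcongr
      _ = _ := by rw [sq_abs]; ring
  · calc _ ≤ ‖Complex.exp (x * Complex.I) - 1‖ + ‖(x : ℂ) * Complex.I‖ := norm_sub_le _ _
      _ ≤ |x| + |x| := add_le_add (norm_exp_mul_I_sub_one_le x) hn.le
      _ ≤ 4 * |x| ^ 2 := by nlinarith
      _ = _ := by rw [sq_abs]

theorem norm_exp_mul_I_sub_taylor_two_le (x : ℝ) :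
    ‖Complex.exp (x * Complex.I) - 1 - x * Complex.I + x ^ 2 / 2‖ ≤ 5 * |x| ^ 3 := by
  have hn : ‖(x : ℂ) * Complex.I‖ = |x| := by simp
  rcases le_or_gt |x| 1 with h | h
  · have h1 := Complex.norm_exp_sub_sum_le_norm_mul_exp (x * Complex.I) 3
    rw [hn] at h1
    simp only [Finset.sum_range_succ, Finset.sum_range_zero, Nat.factorial, pow_zero, pow_one] at h1
    have h2 : Real.exp |x| ≤ 5 := (Real.exp_le_exp.2 h).trans (by linarith [Real.exp_one_lt_d9])
    calc _ ≤ |x| ^ 3 * Real.exp |x| := by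
          refine le_trans (le_of_eq ?_) h1
          congr 1; push_cast; rw [mul_pow, Complex.I_sq]; ring
      _ ≤ |x| ^ 3 * 5 := by gcongr
      _ = _ := by ring
  · calc _ ≤ ‖Complex.exp (x * Complex.I) - 1 - x * Complex.I‖ + ‖(x : ℂ) ^ 2 / 2‖ := norm_add_le _ _
      _ ≤ 4 * x ^ 2 + |x| ^ 2 / 2 := by
          refine add_le_add (norm_exp_mul_I_sub_one_sub_le x) (le_of_eq ?_)
          simp
      _ ≤ 5 * |x| ^ 3 := by
          rw [← sq_abs x]
          have : |x| ^ 2 ≤ |x| ^ 3 := pow_le_pow_right₀ h.le (by norm_num)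
          nlinarith [sq_nonneg |x|]

/-- In the application `a` has order `α` and `b` order `√α`. So `a` is expanded to first order and
`b` to second, leaving an error of order `α^{3/2}`. -/
theorem norm_exp_add_mul_I_sub_taylor_le (a b : ℝ) :
    ‖Complex.exp ((a + b : ℝ) * Complex.I) -
      (1 + a * Complex.I + b * Complex.I - (b : ℂ) ^ 2 / 2)‖ ≤
      4 * a ^ 2 + |a| * |b| + 5 * |b| ^ 3 := by
  have e : Complex.exp ((a + b : ℝ) * Complex.I) -
      (1 + a * Complex.I + b * Complex.I - (b : ℂ) ^ 2 / 2) =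
      Complex.exp (b * Complex.I) * (Complex.exp (a * Complex.I) - 1 - a * Complex.I) +
      (Complex.exp (b * Complex.I) - 1) * (a * Complex.I) +
      (Complex.exp (b * Complex.I) - 1 - b * Complex.I + (b : ℂ) ^ 2 / 2) := by
    push_cast
    rw [add_mul, Complex.exp_add]
    ring
  rw [e]
  refine (norm_add₃_le).trans ?_
  rw [norm_mul, norm_mul, Complex.norm_exp_ofReal_mul_I, one_mul]
  refine add_le_add (add_le_add (norm_exp_mul_I_sub_one_sub_le a) ?_)
    (norm_exp_mul_I_sub_taylor_two_le b)
  rw [mul_comm]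
  have : ‖(a : ℂ) * Complex.I‖ = |a| := by simp
  rw [this]
  gcongr
  exact norm_exp_mul_I_sub_one_le b

theorem norm_exp_mul_I_mul_sub_le (c w : ℝ) :
    ‖Complex.exp (c * Complex.I) * (1 - w) - (1 + c * Complex.I - w)‖ ≤ 4 * c ^ 2 + |c| * |w| := by
  have e : Complex.exp (c * Complex.I) * (1 - w) - (1 + c * Complex.I - w) =
      (Complex.exp (c * Complex.I) - 1 - c * Complex.I) - (Complex.exp (c * Complex.I) - 1) * w := by
    ring
  rw [e]
  refine (norm_sub_le _ _).trans (add_le_add (norm_exp_mul_I_sub_one_sub_le c) ?_)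
  rw [norm_mul, Complex.norm_real, Real.norm_eq_abs]
  gcongr
  exact norm_exp_mul_I_sub_one_le c

end ExpBounds

/-! ### A discrete Gronwall inequality along a contraction. -/

section Iterate

variable {E : Type*} [NormedAddCommGroup E] [InnerProductSpace ℝ E]

/-- Iterating `B` drives the argument to 0, where `Δ` vanishes, and the accumulated errors form a
geometric series. -/
theorem le_of_le_comp_add {Δ : E → ℝ} (hΔ : ContinuousAt Δ 0) (hΔ0 : Δ 0 = 0) {B : E → E} {ρ : ℝ}
    (hρ0 : 0 ≤ ρ) (hρ1 : ρ < 1) (hB : ∀ t, ‖B t‖ ≤ ρ * ‖t‖) {c R : ℝ} (hc : 0 ≤ c)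
    (h : ∀ t, ‖t‖ ≤ R → Δ t ≤ Δ (B t) + c * ‖t‖ ^ 2) {t : E} (ht : ‖t‖ ≤ R) :
    Δ t ≤ c * R ^ 2 / (1 - ρ) := by
  have hR : 0 ≤ R := (norm_nonneg t).trans ht
  have hBn : ∀ n, ‖B^[n] t‖ ≤ ρ ^ n * ‖t‖ := fun n => by
    induction n with
    | zero => simp
    | succ n ih =>
      rw [Function.iterate_succ_apply']
      calc _ ≤ ρ * ‖B^[n] t‖ := hB _
        _ ≤ ρ * (ρ ^ n * ‖t‖) := by gcongr
        _ = _ := by ring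
  have hBR : ∀ n, ‖B^[n] t‖ ≤ R := fun n => (hBn n).trans <|
    (mul_le_of_le_one_left (norm_nonneg _) (pow_le_one₀ hρ0 hρ1.le)).trans ht
  have hstep : ∀ n, Δ t ≤ Δ (B^[n] t) + c * R ^ 2 * ∑ i ∈ Finset.range n, ρ ^ i := fun n => by
    induction n with
    | zero => simp
    | succ n ih =>
      have h1 := h _ (hBR n)
      -- Only one of the two available factors `ρ ^ n` is kept; the series then sums to exactly `1 /
      -- (1 - ρ)`.
      have h2 : ‖B^[n] t‖ ^ 2 ≤ R ^ 2 * ρ ^ n := by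
        calc ‖B^[n] t‖ ^ 2 = ‖B^[n] t‖ * ‖B^[n] t‖ := by ring
          _ ≤ R * (ρ ^ n * ‖t‖) := mul_le_mul (hBR n) (hBn n) (norm_nonneg _) hR
          _ ≤ R * (ρ ^ n * R) := by gcongr
          _ = _ := by ring
      rw [Function.iterate_succ_apply', Finset.sum_range_succ]
      have h3 := mul_le_mul_of_nonneg_left h2 hc
      nlinarith
  have hsum : ∀ n, ∑ i ∈ Finset.range n, ρ ^ i ≤ (1 - ρ)⁻¹ := fun n => by
    rw [← tsum_geometric_of_lt_one hρ0 hρ1]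
    exact (summable_geometric_of_lt_one hρ0 hρ1).sum_le_tsum _ fun i _ => by positivity
  have hlim : Tendsto (fun n => Δ (B^[n] t) + c * R ^ 2 * (1 - ρ)⁻¹) atTop
      (𝓝 (0 + c * R ^ 2 * (1 - ρ)⁻¹)) := by
    refine Tendsto.add_const _ ?_
    have h0 : Tendsto (fun n => B^[n] t) atTop (𝓝 0) := by
      refine squeeze_zero_norm hBn ?_
      simpa using (tendsto_pow_atTop_nhds_zero_of_lt_one hρ0 hρ1).mul_const ‖t‖
    have := hΔ.tendsto.comp h0
    rwa [hΔ0] at this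
  rw [zero_add, ← div_eq_mul_inv] at hlim
  refine ge_of_tendsto' hlim fun n => (hstep n).trans ?_
  rw [div_eq_mul_inv]
  gcongr
  exact hsum n

end Iterate

/-! ### One step of the rescaled recursion, tested against characters. -/

section LinearNoise

variable {ι : Type*} [MeasurableSpace ι] [Finite ι] [MeasurableSingletonClass ι]
variable {E : Type*} [NormedAddCommGroup E] [InnerProductSpace ℝ E] [FiniteDimensional ℝ E]
  [MeasurableSpace E] [BorelSpace E] (μ : Measure ι) [IsProbabilityMeasure μ]

/-- The rescaled step `z ↦ (1 - α M) z + √α h`. -/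
noncomputable def scaledStep (M : ι → E →L[ℝ] E) (h : ι → E) (α : ℝ) (m : ι) (z : E) : E :=
  z - α • M m z + √α • h m

theorem continuous_scaledStep (M : ι → E →L[ℝ] E) (h : ι → E) (α : ℝ) (m : ι) :
    Continuous (scaledStep M h α m) := by
  unfold scaledStep; fun_prop

variable {M : ι → E →L[ℝ] E} {h : ι → E} {G : E →L[ℝ] E} {K : ℝ}

theorem abs_integral_le_of_abs_le {f : ι → ℝ} {C : ℝ} (hf : ∀ m, |f m| ≤ C) : |∫ m, f m ∂μ| ≤ C := by
  have := norm_integral_le_of_norm_le_const (μ := μ) (ae_of_all μ fun m => (Real.norm_eq_abs (f m)).trans_le (hf m))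
  simpa using this

/-- Here `r` stands for `√α`, `n` for `‖z‖` and `N` for `‖t‖`. Each of the five products is at most
`α r K³ N² (1 + N) (1 + n²)`, and their coefficients `4 + 1 + 5 + 4 + 1` add up to 15. The growth in
`n` is only quadratic, so second moments will suffice. -/
theorem taylor_error_le {α r K n N : ℝ} (hα0 : 0 ≤ α) (hαr : α ≤ r) (hrr : r * r = α)
    (hK : 1 ≤ K) (hn0 : 0 ≤ n) (hN0 : 0 ≤ N) :
    4 * (α * K * n * N) ^ 2 + (α * K * n * N) * (r * K * N) + 5 * (r * K * N) ^ 3 +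
      (4 * (α * K * n * N) ^ 2 + (α * K * n * N) * (α * (K ^ 2 * N ^ 2) / 2)) ≤
      15 * (α * r) * K ^ 3 * N ^ 2 * (1 + N) * (1 + n ^ 2) := by
  have hr0 : 0 ≤ r := hα0.trans hαr
  have hK0 : 0 ≤ K := by linarith
  have hK2 : K ^ 2 ≤ K ^ 3 := pow_le_pow_right₀ hK (by norm_num)
  have hn1 : n ≤ 1 + n ^ 2 := by nlinarith [sq_nonneg (n - 1)]
  have hq1 : n ^ 2 ≤ (1 + N) * (1 + n ^ 2) := by nlinarith [mul_nonneg hN0 (sq_nonneg n)]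
  have hq2 : n ≤ (1 + N) * (1 + n ^ 2) := by nlinarith [mul_nonneg hN0 (sq_nonneg n)]
  have hq3 : N ≤ (1 + N) * (1 + n ^ 2) := by nlinarith [mul_nonneg hN0 (sq_nonneg n)]
  have hq4 : N * (n / 2) ≤ (1 + N) * (1 + n ^ 2) := by
    have h := mul_le_mul_of_nonneg_left hn1 hN0
    nlinarith [mul_nonneg hN0 (sq_nonneg n)]
  have hαα : α * α ≤ α * r := mul_le_mul_of_nonneg_left hαr hα0
  have p1 : (α * K * n * N) ^ 2 ≤ α * r * K ^ 3 * N ^ 2 * ((1 + N) * (1 + n ^ 2)) := by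
    calc (α * K * n * N) ^ 2 = α * α * K ^ 2 * N ^ 2 * n ^ 2 := by ring
      _ ≤ _ := by gcongr
  have p2 : (α * K * n * N) * (r * K * N) ≤ α * r * K ^ 3 * N ^ 2 * ((1 + N) * (1 + n ^ 2)) := by
    calc (α * K * n * N) * (r * K * N) = α * r * K ^ 2 * N ^ 2 * n := by ring
      _ ≤ _ := by gcongr
  have p3 : (r * K * N) ^ 3 ≤ α * r * K ^ 3 * N ^ 2 * ((1 + N) * (1 + n ^ 2)) := by
    calc (r * K * N) ^ 3 = (r * r) * r * K ^ 3 * N ^ 2 * N := by ring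
      _ = α * r * K ^ 3 * N ^ 2 * N := by rw [hrr]
      _ ≤ _ := by gcongr
  have p4 : (α * K * n * N) * (α * (K ^ 2 * N ^ 2) / 2) ≤
      α * r * K ^ 3 * N ^ 2 * ((1 + N) * (1 + n ^ 2)) := by
    calc (α * K * n * N) * (α * (K ^ 2 * N ^ 2) / 2) = α * α * K ^ 3 * N ^ 2 * (N * (n / 2)) := by ring
      _ ≤ _ := by gcongr
  linarith

/-- The exponent splits into `⟨z, t⟩`, a part `a` from `M` and a part `b` from `h`. After averaging,
`a` leaves the drift `-α ⟨z, G t⟩`, the linear term in `b` vanishes, and `b²` leaves `α s`.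
Fluctuations of `M` about its mean enter only the error. -/
theorem norm_integral_exp_scaledStep_sub_le (hK : 1 ≤ K) (hM : ∀ m, ‖M m‖ ≤ K)
    (hh : ∀ m, ‖h m‖ ≤ K) (hGK : ‖G‖ ≤ K)
    (hG : ∀ t z, ∫ m, inner ℝ (M m z) t ∂μ = inner ℝ z (G t))
    (h0 : ∀ t, ∫ m, inner ℝ (h m) t ∂μ = 0) {α : ℝ} (hα0 : 0 ≤ α) (hα1 : α ≤ 1) (t z : E) :
    ‖∫ m, Complex.exp ((inner ℝ (scaledStep M h α m z) t : ℝ) * Complex.I) ∂μ -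
      Complex.exp ((inner ℝ z (t - α • G t) : ℝ) * Complex.I) *
        (1 - (α * (∫ m, (inner ℝ (h m) t) ^ 2 ∂μ) / 2 : ℝ))‖ ≤
      15 * (α * √α) * K ^ 3 * ‖t‖ ^ 2 * (1 + ‖t‖) * (1 + ‖z‖ ^ 2) := by
  set s := ∫ m, (inner ℝ (h m) t) ^ 2 ∂μ with hs
  set a : ι → ℝ := fun m => -(α * inner ℝ (M m z) t) with ha
  set b : ι → ℝ := fun m => √α * inner ℝ (h m) t with hb
  set c : ℝ := -(α * inner ℝ z (G t)) with hc
  set N := ‖t‖ with hN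
  set n := ‖z‖ with hn
  have hN0 : 0 ≤ N := norm_nonneg _
  have hn0 : 0 ≤ n := norm_nonneg _
  have hr0 : 0 ≤ √α := Real.sqrt_nonneg _
  have hr1 : √α ≤ 1 := Real.sqrt_le_one.2 hα1
  have hrr : √α * √α = α := Real.mul_self_sqrt hα0
  have hαr : α ≤ √α := by nlinarith
  have haK : ∀ m, |a m| ≤ α * K * n * N := fun m => by
    rw [ha, abs_neg, abs_mul, abs_of_nonneg hα0, mul_assoc α, mul_assoc α]
    gcongr
    refine (abs_real_inner_le_norm _ _).trans ?_
    gcongr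
    exact ((M m).le_opNorm z).trans (by gcongr; exact hM m)
  have hbK : ∀ m, |b m| ≤ √α * K * N := fun m => by
    rw [hb, abs_mul, abs_of_nonneg hr0, mul_assoc]
    gcongr
    refine (abs_real_inner_le_norm _ _).trans ?_
    gcongr
    exact hh m
  have hcK : |c| ≤ α * K * n * N := by
    rw [hc, abs_neg, abs_mul, abs_of_nonneg hα0]
    calc α * |inner ℝ z (G t)| ≤ α * (n * (K * N)) := by
          gcongr
          refine (abs_real_inner_le_norm _ _).trans ?_
          gcongr
          exact (G.le_opNorm t).trans (by gcongr)
      _ = _ := by ring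
  have hsK : |s| ≤ K ^ 2 * N ^ 2 := abs_integral_le_of_abs_le μ fun m => by
    rw [abs_pow, ← mul_pow]
    gcongr
    refine (abs_real_inner_le_norm _ _).trans ?_
    gcongr
    exact hh m
  have hsplit : ∀ m, inner ℝ (scaledStep M h α m z) t = inner ℝ z t + (a m + b m) := fun m => by
    rw [scaledStep, inner_add_left, inner_sub_left, inner_smul_left, inner_smul_left]
    simp [ha, hb]; ring
  have hsplit2 : inner ℝ z (t - α • G t) = inner ℝ z t + c := by
    rw [inner_sub_right, inner_smul_right]; simp [hc]; ring
  have e1 : ∫ m, Complex.exp ((inner ℝ (scaledStep M h α m z) t : ℝ) * Complex.I) ∂μ =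
      Complex.exp ((inner ℝ z t : ℝ) * Complex.I) *
        ∫ m, Complex.exp ((a m + b m : ℝ) * Complex.I) ∂μ := by
    rw [← integral_const_mul]
    congr 1; ext m
    rw [hsplit, ← Complex.exp_add]; push_cast; ring_nf
  have e2 : Complex.exp ((inner ℝ z (t - α • G t) : ℝ) * Complex.I) =
      Complex.exp ((inner ℝ z t : ℝ) * Complex.I) * Complex.exp (c * Complex.I) := by
    rw [hsplit2, ← Complex.exp_add]; push_cast; ring_nf
  have ia : ∫ m, (a m : ℂ) ∂μ = c := by
    rw [integral_complex_ofReal]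
    simp only [ha, hc, integral_neg, integral_const_mul, hG]
  have ib : ∫ m, (b m : ℂ) ∂μ = 0 := by
    rw [integral_complex_ofReal]
    simp only [hb, integral_const_mul, h0, mul_zero, Complex.ofReal_zero]
  have ibb : ∫ m, ((b m : ℂ) ^ 2) ∂μ = (α * s : ℝ) := by
    have : ∀ m, ((b m : ℂ)) ^ 2 = ((α * (inner ℝ (h m) t) ^ 2 : ℝ) : ℂ) := fun m => by
      rw [← Complex.ofReal_pow, hb, mul_pow, Real.sq_sqrt hα0]
    simp only [this]
    rw [integral_complex_ofReal, integral_const_mul]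
  have e3 : ∫ m, (1 + a m * Complex.I + b m * Complex.I - (b m : ℂ) ^ 2 / 2) ∂μ =
      1 + c * Complex.I - (α * s / 2 : ℝ) := by
    rw [integral_sub (integrable_of_finite' _ _) (integrable_of_finite' _ _),
      integral_add (integrable_of_finite' _ _) (integrable_of_finite' _ _),
      integral_add (integrable_of_finite' _ _) (integrable_of_finite' _ _),
      integral_mul_const, integral_mul_const, ia, ib, integral_div, ibb]
    simp
  have h1 : ‖∫ m, Complex.exp ((a m + b m : ℝ) * Complex.I) ∂μ -
      (1 + c * Complex.I - (α * s / 2 : ℝ))‖ ≤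
      4 * (α * K * n * N) ^ 2 + (α * K * n * N) * (√α * K * N) + 5 * (√α * K * N) ^ 3 := by
    rw [← e3, ← integral_sub (integrable_of_finite' _ _) (integrable_of_finite' _ _)]
    refine (norm_integral_le_of_norm_le_const (ae_of_all _ fun m =>
      (norm_exp_add_mul_I_sub_taylor_le (a m) (b m)).trans (?_ : _ ≤
        4 * (α * K * n * N) ^ 2 + (α * K * n * N) * (√α * K * N) + 5 * (√α * K * N) ^ 3))).trans ?_
    · rw [← sq_abs (a m)]
      gcongr
      exacts [haK m, haK m, hbK m, hbK m]
    · simp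
  have h2 := norm_exp_mul_I_mul_sub_le c (α * s / 2)
  have h3 : |α * s / 2| ≤ α * (K ^ 2 * N ^ 2) / 2 := by
    rw [abs_div, abs_mul, abs_of_nonneg hα0, abs_two]
    gcongr
  have h4 : 4 * c ^ 2 + |c| * |α * s / 2| ≤
      4 * (α * K * n * N) ^ 2 + (α * K * n * N) * (α * (K ^ 2 * N ^ 2) / 2) := by
    rw [← sq_abs c]
    gcongr
  rw [e1, e2, mul_assoc, ← mul_sub, norm_mul, Complex.norm_exp_ofReal_mul_I, one_mul]
  refine (norm_sub_le_norm_sub_add_norm_sub _ (1 + c * Complex.I - (α * s / 2 : ℝ)) _).trans ?_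
  rw [norm_sub_rev (1 + c * Complex.I - (α * s / 2 : ℝ) : ℂ)]
  refine (add_le_add h1 (h2.trans h4)).trans ?_
  have := taylor_error_le hα0 hαr hrr hK hn0 hN0
  linarith

end LinearNoise

end DropoutGD

namespace DropoutGD

/-! ### Stationary laws of the rescaled recursion: uniform second moments and comparison with a
Gaussian law. -/

section LinearNoise

variable {ι : Type*} [MeasurableSpace ι] [Finite ι] [MeasurableSingletonClass ι]
variable {E : Type*} [NormedAddCommGroup E] [InnerProductSpace ℝ E] [FiniteDimensional ℝ E]
  [MeasurableSpace E] [BorelSpace E] (μ : Measure ι) [IsProbabilityMeasure μ]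
variable {M : ι → E →L[ℝ] E} {h : ι → E} {G : E →L[ℝ] E} {K : ℝ}

/-- The cross term of `z` and `h` averages to zero. The one of `M z` and `h` is linear in `‖z‖` and
is absorbed by half of the decay `l α ‖z‖²`. -/
theorem integral_norm_sq_scaledStep_le (hK : 1 ≤ K) (hM : ∀ m, ‖M m‖ ≤ K)
    (hh : ∀ m, ‖h m‖ ≤ K) (h0 : ∀ t, ∫ m, inner ℝ (h m) t ∂μ = 0) {α l : ℝ} (hα0 : 0 ≤ α)
    (hα1 : α ≤ 1) (hl : 0 < l)
    (hκ : ∀ v, ∫ m, ‖v - α • M m v‖ ^ 2 ∂μ ≤ (1 - l * α) * ‖v‖ ^ 2) (z : E) :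
    ∫ m, ‖scaledStep M h α m z‖ ^ 2 ∂μ ≤
      (1 - l * α / 2) * ‖z‖ ^ 2 + α * (K ^ 2 + 2 * K ^ 4 / l) := by
  have hr0 : 0 ≤ √α := Real.sqrt_nonneg _
  have hr1 : √α ≤ 1 := Real.sqrt_le_one.2 hα1
  have hrr : √α * √α = α := Real.mul_self_sqrt hα0
  set n := ‖z‖ with hn
  have hn0 : 0 ≤ n := norm_nonneg _
  have hexp : ∀ m, ‖scaledStep M h α m z‖ ^ 2 ≤ ‖z - α • M m z‖ ^ 2 + 2 * √α * inner ℝ (h m) z +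
      (2 * α * (K ^ 2 * n) + α * K ^ 2) := fun m => by
    rw [scaledStep, norm_add_sq_real, inner_smul_right, inner_sub_left, inner_smul_left, norm_smul,
      real_inner_comm (h m) z]
    have h1 : |inner ℝ (M m z) (h m)| ≤ K ^ 2 * n := by
      refine (abs_real_inner_le_norm _ _).trans ?_
      calc _ ≤ (K * n) * K := by
            gcongr
            exacts [((M m).le_opNorm z).trans (by gcongr; exact hM m), hh m]
        _ = _ := by ring
    have h2 : (‖√α‖ * ‖h m‖) ^ 2 ≤ α * K ^ 2 := by
      rw [mul_pow, Real.norm_eq_abs, sq_abs, Real.sq_sqrt hα0]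
      gcongr
      exact hh m
    have h3 : -(α * √α * inner ℝ (M m z) (h m)) ≤ α * (K ^ 2 * n) := by
      refine (neg_le_abs _).trans ?_
      rw [abs_mul, abs_of_nonneg (by positivity)]
      calc α * √α * |inner ℝ (M m z) (h m)| ≤ α * 1 * (K ^ 2 * n) := by gcongr
        _ = _ := by ring
    simp only [conj_trivial]
    nlinarith
  calc ∫ m, ‖scaledStep M h α m z‖ ^ 2 ∂μ
      ≤ ∫ m, (‖z - α • M m z‖ ^ 2 + 2 * √α * inner ℝ (h m) z +
          (2 * α * (K ^ 2 * n) + α * K ^ 2)) ∂μ :=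
        integral_mono (integrable_of_finite' _ _) (integrable_of_finite' _ _) hexp
    _ = ∫ m, ‖z - α • M m z‖ ^ 2 ∂μ + (2 * α * (K ^ 2 * n) + α * K ^ 2) := by
        rw [integral_add (integrable_of_finite' _ _) (integrable_of_finite' _ _),
          integral_add (integrable_of_finite' _ _) (integrable_of_finite' _ _),
          integral_const_mul, h0]
        simp
    _ ≤ (1 - l * α) * n ^ 2 + (2 * α * (K ^ 2 * n) + α * K ^ 2) := by gcongr; exact hκ z
    _ ≤ _ := by
        -- Young's inequality, as the square of `l n - 2 K²` divided by `2 l`.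
        have h5 : 2 * (K ^ 2 * n) ≤ l / 2 * n ^ 2 + 2 * K ^ 4 / l := by
          have : l / 2 * n ^ 2 + 2 * K ^ 4 / l - 2 * (K ^ 2 * n) =
              (l * n - 2 * K ^ 2) ^ 2 / (2 * l) := by field_simp; ring
          have : 0 ≤ (l * n - 2 * K ^ 2) ^ 2 / (2 * l) := by positivity
          linarith
        nlinarith [mul_le_mul_of_nonneg_left h5 hα0]

theorem integrable_norm_sq {ζ : Measure E} (hζ : MemLp id 2 ζ) :
    Integrable (fun z => ‖z‖ ^ 2) ζ := hζ.integrable_norm_pow (by norm_num)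

/-- Integrating the one-step bound against the stationary law puts the same finite second moment on
both sides. Decay and input are both proportional to `α`, so `α` cancels and the bound is uniform.
-/
theorem integral_norm_sq_stationary_le (hK : 1 ≤ K) (hM : ∀ m, ‖M m‖ ≤ K)
    (hh : ∀ m, ‖h m‖ ≤ K) (h0 : ∀ t, ∫ m, inner ℝ (h m) t ∂μ = 0) {α l : ℝ} (hα0 : 0 < α)
    (hα1 : α ≤ 1) (hl : 0 < l)
    (hκ : ∀ v, ∫ m, ‖v - α • M m v‖ ^ 2 ∂μ ≤ (1 - l * α) * ‖v‖ ^ 2)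
    {ζ : Measure E} [IsProbabilityMeasure ζ] (hζ : pushLaw μ (scaledStep M h α) ζ = ζ)
    (hζ2 : MemLp id 2 ζ) :
    ∫ z, ‖z‖ ^ 2 ∂ζ ≤ 2 / l * (K ^ 2 + 2 * K ^ 4 / l) := by
  have hi := integrable_norm_sq hζ2
  have hi' : Integrable (fun z => ‖z‖ ^ 2) (pushLaw μ (scaledStep M h α) ζ) := by rwa [hζ]
  have hle : ∫ z, ‖z‖ ^ 2 ∂ζ ≤
      ∫ z, ((1 - l * α / 2) * ‖z‖ ^ 2 + α * (K ^ 2 + 2 * K ^ 4 / l)) ∂ζ := by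
    conv_lhs => rw [← hζ, integral_pushLaw μ (continuous_scaledStep M h α) ζ hi']
    refine integral_mono_of_nonneg (ae_of_all _ fun z => ?_)
      ((hi.const_mul _).add (integrable_const _)) (ae_of_all _ fun z => ?_)
    · exact integral_nonneg fun m => by positivity
    · exact integral_norm_sq_scaledStep_le μ hK hM hh h0 hα0.le hα1 hl hκ z
  rw [integral_add (hi.const_mul _) (integrable_const _), integral_const_mul] at hle
  simp only [integral_const, probReal_univ, one_smul] at hle
  have h1 : α * (l / 2 * ∫ z, ‖z‖ ^ 2 ∂ζ) ≤ α * (K ^ 2 + 2 * K ^ 4 / l) := by linarith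
  have h2 := le_of_mul_le_mul_left h1 hα0
  have h3 := mul_le_mul_of_nonneg_left h2 (show 0 ≤ 2 / l by positivity)
  have h4 : 2 / l * (l / 2 * ∫ z, ‖z‖ ^ 2 ∂ζ) = ∫ z, ‖z‖ ^ 2 ∂ζ := by field_simp
  linarith

/-- Stationarity turns the one-step estimate into an approximate functional equation for the
characteristic function. -/
theorem norm_charFun_sub_step_le (hK : 1 ≤ K) (hM : ∀ m, ‖M m‖ ≤ K)
    (hh : ∀ m, ‖h m‖ ≤ K) (hGK : ‖G‖ ≤ K)
    (hG : ∀ t z, ∫ m, inner ℝ (M m z) t ∂μ = inner ℝ z (G t))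
    (h0 : ∀ t, ∫ m, inner ℝ (h m) t ∂μ = 0) {α : ℝ} (hα0 : 0 ≤ α) (hα1 : α ≤ 1)
    {ζ : Measure E} [IsProbabilityMeasure ζ] (hζ : pushLaw μ (scaledStep M h α) ζ = ζ)
    (hζ2 : MemLp id 2 ζ) (t : E) :
    ‖charFun ζ t - charFun ζ (t - α • G t) *
        (1 - (α * (∫ m, (inner ℝ (h m) t) ^ 2 ∂μ) / 2 : ℝ))‖ ≤
      15 * (α * √α) * K ^ 3 * ‖t‖ ^ 2 * (1 + ‖t‖) * (1 + ∫ z, ‖z‖ ^ 2 ∂ζ) := by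
  have hi := integrable_norm_sq hζ2
  have hie : ∀ (t : E) (ζ : Measure E) [IsProbabilityMeasure ζ],
      Integrable (fun z : E => Complex.exp ((inner ℝ z t : ℝ) * Complex.I)) ζ := fun t ζ _ =>
    integrable_of_lipschitz_bounded (norm_nonneg t) (norm_exp_inner_sub_le t)
      (fun u => (Complex.norm_exp_ofReal_mul_I _).le) ζ
  set A := fun z : E => ∫ m, Complex.exp ((inner ℝ (scaledStep M h α m z) t : ℝ) * Complex.I) ∂μ
  set B := fun z : E => Complex.exp ((inner ℝ z (t - α • G t) : ℝ) * Complex.I) *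
        (1 - (α * (∫ m, (inner ℝ (h m) t) ^ 2 ∂μ) / 2 : ℝ))
  have hpr := isProbabilityMeasure_pushLaw μ (continuous_scaledStep M h α) ζ
  have e1 : charFun ζ t = ∫ z, A z ∂ζ := by
    conv_lhs => rw [← hζ, charFun_apply,
      integral_pushLaw μ (continuous_scaledStep M h α) ζ (hie t _)]
  have e2 : charFun ζ (t - α • G t) * (1 - (α * (∫ m, (inner ℝ (h m) t) ^ 2 ∂μ) / 2 : ℝ)) =
      ∫ z, B z ∂ζ := by
    rw [charFun_apply, ← integral_mul_const]
  have hA : Integrable A ζ := by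
    have h1 : Integrable (fun z : ι × E =>
        Complex.exp ((inner ℝ (scaledStep M h α z.1 z.2) t : ℝ) * Complex.I)) (μ.prod ζ) :=
      (hie t (pushLaw μ (scaledStep M h α) ζ)).comp_measurable
        (measurable_uncurry_of_finite (continuous_scaledStep M h α))
    exact h1.integral_prod_right
  rw [e1, e2, ← integral_sub hA ((hie _ ζ).mul_const _)]
  refine (norm_integral_le_of_norm_le
    (((integrable_const (1 : ℝ)).add hi).const_mul (15 * (α * √α) * K ^ 3 * ‖t‖ ^ 2 * (1 + ‖t‖)))
    (ae_of_all _ fun z => norm_integral_exp_scaledStep_sub_le μ hK hM hh hGK hG h0 hα0 hα1 t z)).trans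
    (le_of_eq ?_)
  rw [integral_const_mul, integral_add' (integrable_const _) hi]
  simp

/-- The Gaussian counterpart of the functional equation: by the Lyapunov identity, passing from `t`
to `t - α G t` changes the quadratic form by `α s` up to a term of order `α²`. -/
theorem abs_exp_quadratic_sub_step_le (hK : 1 ≤ K) (hh : ∀ m, ‖h m‖ ≤ K) (hGK : ‖G‖ ≤ K)
    {Q : E →L[ℝ] E} (hQK : ‖Q‖ ≤ K) (hQ : ∀ t, 0 ≤ inner ℝ t (Q t))
    (hlyap : ∀ t, inner ℝ t (Q (G t)) + inner ℝ (G t) (Q t) = ∫ m, (inner ℝ (h m) t) ^ 2 ∂μ)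
    {α R : ℝ} (hα0 : 0 ≤ α) (hα1 : α ≤ 1) (hαR : α * (K ^ 3 * R ^ 2) ≤ 1) {t : E} (ht : ‖t‖ ≤ R) :
    |Real.exp (-(inner ℝ t (Q t) / 2)) -
      Real.exp (-(inner ℝ (t - α • G t) (Q (t - α • G t)) / 2)) *
        (1 - α * (∫ m, (inner ℝ (h m) t) ^ 2 ∂μ) / 2)| ≤
      α * √α * (K ^ 6 * (R ^ 2 + 1)) * ‖t‖ ^ 2 := by
  set s := ∫ m, (inner ℝ (h m) t) ^ 2 ∂μ with hs
  set N := ‖t‖ with hN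
  set r := inner ℝ (G t) (Q (G t)) with hr
  set v' := inner ℝ (t - α • G t) (Q (t - α • G t)) with hv'
  have hN0 : 0 ≤ N := norm_nonneg _
  have hv'0 : 0 ≤ v' := hQ _
  have hr0 : 0 ≤ r := hQ _
  have hK0 : 0 ≤ K := by linarith
  have hK23 : K ^ 2 ≤ K ^ 3 := pow_le_pow_right₀ hK (by norm_num)
  have hK36 : K ^ 3 ≤ K ^ 6 := pow_le_pow_right₀ hK (by norm_num)
  have hαr : α ≤ √α := by
    nlinarith [Real.sqrt_nonneg α, Real.sqrt_le_one.2 hα1, Real.mul_self_sqrt hα0]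
  have hv : inner ℝ t (Q t) = v' + α * s - α ^ 2 * r := by
    rw [hs, ← hlyap t, hv', hr]
    simp only [map_sub, map_smul, inner_sub_left, inner_sub_right, inner_smul_left,
      inner_smul_right, conj_trivial]
    ring
  have hs0 : 0 ≤ s := integral_nonneg fun m => by positivity
  have hsK : s ≤ K ^ 3 * N ^ 2 := by
    refine (le_abs_self _).trans (abs_integral_le_of_abs_le μ fun m => ?_)
    rw [abs_pow]
    calc |inner ℝ (h m) t| ^ 2 ≤ (K * N) ^ 2 := by
          gcongr
          exact (abs_real_inner_le_norm _ _).trans (by gcongr; exact hh m)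
      _ = K ^ 2 * N ^ 2 := by ring
      _ ≤ _ := by gcongr
  have hrK : r ≤ K ^ 3 * N ^ 2 := by
    have h1 : ‖G t‖ ≤ K * N := (G.le_opNorm t).trans (by gcongr)
    have h2 : ‖Q (G t)‖ ≤ K * (K * N) := (Q.le_opNorm _).trans (by gcongr)
    calc r ≤ ‖G t‖ * ‖Q (G t)‖ := real_inner_le_norm _ _
      _ ≤ (K * N) * (K * (K * N)) := by gcongr
      _ = _ := by ring
  set w := (α * s - α ^ 2 * r) / 2 with hw
  have hN2 : N ^ 2 ≤ R ^ 2 := by gcongr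
  have hwK : |w| ≤ α * (K ^ 3 * N ^ 2) := by
    have h1 : α * s ≤ α * (K ^ 3 * N ^ 2) := by gcongr
    have h2 : α ^ 2 * r ≤ α * (K ^ 3 * N ^ 2) := by
      calc α ^ 2 * r ≤ α * (K ^ 3 * N ^ 2) := by gcongr; nlinarith
        _ = _ := rfl
    have h3 : 0 ≤ α * s := by positivity
    have h4 : 0 ≤ α ^ 2 * r := by positivity
    rw [abs_le]; constructor <;> linarith
  -- The smallness condition `hαR` serves to bring the exponent into the range of the quadratic
  -- bound for `exp`.
  have hw1 : |-w| ≤ 1 := by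
    rw [abs_neg]
    exact hwK.trans (le_trans (by gcongr) hαR)
  have e1 : Real.exp (-(inner ℝ t (Q t) / 2)) = Real.exp (-(v' / 2)) * Real.exp (-w) := by
    rw [hv, ← Real.exp_add]; congr 1; rw [hw]; ring
  rw [e1, ← mul_sub, abs_mul, Real.abs_exp]
  have h5 : |Real.exp (-w) - (1 - α * s / 2)| ≤ w ^ 2 + α ^ 2 * r / 2 := by
    have h6 := Real.abs_exp_sub_one_sub_id_le hw1
    have h7 : Real.exp (-w) - (1 - α * s / 2) = (Real.exp (-w) - 1 - -w) + α ^ 2 * r / 2 := by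
      rw [hw]; ring
    rw [h7]
    refine (abs_add_le _ _).trans ?_
    rw [abs_of_nonneg (show 0 ≤ α ^ 2 * r / 2 by positivity)]
    nlinarith
  have h8 : w ^ 2 ≤ α ^ 2 * (K ^ 6 * R ^ 2 * N ^ 2) := by
    rw [← sq_abs]
    calc |w| ^ 2 ≤ (α * (K ^ 3 * N ^ 2)) ^ 2 := by gcongr
      _ = α ^ 2 * (K ^ 6 * N ^ 2 * N ^ 2) := by ring
      _ ≤ _ := by gcongr
  have h9 : α ^ 2 * r / 2 ≤ α ^ 2 * (K ^ 6 * 1 * N ^ 2) := by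
    have : α ^ 2 * r ≤ α ^ 2 * (K ^ 6 * 1 * N ^ 2) := by
      gcongr
      rw [mul_one]
      exact hrK.trans (by gcongr)
    have : 0 ≤ α ^ 2 * r := by positivity
    linarith
  calc Real.exp (-(v' / 2)) * |Real.exp (-w) - (1 - α * s / 2)| ≤
        1 * |Real.exp (-w) - (1 - α * s / 2)| := by
          gcongr
          exact Real.exp_le_one_iff.2 (by linarith)
    _ ≤ α * α * (K ^ 6 * (R ^ 2 + 1)) * N ^ 2 := by nlinarith
    _ ≤ _ := by gcongr

/-- The characteristic function of the rescaled stationary law is close to that of a Gaussian law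
whose covariance solves the Lyapunov equation. -/
theorem norm_charFun_sub_exp_le (hK : 1 ≤ K) (hM : ∀ m, ‖M m‖ ≤ K)
    (hh : ∀ m, ‖h m‖ ≤ K) (hGK : ‖G‖ ≤ K)
    (hG : ∀ t z, ∫ m, inner ℝ (M m z) t ∂μ = inner ℝ z (G t))
    (h0 : ∀ t, ∫ m, inner ℝ (h m) t ∂μ = 0)
    {Q : E →L[ℝ] E} (hQK : ‖Q‖ ≤ K) (hQ : ∀ t, 0 ≤ inner ℝ t (Q t))
    (hlyap : ∀ t, inner ℝ t (Q (G t)) + inner ℝ (G t) (Q t) = ∫ m, (inner ℝ (h m) t) ^ 2 ∂μ)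
    {α l : ℝ} (hα0 : 0 < α) (hα1 : α ≤ 1) (hl : 0 < l) (hlα : l * α ≤ 1)
    (hB : ∀ t, ‖t - α • G t‖ ≤ (1 - l * α) * ‖t‖)
    {ζ : Measure E} [IsProbabilityMeasure ζ] (hζ : pushLaw μ (scaledStep M h α) ζ = ζ)
    (hζ2 : MemLp id 2 ζ) {C : ℝ} (hC : ∫ z, ‖z‖ ^ 2 ∂ζ ≤ C) (t : E)
    (hαR : α * (K ^ 3 * ‖t‖ ^ 2) ≤ 1) :
    ‖charFun ζ t - Real.exp (-(inner ℝ t (Q t) / 2))‖ ≤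
      √α * ((15 * K ^ 3 * (1 + ‖t‖) * (1 + C) + K ^ 6 * (‖t‖ ^ 2 + 1)) * ‖t‖ ^ 2 / l) := by
  set R := ‖t‖ with hR
  have hR0 : 0 ≤ R := norm_nonneg _
  have hC0 : 0 ≤ C := le_trans (integral_nonneg fun z => by positivity) hC
  have hr0 : 0 ≤ √α := Real.sqrt_nonneg _
  have hK0 : 0 ≤ K := by linarith
  have hK23 : K ^ 2 ≤ K ^ 3 := pow_le_pow_right₀ hK (by norm_num)
  set Δ : E → ℝ := fun t => ‖charFun ζ t - Real.exp (-(inner ℝ t (Q t) / 2))‖ with hΔ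
  set c := α * √α * (15 * K ^ 3 * (1 + R) * (1 + C) + K ^ 6 * (R ^ 2 + 1)) with hc
  have hΔc : ContinuousAt Δ 0 := by
    have h1 : Continuous (charFun ζ) := continuous_charFun
    have h2 : Continuous fun t : E => ((Real.exp (-(inner ℝ t (Q t) / 2)) : ℝ) : ℂ) := by fun_prop
    exact (h1.sub h2).norm.continuousAt
  have hΔ0 : Δ 0 = 0 := by simp [hΔ]
  -- The error per step is of order `α √α` and the contraction gap is `l α`; their quotient is the
  -- rate `√α`.
  have hmain := le_of_le_comp_add (Δ := Δ) hΔc hΔ0 (B := fun t => t - α • G t) (ρ := 1 - l * α)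
    (by linarith) (by nlinarith) hB (c := c) (R := R) (by positivity) (fun t ht => ?_) (t := t) le_rfl
  · refine hmain.trans (le_of_eq ?_)
    rw [hc]
    field_simp
    ring
  · set s := ∫ m, (inner ℝ (h m) t) ^ 2 ∂μ with hs
    have hs0 : 0 ≤ s := integral_nonneg fun m => by positivity
    have hsK : s ≤ K ^ 3 * R ^ 2 := by
      refine (le_abs_self _).trans (abs_integral_le_of_abs_le μ fun m => ?_)
      rw [abs_pow]
      calc |inner ℝ (h m) t| ^ 2 ≤ (K * R) ^ 2 := by
            gcongr
            exact (abs_real_inner_le_norm _ _).trans (by gcongr; exact hh m)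
        _ = K ^ 2 * R ^ 2 := by ring
        _ ≤ _ := by gcongr
    have hαs : α * s ≤ 1 := le_trans (by gcongr) hαR
    have hαs0 : 0 ≤ α * s := by positivity
    have b1 := norm_charFun_sub_step_le μ hK hM hh hGK hG h0 hα0.le hα1 hζ hζ2 t
    have b2 := abs_exp_quadratic_sub_step_le μ hK hh hGK hQK hQ hlyap hα0.le hα1 hαR ht
    rw [← hs] at b1 b2
    set w : ℝ := 1 - α * s / 2 with hw
    have hw1 : |w| ≤ 1 := by rw [abs_le]; constructor <;> linarith
    set g := fun t : E => Real.exp (-(inner ℝ t (Q t) / 2)) with hg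
    set B := t - α • G t with hBt
    have hwc : (1 - (α * s / 2 : ℝ) : ℂ) = (w : ℂ) := by rw [hw]; push_cast; ring
    rw [hwc] at b1
    have b2' : ‖((g B * w - g t : ℝ) : ℂ)‖ ≤ α * √α * (K ^ 6 * (R ^ 2 + 1)) * ‖t‖ ^ 2 := by
      rw [Complex.norm_real, Real.norm_eq_abs, abs_sub_comm]; exact b2
    -- The factor `w` has modulus at most 1, so the middle summand is bounded by `Δ B` without any
    -- loss that iteration would amplify.
    have e : charFun ζ t - (g t : ℂ) = (charFun ζ t - charFun ζ B * w) +
        (charFun ζ B - (g B : ℂ)) * w + ((g B * w - g t : ℝ) : ℂ) := by push_cast; ring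
    have b3 : ‖(charFun ζ B - (g B : ℂ)) * w‖ ≤ Δ B := by
      rw [norm_mul, Complex.norm_real, Real.norm_eq_abs]
      exact mul_le_of_le_one_right (norm_nonneg _) hw1
    have b4 : 15 * (α * √α) * K ^ 3 * ‖t‖ ^ 2 * (1 + ‖t‖) * (1 + ∫ z, ‖z‖ ^ 2 ∂ζ) ≤
        15 * (α * √α) * K ^ 3 * ‖t‖ ^ 2 * (1 + R) * (1 + C) := by
      have : 0 ≤ ∫ z, ‖z‖ ^ 2 ∂ζ := integral_nonneg fun z => by positivity
      gcongr
    calc Δ t = ‖charFun ζ t - (g t : ℂ)‖ := rfl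
      _ = ‖(charFun ζ t - charFun ζ B * w) + (charFun ζ B - (g B : ℂ)) * w +
            ((g B * w - g t : ℝ) : ℂ)‖ := by rw [e]
      _ ≤ ‖charFun ζ t - charFun ζ B * w‖ + ‖(charFun ζ B - (g B : ℂ)) * w‖ +
            ‖((g B * w - g t : ℝ) : ℂ)‖ := norm_add₃_le
      _ ≤ 15 * (α * √α) * K ^ 3 * ‖t‖ ^ 2 * (1 + R) * (1 + C) + Δ B +
          α * √α * (K ^ 6 * (R ^ 2 + 1)) * ‖t‖ ^ 2 := by
            gcongr
            exact b1.trans b4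
      _ = _ := by rw [hc]; ring

end LinearNoise

end DropoutGD

namespace DropoutGD

/-! ### Matrices acting on Euclidean vectors; bounds for masked Gram matrices. -/

section App

variable {n d k : ℕ}

theorem app_apply (A : Matrix (Fin n) (Fin d) ℝ) (v : Vec d) (i : Fin n) :
    app A v i = ∑ j, A i j * v j := rfl

theorem app_eq_toEuclideanCLM (A : Matrix (Fin d) (Fin d) ℝ) (v : Vec d) :
    app A v = Matrix.toEuclideanCLM (𝕜 := ℝ) A v := rfl

theorem app_mul (A : Matrix (Fin n) (Fin d) ℝ) (B : Matrix (Fin d) (Fin k) ℝ) (v : Vec k) :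
    app (A * B) v = app A (app B v) := by
  simp [app, Matrix.mulVec_mulVec]

theorem app_sub (A : Matrix (Fin n) (Fin d) ℝ) (u v : Vec d) :
    app A (u - v) = app A u - app A v := by
  ext i; simp [app, Matrix.mulVec_sub]

theorem add_app (A B : Matrix (Fin n) (Fin d) ℝ) (v : Vec d) :
    app (A + B) v = app A v + app B v := by
  ext i; simp [app, Matrix.add_mulVec]

theorem sub_app (A B : Matrix (Fin n) (Fin d) ℝ) (v : Vec d) :
    app (A - B) v = app A v - app B v := by
  ext i; simp [app, Matrix.sub_mulVec]

theorem smul_app (c : ℝ) (A : Matrix (Fin n) (Fin d) ℝ) (v : Vec d) :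
    app (c • A) v = c • app A v := by
  ext i; simp [app, Matrix.smul_mulVec]

theorem one_app (v : Vec d) : app (1 : Matrix (Fin d) (Fin d) ℝ) v = v := by
  ext i; simp [app]

theorem inner_eq_sum (u v : Vec d) : inner ℝ u v = ∑ i, u i * v i := by
  simp [PiLp.inner_apply, mul_comm]

theorem inner_app_transpose (A : Matrix (Fin n) (Fin d) ℝ) (x : Vec n) (v : Vec d) :
    inner ℝ (app A.transpose x) v = inner ℝ x (app A v) := by
  simp only [inner_eq_sum, app_apply, Matrix.transpose_apply, Finset.sum_mul, Finset.mul_sum]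
  rw [Finset.sum_comm]
  exact Finset.sum_congr rfl fun i _ => Finset.sum_congr rfl fun j _ => by ring

theorem inner_app_gram (X : Matrix (Fin n) (Fin d) ℝ) (v : Vec d) :
    inner ℝ (app (gram X) v) v = ‖app X v‖ ^ 2 := by
  rw [gram, app_mul, inner_app_transpose, real_inner_self_eq_norm_sq]

theorem norm_app_le (A : Matrix (Fin d) (Fin d) ℝ) (v : Vec d) : ‖app A v‖ ≤ specNorm A * ‖v‖ :=
  (Matrix.toEuclideanCLM (𝕜 := ℝ) A).le_opNorm v

theorem specNorm_nonneg (A : Matrix (Fin d) (Fin d) ℝ) : 0 ≤ specNorm A := norm_nonneg _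

/-- This is `𝕏² ≤ ‖𝕏‖ 𝕏` as quadratic forms. With `g = 𝕏 w`, Cauchy–Schwarz gives `‖g‖² = ⟨X w, X g⟩
≤ ‖X w‖ ‖X g‖`, and `‖X g‖² ≤ ‖𝕏‖ ‖g‖²`. -/
theorem norm_sq_app_gram_le (X : Matrix (Fin n) (Fin d) ℝ) (w : Vec d) :
    ‖app (gram X) w‖ ^ 2 ≤ specNorm (gram X) * ‖app X w‖ ^ 2 := by
  set g := app (gram X) w with hg
  set L := specNorm (gram X)
  have hL : 0 ≤ L := specNorm_nonneg _
  have h1 : ‖g‖ ^ 2 = inner ℝ (app X w) (app X g) := by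
    rw [← real_inner_self_eq_norm_sq]
    nth_rewrite 1 [hg]
    rw [gram, app_mul, inner_app_transpose]
  have h2 : ‖app X g‖ ^ 2 ≤ L * ‖g‖ ^ 2 := by
    rw [← inner_app_gram]
    calc _ ≤ ‖app (gram X) g‖ * ‖g‖ := real_inner_le_norm _ _
      _ ≤ L * ‖g‖ * ‖g‖ := by gcongr; exact norm_app_le _ _
      _ = _ := by ring
  have h3 : ‖g‖ ^ 2 ≤ ‖app X w‖ * ‖app X g‖ := h1 ▸ real_inner_le_norm _ _
  have h4 : (‖g‖ ^ 2) ^ 2 ≤ ‖app X w‖ ^ 2 * (L * ‖g‖ ^ 2) := by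
    calc (‖g‖ ^ 2) ^ 2 ≤ (‖app X w‖ * ‖app X g‖) ^ 2 := by gcongr
      _ = ‖app X w‖ ^ 2 * ‖app X g‖ ^ 2 := by ring
      _ ≤ _ := by gcongr
  rcases eq_or_ne (‖g‖ ^ 2) 0 with h0 | h0
  · rw [h0]; positivity
  · have h5 : 0 < ‖g‖ ^ 2 := lt_of_le_of_ne (by positivity) (Ne.symm h0)
    refine le_of_mul_le_mul_right ?_ h5
    calc _ = (‖g‖ ^ 2) ^ 2 := by ring
      _ ≤ _ := h4
      _ = _ := by ring

theorem app_maskMat_apply (m : Mask d) (v : Vec d) (i : Fin d) :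
    app (maskMat m) v i = (if m i then 1 else 0) * v i := by
  simp [app, maskMat, Matrix.mulVec_diagonal]

theorem norm_app_maskMat_le (m : Mask d) (v : Vec d) : ‖app (maskMat m) v‖ ≤ ‖v‖ := by
  rw [EuclideanSpace.norm_eq, EuclideanSpace.norm_eq]
  gcongr with i
  rw [app_maskMat_apply]
  split_ifs <;> simp

theorem maskMat_transpose (m : Mask d) : (maskMat m).transpose = maskMat m := by
  simp [maskMat, Matrix.diagonal_transpose]

theorem norm_sq_app_mask_gram_le (X : Matrix (Fin n) (Fin d) ℝ) (m : Mask d) (v : Vec d) :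
    ‖app (maskMat m * gram X * maskMat m) v‖ ^ 2 ≤
      specNorm (gram X) * inner ℝ (app (maskMat m * gram X * maskMat m) v) v := by
  have h1 : inner ℝ (app (maskMat m * gram X * maskMat m) v) v =
      ‖app X (app (maskMat m) v)‖ ^ 2 := by
    rw [app_mul, app_mul, ← inner_app_gram]
    conv_lhs => rw [← maskMat_transpose m, inner_app_transpose]
    rw [maskMat_transpose]
  rw [h1]
  refine le_trans ?_ (norm_sq_app_gram_le X _)
  rw [app_mul, app_mul]
  gcongr
  exact norm_app_maskMat_le _ _

/-- The quadratic term is traded for the linear one through `A² ≤ ‖𝕏‖ A` with `A = D 𝕏 D`. Being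
linear in `A`, the bound can be averaged over masks, which replaces `A` by the coercive `p 𝕏_p`. -/
theorem norm_sq_sub_smul_mask_gram_le (X : Matrix (Fin n) (Fin d) ℝ) (α : ℝ)
    (m : Mask d) (v : Vec d) :
    ‖v - α • app (maskMat m * gram X * maskMat m) v‖ ^ 2 ≤
      ‖v‖ ^ 2 - α * (2 - α * specNorm (gram X)) *
        inner ℝ (app (maskMat m * gram X * maskMat m) v) v := by
  set w := app (maskMat m * gram X * maskMat m) v with hw
  have h := norm_sq_app_mask_gram_le X m v
  rw [← hw] at h
  rw [norm_sub_sq_real, inner_smul_right, norm_smul, mul_pow, Real.norm_eq_abs, sq_abs,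
    real_inner_comm]
  nlinarith [mul_le_mul_of_nonneg_left h (sq_nonneg α)]

theorem norm_sub_smul_mask_gram_le (X : Matrix (Fin n) (Fin d) ℝ) {α : ℝ} (hα0 : 0 ≤ α)
    (hα : α * specNorm (gram X) ≤ 2) (m : Mask d) (v : Vec d) :
    ‖v - α • app (maskMat m * gram X * maskMat m) v‖ ≤ ‖v‖ := by
  refine le_of_sq_le_sq ?_ (norm_nonneg v)
  refine (norm_sq_sub_smul_mask_gram_le X α m v).trans ?_
  rcases (specNorm_nonneg (gram X)).eq_or_lt with h0 | h0
  · have h := norm_sq_app_mask_gram_le X m v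
    rw [← h0, zero_mul] at h
    have h1 : app (maskMat m * gram X * maskMat m) v = 0 := by
      rw [← norm_eq_zero]; exact pow_eq_zero_iff (two_ne_zero) |>.1 (le_antisymm h (by positivity))
    simp [h1]
  · have h := norm_sq_app_mask_gram_le X m v
    have h1 : 0 ≤ inner ℝ (app (maskMat m * gram X * maskMat m) v) v :=
      nonneg_of_mul_nonneg_right ((sq_nonneg _).trans h) h0
    have : 0 ≤ α * (2 - α * specNorm (gram X)) *
        inner ℝ (app (maskMat m * gram X * maskMat m) v) v :=
      mul_nonneg (mul_nonneg hα0 (by linarith)) h1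
    linarith

end App

/-! ### First and second moments of the dropout masks and of the noise. -/

section Moments

variable {n d : ℕ} (p : unitInterval)

instance : IsProbabilityMeasure (dropoutLaw d p) := by
  unfold dropoutLaw; infer_instance

/-- The `0`/`1` indicator of keeping coordinate `i`. -/
def keep (m : Mask d) (i : Fin d) : ℝ := if m i then 1 else 0

theorem integral_keep (i : Fin d) : ∫ m, keep m i ∂(dropoutLaw d p) = p := by
  have h := integral_comp_eval (μ := fun _ : Fin d => bernoulliMeasure true false p) (i := i)
    (f := fun b : Bool => if b then (1 : ℝ) else 0) (by fun_prop)
  rw [integral_bernoulliMeasure] at h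
  simpa [keep, dropoutLaw] using h

theorem integral_keep_mul_keep {i j : Fin d} (hij : i ≠ j) :
    ∫ m, keep m i * keep m j ∂(dropoutLaw d p) = (p : ℝ) * p := by
  have h : iIndepFun (fun (i : Fin d) (m : Mask d) => keep m i) (dropoutLaw d p) :=
    iIndepFun_pi (μ := fun _ : Fin d => bernoulliMeasure true false p)
      (X := fun _ (b : Bool) => if b then (1 : ℝ) else 0) (fun i => by fun_prop)
  have h2 := (h.indepFun hij).integral_fun_mul_eq_mul_integral
    (integrable_of_finite' _ _).aestronglyMeasurable (integrable_of_finite' _ _).aestronglyMeasurable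
  rw [h2, integral_keep, integral_keep]

theorem keep_mul_self (m : Mask d) (i : Fin d) : keep m i * keep m i = keep m i := by
  unfold keep; split_ifs <;> simp

theorem maskMat_mul_mul_apply (A : Matrix (Fin d) (Fin d) ℝ) (m : Mask d) (i j : Fin d) :
    (maskMat m * A * maskMat m) i j = A i j * (keep m i * keep m j) := by
  simp [maskMat, Matrix.diagonal_mul, Matrix.mul_diagonal, keep]

/-- Off the diagonal independence gives `p²`; on it an indicator equals its square and gives `p`.
This is the origin of `p 𝕏_p`. -/
theorem integral_maskMat_mul_mul (A : Matrix (Fin d) (Fin d) ℝ) (i j : Fin d) :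
    ∫ m, (maskMat m * A * maskMat m) i j ∂(dropoutLaw d p) = ((p : ℝ) • shrink p A) i j := by
  simp only [maskMat_mul_mul_apply, integral_const_mul]
  rcases eq_or_ne i j with rfl | hij
  · simp only [keep_mul_self, integral_keep]
    simp [shrink]; ring
  · rw [integral_keep_mul_keep p hij]
    simp [shrink, hij]; ring

theorem integral_inner_app_mask (A : Matrix (Fin d) (Fin d) ℝ) (t z : Vec d) :
    ∫ m, inner ℝ (app (maskMat m * A * maskMat m) z) t ∂(dropoutLaw d p) =
      inner ℝ (app ((p : ℝ) • shrink p A) z) t := by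
  simp only [inner_eq_sum, app_apply, Finset.sum_mul]
  rw [integral_finsetSum _ fun i _ => integrable_of_finite' _ _]
  refine Finset.sum_congr rfl fun i _ => ?_
  rw [integral_finsetSum _ fun i _ => integrable_of_finite' _ _]
  refine Finset.sum_congr rfl fun j _ => ?_
  rw [integral_mul_const, integral_mul_const, integral_maskMat_mul_mul]

theorem noise_apply (X : Matrix (Fin n) (Fin d) ℝ) (y : Vec n) (q : ℝ) (m : Mask d) (i : Fin d) :
    noise X y q m i =
      ∑ j, offDiag (gram X) i j * ridge X y q j * (keep m i * (q - keep m j)) := by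
  rw [noise, app_apply]
  refine Finset.sum_congr rfl fun j _ => ?_
  have : (q • (1 : Matrix (Fin d) (Fin d) ℝ) - maskMat m) =
      Matrix.diagonal fun i => q - keep m i := by
    ext a b
    by_cases hab : a = b
    · subst hab; simp [maskMat, keep]
    · simp [maskMat, hab]
  rw [this, maskMat, Matrix.mul_diagonal, Matrix.diagonal_mul]
  simp only [keep]; ring

/-- The diagonal terms are absent by definition of `offDiag`; for `i ≠ j` the mean of `keep i * (p -
keep j)` is `p² - p²`. -/
theorem integral_noise_apply (X : Matrix (Fin n) (Fin d) ℝ) (y : Vec n) (i : Fin d) :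
    ∫ m, noise X y p m i ∂(dropoutLaw d p) = 0 := by
  simp only [noise_apply]
  rw [integral_finsetSum _ fun i _ => integrable_of_finite' _ _]
  refine Finset.sum_eq_zero fun j _ => ?_
  rcases eq_or_ne i j with rfl | hij
  · simp [offDiag]
  · rw [integral_const_mul]
    simp only [mul_sub]
    rw [integral_sub (integrable_of_finite' _ _) (integrable_of_finite' _ _), integral_mul_const,
      integral_keep, integral_keep_mul_keep p hij]
    ring

theorem integral_inner_noise (X : Matrix (Fin n) (Fin d) ℝ) (y : Vec n) (t : Vec d) :
    ∫ m, inner ℝ (noise X y p m) t ∂(dropoutLaw d p) = 0 := by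
  simp only [inner_eq_sum]
  rw [integral_finsetSum _ fun i _ => integrable_of_finite' _ _]
  exact Finset.sum_eq_zero fun i _ => by rw [integral_mul_const, integral_noise_apply, zero_mul]

theorem noiseCov_apply (X : Matrix (Fin n) (Fin d) ℝ) (y : Vec n) (i j : Fin d) :
    noiseCov X y p i j = ∫ m, noise X y p m i * noise X y p m j ∂(dropoutLaw d p) := by
  simp [noiseCov, covMat, covariance, integral_noise_apply]

theorem integral_inner_noise_sq (X : Matrix (Fin n) (Fin d) ℝ) (y : Vec n) (t : Vec d) :
    ∫ m, (inner ℝ (noise X y p m) t) ^ 2 ∂(dropoutLaw d p) =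
      inner ℝ t (app (noiseCov X y p) t) := by
  simp only [inner_eq_sum, app_apply, noiseCov_apply, sq, Finset.sum_mul, Finset.mul_sum]
  rw [integral_finsetSum _ fun i _ => integrable_of_finite' _ _]
  refine Finset.sum_congr rfl fun i _ => ?_
  rw [integral_finsetSum _ fun i _ => integrable_of_finite' _ _]
  refine Finset.sum_congr rfl fun j _ => ?_
  rw [← integral_mul_const, ← integral_const_mul]
  congr 1; ext m; ring

end Moments

/-! ### Coercivity of `p 𝕏_p`, and both recursions centred at `β̃`. -/

section Coercive

variable {n d : ℕ}

theorem gram_transpose (X : Matrix (Fin n) (Fin d) ℝ) : (gram X).transpose = gram X := by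
  simp [gram, Matrix.transpose_mul]

theorem shrink_transpose {A : Matrix (Fin d) (Fin d) ℝ} (hA : A.transpose = A) (q : ℝ) :
    (shrink q A).transpose = shrink q A := by
  simp [shrink, Matrix.transpose_add, Matrix.transpose_smul, hA, Matrix.diagonal_transpose]

theorem exists_pos_le_of_finite {ι : Type*} [Finite ι] {a : ι → ℝ} (ha : ∀ i, 0 < a i) :
    ∃ c > 0, ∀ i, c ≤ a i := by
  rcases isEmpty_or_nonempty ι with h | h
  · exact ⟨1, one_pos, fun i => isEmptyElim i⟩
  · obtain ⟨i, hi⟩ := Finite.exists_min a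
    exact ⟨a i, ha i, hi⟩

/-- The part `p 𝕏` is nonnegative, and `(1 - p) Diag(𝕏)` is positive definite since the diagonal of
`𝕏` holds the squared norms of the nonzero columns. -/
theorem exists_coercive (X : Matrix (Fin n) (Fin d) ℝ) {p : ℝ} (hp0 : 0 < p) (hp1 : p < 1)
    (hX : ∀ l, ∃ i, X i l ≠ 0) :
    ∃ l > 0, ∀ v : Vec d, l * ‖v‖ ^ 2 ≤ inner ℝ (app (p • shrink p (gram X)) v) v := by
  have hpos : ∀ l, 0 < gram X l l := fun l => by
    obtain ⟨i, hi⟩ := hX l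
    rw [gram, Matrix.mul_apply]
    refine Finset.sum_pos' (fun j _ => ?_) ⟨i, Finset.mem_univ _, ?_⟩
    · exact mul_self_nonneg _
    · exact mul_self_pos.2 hi
  obtain ⟨c, hc, hle⟩ := exists_pos_le_of_finite hpos
  refine ⟨p * ((1 - p) * c), by have := sub_pos.2 hp1; positivity, fun v => ?_⟩
  have h1 : inner ℝ (app (p • shrink p (gram X)) v) v =
      p * (p * ‖app X v‖ ^ 2 + (1 - p) * ∑ i, gram X i i * v i ^ 2) := by
    rw [smul_app, inner_smul_left, shrink, add_app, smul_app, smul_app, inner_add_left,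
      inner_smul_left, inner_smul_left, inner_app_gram]
    congr 3
    rw [inner_eq_sum]
    refine Finset.sum_congr rfl fun i _ => ?_
    simp [app, Matrix.mulVec_diagonal]; ring
  rw [h1]
  have h2 : c * ‖v‖ ^ 2 ≤ ∑ i, gram X i i * v i ^ 2 := by
    rw [EuclideanSpace.real_norm_sq_eq, Finset.mul_sum]
    exact Finset.sum_le_sum fun i _ => by gcongr; exact hle i
  have h3 := sub_pos.2 hp1
  calc p * ((1 - p) * c) * ‖v‖ ^ 2 = p * (0 + (1 - p) * (c * ‖v‖ ^ 2)) := by ring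
    _ ≤ _ := by gcongr; positivity

theorem app_shrink_ridge (X : Matrix (Fin n) (Fin d) ℝ) (y : Vec n) {p : ℝ} (hp0 : 0 < p)
    (hp1 : p < 1) (hX : ∀ l, ∃ i, X i l ≠ 0) :
    app (shrink p (gram X)) (ridge X y p) = app X.transpose y := by
  obtain ⟨l, hl, h⟩ := exists_coercive X hp0 hp1 hX
  have hinj : Function.Injective (shrink p (gram X)).mulVec := by
    intro a b hab
    have h1 := h (WithLp.toLp 2 (a - b))
    have h2 : app (shrink p (gram X)) (WithLp.toLp 2 (a - b)) = 0 := by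
      ext i; simp [app, Matrix.mulVec_sub, hab]
    rw [smul_app, h2, smul_zero, inner_zero_left] at h1
    have h3 : ‖(WithLp.toLp 2 (a - b) : Vec d)‖ ^ 2 = 0 :=
      le_antisymm (nonpos_of_mul_nonpos_right h1 hl) (by positivity)
    have h4 : (WithLp.toLp 2 (a - b) : Vec d) = 0 := norm_eq_zero.1 (pow_eq_zero_iff two_ne_zero |>.1 h3)
    have h5 := congrArg WithLp.ofLp h4
    exact sub_eq_zero.1 h5
  have hu := Matrix.mulVec_injective_iff_isUnit.1 hinj
  rw [ridge, ← app_mul, Matrix.mul_nonsing_inv _ ((Matrix.isUnit_iff_isUnit_det _).1 hu), one_app]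

/-- The identity `D 𝕏 D + D 𝕏̄ (p I - D) = D 𝕏_p`, applied to `β̃` with `𝕏_p β̃ = Xᵀ y`, writes `D
Xᵀ y` as `D 𝕏 D β̃` plus the noise. -/
theorem gdStep_sub_ridge (X : Matrix (Fin n) (Fin d) ℝ) (y : Vec n) {p : ℝ} (hp0 : 0 < p)
    (hp1 : p < 1) (hX : ∀ l, ∃ i, X i l ≠ 0) (α : ℝ) (m : Mask d) (u : Vec d) :
    gdStep X y α m u - ridge X y p = (u - ridge X y p) -
      α • app (maskMat m * gram X * maskMat m) (u - ridge X y p) + α • noise X y p m := by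
  set β := ridge X y p with hβ
  have h1 : maskMat m * gram X * maskMat m + maskMat m * offDiag (gram X) * (p • 1 - maskMat m) =
      maskMat m * shrink p (gram X) := by
    ext i j
    have e : (p • (1 : Matrix (Fin d) (Fin d) ℝ) - maskMat m) =
        Matrix.diagonal fun i => p - keep m i := by
      ext a b
      by_cases hab : a = b
      · subst hab; simp [maskMat, keep]
      · simp [maskMat, hab]
    rw [Matrix.add_apply, maskMat_mul_mul_apply, e]
    have e2 : maskMat m = Matrix.diagonal fun i => keep m i := rfl
    rw [e2, Matrix.mul_diagonal, Matrix.diagonal_mul, Matrix.diagonal_mul]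
    rcases eq_or_ne i j with rfl | hij
    · simp only [keep_mul_self]; simp [offDiag, shrink]; ring
    · simp [offDiag, shrink, hij]; ring
  have h2 : app (maskMat m * gram X * maskMat m) β + noise X y p m =
      app (maskMat m) (app X.transpose y) := by
    rw [noise, ← hβ, ← add_app, h1, app_mul, hβ, app_shrink_ridge X y hp0 hp1 hX]
  have h3 : app (maskMat m) (app X.transpose (y - app X (app (maskMat m) u))) =
      app (maskMat m) (app X.transpose y) - app (maskMat m * gram X * maskMat m) u := by
    rw [app_sub, app_sub, gram, app_mul, app_mul, app_mul]
  rw [gdStep, h3, ← h2, app_sub]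
  module

theorem affineStep_sub_ridge (X : Matrix (Fin n) (Fin d) ℝ) (y : Vec n) (p α : ℝ) (m : Mask d)
    (u : Vec d) :
    affineStep X y p α m u - ridge X y p = (u - ridge X y p) -
      α • app (p • shrink p (gram X)) (u - ridge X y p) + α • noise X y p m := by
  rw [affineStep, sub_app, one_app, smul_app, smul_app, smul_smul]
  module

end Coercive

end DropoutGD

namespace DropoutGD

/-! ### From mean-square contraction to unique stationary laws with all moments; rescaling. -/

section Moments

open scoped ENNReal NNReal

theorem integral_rpow_le {Ω : Type*} [MeasurableSpace Ω] (μ : Measure Ω) [IsProbabilityMeasure μ]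
    {f : Ω → ℝ} (hf0 : ∀ x, 0 ≤ f x) (hf : Integrable f μ) {q : ℝ} (hq : 1 ≤ q)
    (hfq : Integrable (fun x => f x ^ q) μ) : (∫ x, f x ∂μ) ^ q ≤ ∫ x, f x ^ q ∂μ :=
  (convexOn_rpow hq).map_integral_le
    (Real.continuous_rpow_const (by linarith)).continuousOn isClosed_Ici (ae_of_all _ hf0) hf hfq

theorem integral_le_rpow_inv {Ω : Type*} [MeasurableSpace Ω] (μ : Measure Ω)
    [IsProbabilityMeasure μ] {f : Ω → ℝ} (hf0 : ∀ x, 0 ≤ f x) (hf : Integrable f μ) {q : ℝ}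
    (hq : 1 ≤ q) (hfq : Integrable (fun x => f x ^ q) μ) :
    ∫ x, f x ∂μ ≤ (∫ x, f x ^ q ∂μ) ^ (1 / q) := by
  have h0 : 0 ≤ ∫ x, f x ∂μ := integral_nonneg hf0
  calc ∫ x, f x ∂μ = ((∫ x, f x ∂μ) ^ q) ^ (1 / q) := by
        rw [one_div, Real.rpow_rpow_inv h0 (by linarith)]
    _ ≤ _ := Real.rpow_le_rpow (by positivity) (integral_rpow_le μ hf0 hf hq hfq) (by positivity)

variable {ι : Type*} [MeasurableSpace ι] [Finite ι] [MeasurableSingletonClass ι]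
variable {E : Type*} [NormedAddCommGroup E] [InnerProductSpace ℝ E] [FiniteDimensional ℝ E]
  [MeasurableSpace E] [BorelSpace E] (μ : Measure ι) [IsProbabilityMeasure μ]

theorem norm_sq_integral_le (f : ι → E) : ‖∫ m, f m ∂μ‖ ^ 2 ≤ ∫ m, ‖f m‖ ^ 2 ∂μ := by
  have h := integral_rpow_le μ (fun m => norm_nonneg (f m)) (integrable_of_finite' _ _)
    one_le_two (integrable_of_finite' _ _)
  simp only [Real.rpow_two] at h
  exact le_trans (by gcongr; exact norm_integral_le_integral_norm _) h

/-- Higher powers come from the square and the pointwise bound: `‖f‖^q ≤ c^(q - 2) ‖f‖²`. -/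
theorem lintegral_enorm_rpow_le {f : ι → E} {c κ q : ℝ} (hc : 0 ≤ c) (hκ0 : 0 ≤ κ) (hq : 2 ≤ q)
    (h1 : ∀ m, ‖f m‖ ≤ c) (h2 : ∫ m, ‖f m‖ ^ 2 ∂μ ≤ κ * c ^ 2) :
    ∫⁻ m, ‖f m‖ₑ ^ q ∂μ ≤ ENNReal.ofReal κ * ENNReal.ofReal c ^ q := by
  have hq0 : 0 ≤ q := by linarith
  have e : ∀ m, ‖f m‖ₑ ^ q = ENNReal.ofReal (‖f m‖ ^ q) := fun m => by
    rw [← ofReal_norm, ENNReal.ofReal_rpow_of_nonneg (norm_nonneg _) hq0]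
  simp only [e]
  rw [← ofReal_integral_eq_lintegral_ofReal (integrable_of_finite' _ _)
    (ae_of_all _ fun m => by positivity), ENNReal.ofReal_rpow_of_nonneg hc hq0,
    ← ENNReal.ofReal_mul hκ0]
  refine ENNReal.ofReal_le_ofReal ?_
  have hcq : c ^ q = c ^ (q - 2) * c ^ 2 := by
    rw [← Real.rpow_two, ← Real.rpow_add_of_nonneg hc (by linarith) (by norm_num)]
    congr 1; ring
  calc ∫ m, ‖f m‖ ^ q ∂μ ≤ ∫ m, c ^ (q - 2) * ‖f m‖ ^ 2 ∂μ := by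
        refine integral_mono (integrable_of_finite' _ _) (integrable_of_finite' _ _) fun m => ?_
        have : ‖f m‖ ^ q = ‖f m‖ ^ (q - 2) * ‖f m‖ ^ 2 := by
          rw [← Real.rpow_two, ← Real.rpow_add_of_nonneg (norm_nonneg _) (by linarith) (by norm_num)]
          congr 1; ring
        simp only [this]
        exact mul_le_mul_of_nonneg_right
          (Real.rpow_le_rpow (norm_nonneg _) (h1 m) (by linarith)) (sq_nonneg _)
    _ = c ^ (q - 2) * ∫ m, ‖f m‖ ^ 2 ∂μ := integral_const_mul _ _
    _ ≤ c ^ (q - 2) * (κ * c ^ 2) := by gcongr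
    _ = κ * c ^ q := by rw [hcq]; ring

theorem integral_norm_sub_le_sqrt {F : ι → E → E} {κ : ℝ}
    (h2 : ∀ u v, ∫ m, ‖F m u - F m v‖ ^ 2 ∂μ ≤ κ * ‖u - v‖ ^ 2) (u v : E) :
    ∫ m, ‖F m u - F m v‖ ∂μ ≤ √κ * ‖u - v‖ := by
  have h := integral_rpow_le μ (fun m => norm_nonneg (F m u - F m v)) (integrable_of_finite' _ _)
    one_le_two (integrable_of_finite' _ _)
  simp only [Real.rpow_two] at h
  have h3 := h.trans (h2 u v)
  rw [← Real.sqrt_sq (norm_nonneg (u - v)), ← Real.sqrt_mul' _ (by positivity)]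
  exact Real.le_sqrt_of_sq_le h3

/-- A nonexpansive random iteration that contracts in mean square has exactly one stationary law,
and this law has moments of all orders. -/
theorem exists_unique_pushLaw_fixed {F : ι → E → E} (hF : ∀ m, Continuous (F m)) {κ : ℝ}
    (hκ0 : 0 ≤ κ) (hκ1 : κ < 1) (h1 : ∀ m u v, ‖F m u - F m v‖ ≤ ‖u - v‖)
    (h2 : ∀ u v, ∫ m, ‖F m u - F m v‖ ^ 2 ∂μ ≤ κ * ‖u - v‖ ^ 2) :
    ∃ π : Measure E, IsProbabilityMeasure π ∧ pushLaw μ F π = π ∧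
      (∀ q : ℝ, MemLp id (ENNReal.ofReal q) π) ∧
      ∀ π' : Measure E, IsProbabilityMeasure π' → pushLaw μ F π' = π' → π' = π := by
  have hex : ∀ q : ℝ, 2 ≤ q → ∃ π : Measure E, IsProbabilityMeasure π ∧ pushLaw μ F π = π ∧
      MemLp id (ENNReal.ofReal q) π := fun q hq =>
    exists_pushLaw_fixed μ hF (by linarith) (κ := ⟨κ, hκ0⟩) hκ1 fun u v => by
      have h := lintegral_enorm_rpow_le μ (norm_nonneg (u - v)) hκ0 hq (fun m => h1 m u v) (h2 u v)
      rw [ofReal_norm] at h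
      convert h using 2
      rw [ENNReal.ofReal, Real.toNNReal_of_nonneg hκ0]
      rfl
  have huniq : ∀ π π' : Measure E, IsProbabilityMeasure π → IsProbabilityMeasure π' →
      pushLaw μ F π = π → pushLaw μ F π' = π' → π' = π := fun π π' _ _ h h' =>
    pushLaw_fixed_unique μ hF (Real.sqrt_nonneg κ)
      (by rw [Real.sqrt_lt' one_pos]; simpa using hκ1) (integral_norm_sub_le_sqrt μ h2) h' h
  obtain ⟨π, hπ, hfix, -⟩ := hex 2 le_rfl
  refine ⟨π, hπ, hfix, fun q => ?_, fun π' hπ' h' => huniq π π' hπ hπ' hfix h'⟩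
  -- Existence yields a law for each exponent separately; uniqueness identifies them, so one law has
  -- all the moments.
  obtain ⟨π', hπ', hfix', hmem⟩ := hex (max q 2) (le_max_right _ _)
  rw [huniq π π' hπ hπ' hfix hfix'] at hmem
  exact hmem.mono_exponent (ENNReal.ofReal_le_ofReal (le_max_left _ _))

theorem map_pushLaw {f g : ι → E → E} (hf : ∀ m, Continuous (f m)) (hg : ∀ m, Continuous (g m))
    {S : E → E} (hS : Continuous S) (h : ∀ m u, S (f m u) = g m (S u)) (π : Measure E)
    [IsProbabilityMeasure π] : (pushLaw μ f π).map S = pushLaw μ g (π.map S) := by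
  have e := Measure.map_prod_map μ π measurable_id hS.measurable
  rw [Measure.map_id] at e
  rw [pushLaw, pushLaw, Measure.map_map hS.measurable (measurable_uncurry_of_finite hf), e,
    Measure.map_map (measurable_uncurry_of_finite hg) (measurable_id.prodMap hS.measurable)]
  congr 1
  ext z : 1
  exact h z.1 z.2

/-- Centering at `β` and division by `√α`. -/
noncomputable def rescale (β : E) (α : ℝ) (u : E) : E := (√α)⁻¹ • (u - β)

theorem continuous_rescale (β : E) (α : ℝ) : Continuous (rescale β α) := by
  unfold rescale; fun_prop

/-- Rescaling conjugates the two iterations; `α / √α = √α` gives the size of the additive noise. -/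
theorem pushLaw_rescale {f : ι → E → E} (hf : ∀ m, Continuous (f m)) {M : ι → E →L[ℝ] E}
    {h : ι → E} {α : ℝ} {β : E}
    (hfβ : ∀ m u, f m u - β = (u - β) - α • M m (u - β) + α • h m) {π : Measure E}
    [IsProbabilityMeasure π] (hπ : pushLaw μ f π = π) :
    pushLaw μ (scaledStep M h α) (π.map (rescale β α)) = π.map (rescale β α) := by
  rw [← map_pushLaw μ hf (continuous_scaledStep M h α) (continuous_rescale β α) _ π, hπ]
  intro m u
  have hr : (√α)⁻¹ * α = √α := by
    rw [inv_mul_eq_div, Real.div_sqrt]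
  rw [rescale, hfβ, scaledStep, rescale, map_smul, smul_add, smul_sub, smul_smul (√α)⁻¹ α (h m), hr,
    smul_comm α]

theorem memLp_rescale (β : E) (α : ℝ) {π : Measure E} [IsProbabilityMeasure π]
    (hπ : MemLp id 2 π) : MemLp id 2 (π.map (rescale β α)) := by
  rw [memLp_map_measure_iff aestronglyMeasurable_id (continuous_rescale β α).aemeasurable]
  exact (hπ.sub (memLp_const β)).const_smul ((√α)⁻¹)

end Moments

/-! ### Contraction and stationary laws for gradient descent with dropout and for the affine
recursion. -/

section Dropout

variable {n d : ℕ}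

/-- `D 𝕏 D` as an operator. -/
noncomputable def maskGramOp (X : Matrix (Fin n) (Fin d) ℝ) (m : Mask d) : Vec d →L[ℝ] Vec d :=
  Matrix.toEuclideanCLM (𝕜 := ℝ) (maskMat m * gram X * maskMat m)

/-- `p 𝕏_p`, the mean of `D 𝕏 D`, as an operator. -/
noncomputable def meanGramOp (X : Matrix (Fin n) (Fin d) ℝ) (p : ℝ) : Vec d →L[ℝ] Vec d :=
  Matrix.toEuclideanCLM (𝕜 := ℝ) (p • shrink p (gram X))

theorem maskGramOp_apply (X : Matrix (Fin n) (Fin d) ℝ) (m : Mask d) (v : Vec d) :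
    maskGramOp X m v = app (maskMat m * gram X * maskMat m) v := rfl

theorem meanGramOp_apply (X : Matrix (Fin n) (Fin d) ℝ) (p : ℝ) (v : Vec d) :
    meanGramOp X p v = app (p • shrink p (gram X)) v := rfl

theorem inner_meanGramOp_comm (X : Matrix (Fin n) (Fin d) ℝ) (p : ℝ) (u v : Vec d) :
    inner ℝ (meanGramOp X p u) v = inner ℝ u (meanGramOp X p v) := by
  have h : (p • shrink p (gram X)).transpose = p • shrink p (gram X) := by
    rw [Matrix.transpose_smul, shrink_transpose (gram_transpose X)]
  rw [meanGramOp_apply, meanGramOp_apply, ← inner_app_transpose, h]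

theorem integral_inner_maskGramOp (X : Matrix (Fin n) (Fin d) ℝ) (p : unitInterval) (t z : Vec d) :
    ∫ m, inner ℝ (maskGramOp X m z) t ∂(dropoutLaw d p) = inner ℝ z (meanGramOp X p t) := by
  rw [← inner_meanGramOp_comm]
  exact integral_inner_app_mask p (gram X) t z

theorem integral_maskGramOp (X : Matrix (Fin n) (Fin d) ℝ) (p : unitInterval) (z : Vec d) :
    ∫ m, maskGramOp X m z ∂(dropoutLaw d p) = meanGramOp X p z := by
  refine ext_inner_left ℝ fun t => ?_
  rw [← integral_inner (integrable_of_finite' _ _), real_inner_comm, inner_meanGramOp_comm,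
    ← integral_inner_maskGramOp]
  exact integral_congr_ae (ae_of_all _ fun m => real_inner_comm _ _)

theorem integral_norm_sq_sub_maskGramOp_le (X : Matrix (Fin n) (Fin d) ℝ) (p : unitInterval)
    {l α : ℝ} (hl : ∀ v, l * ‖v‖ ^ 2 ≤ inner ℝ (meanGramOp X p v) v) (hα0 : 0 ≤ α)
    (hα : α * specNorm (gram X) ≤ 2) (v : Vec d) :
    ∫ m, ‖v - α • maskGramOp X m v‖ ^ 2 ∂(dropoutLaw d p) ≤
      (1 - l * (α * (2 - α * specNorm (gram X)))) * ‖v‖ ^ 2 := by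
  calc _ ≤ ∫ m, (‖v‖ ^ 2 - α * (2 - α * specNorm (gram X)) * inner ℝ (maskGramOp X m v) v)
        ∂(dropoutLaw d p) :=
        integral_mono (integrable_of_finite' _ _) (integrable_of_finite' _ _)
          fun m => norm_sq_sub_smul_mask_gram_le X α m v
    _ = ‖v‖ ^ 2 - α * (2 - α * specNorm (gram X)) * inner ℝ (meanGramOp X p v) v := by
        rw [integral_sub (integrable_of_finite' _ _) (integrable_of_finite' _ _),
          integral_const_mul, integral_inner_maskGramOp, inner_meanGramOp_comm]
        simp
    _ ≤ _ := by
        have h1 : 0 ≤ α * (2 - α * specNorm (gram X)) := mul_nonneg hα0 (by linarith)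
        nlinarith [mul_le_mul_of_nonneg_left (hl v) h1]

/-- By Jensen: `v - α G v` is the mean of `v - α M v`, so the averaged recursion inherits the bound
of the random one. -/
theorem norm_sq_sub_meanGramOp_le (X : Matrix (Fin n) (Fin d) ℝ) (p : unitInterval)
    {l α : ℝ} (hl : ∀ v, l * ‖v‖ ^ 2 ≤ inner ℝ (meanGramOp X p v) v) (hα0 : 0 ≤ α)
    (hα : α * specNorm (gram X) ≤ 2) (v : Vec d) :
    ‖v - α • meanGramOp X p v‖ ^ 2 ≤
      (1 - l * (α * (2 - α * specNorm (gram X)))) * ‖v‖ ^ 2 := by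
  have h : v - α • meanGramOp X p v = ∫ m, (v - α • maskGramOp X m v) ∂(dropoutLaw d p) := by
    rw [integral_sub (integrable_of_finite' _ _) (integrable_of_finite' _ _), integral_smul,
      integral_maskGramOp]
    simp
  rw [h]
  exact (norm_sq_integral_le _ _).trans (integral_norm_sq_sub_maskGramOp_le X p hl hα0 hα v)

theorem continuous_app {n d : ℕ} (A : Matrix (Fin n) (Fin d) ℝ) : Continuous (app A) := by
  unfold app
  fun_prop

theorem continuous_gdStep (X : Matrix (Fin n) (Fin d) ℝ) (y : Vec n) (α : ℝ) (m : Mask d) :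
    Continuous (gdStep X y α m) := by
  have h1 := continuous_app (maskMat m)
  have h2 := continuous_app X
  have h3 := continuous_app X.transpose
  unfold gdStep
  fun_prop

theorem continuous_affineStep (X : Matrix (Fin n) (Fin d) ℝ) (y : Vec n) (p α : ℝ) (m : Mask d) :
    Continuous (affineStep X y p α m) := by
  have h := continuous_app (1 - (α * p) • shrink p (gram X))
  unfold affineStep
  fun_prop

theorem gdStep_sub (X : Matrix (Fin n) (Fin d) ℝ) (y : Vec n) (α : ℝ) (m : Mask d) (u v : Vec d) :
    gdStep X y α m u - gdStep X y α m v = (u - v) - α • maskGramOp X m (u - v) := by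
  have h3 : ∀ u, app (maskMat m) (app X.transpose (y - app X (app (maskMat m) u))) =
      app (maskMat m) (app X.transpose y) - maskGramOp X m u := fun u => by
    rw [maskGramOp_apply, app_sub, app_sub, gram, app_mul, app_mul, app_mul]
  rw [gdStep, gdStep, h3, h3, map_sub]
  module

theorem affineStep_sub (X : Matrix (Fin n) (Fin d) ℝ) (y : Vec n) (p α : ℝ) (m : Mask d)
    (u v : Vec d) :
    affineStep X y p α m u - affineStep X y p α m v = (u - v) - α • meanGramOp X p (u - v) := by
  have h1 := affineStep_sub_ridge X y p α m u
  have h2 := affineStep_sub_ridge X y p α m v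
  have h3 : affineStep X y p α m u - affineStep X y p α m v =
      (affineStep X y p α m u - ridge X y p) - (affineStep X y p α m v - ridge X y p) := by abel
  rw [h3, h1, h2, ← meanGramOp_apply, ← meanGramOp_apply, map_sub, map_sub, map_sub]
  module

/-- Taking the maximum with 0 supplies a nonnegative contraction factor without comparing `l` with
the spectral norm. -/
theorem contraction_factor_bounds (X : Matrix (Fin n) (Fin d) ℝ) {l α : ℝ} (hl0 : 0 < l)
    (hα0 : 0 < α) (hα : α * specNorm (gram X) < 2) :
    max (1 - l * (α * (2 - α * specNorm (gram X)))) 0 < 1 := by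
  have : 0 < l * (α * (2 - α * specNorm (gram X))) :=
    mul_pos hl0 (mul_pos hα0 (by linarith))
  exact max_lt (by linarith) one_pos

theorem exists_unique_gd_stationary (X : Matrix (Fin n) (Fin d) ℝ) (y : Vec n) (p : unitInterval)
    {l α : ℝ} (hl0 : 0 < l) (hl : ∀ v, l * ‖v‖ ^ 2 ≤ inner ℝ (meanGramOp X p v) v) (hα0 : 0 < α)
    (hα : α * specNorm (gram X) < 2) :
    ∃ π : Measure (Vec d), IsProbabilityMeasure π ∧ pushLaw (dropoutLaw d p) (gdStep X y α) π = π ∧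
      (∀ q : ℝ, MemLp id (ENNReal.ofReal q) π) ∧
      ∀ π' : Measure (Vec d), IsProbabilityMeasure π' →
        pushLaw (dropoutLaw d p) (gdStep X y α) π' = π' → π' = π := by
  refine exists_unique_pushLaw_fixed _ (continuous_gdStep X y α) (le_max_right _ _)
    (contraction_factor_bounds X hl0 hα0 hα) (fun m u v => ?_) (fun u v => ?_)
  · rw [gdStep_sub]
    exact norm_sub_smul_mask_gram_le X hα0.le hα.le m _
  · simp only [gdStep_sub]
    refine (integral_norm_sq_sub_maskGramOp_le X p hl hα0.le hα.le _).trans ?_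
    gcongr
    exact le_max_left _ _

theorem exists_unique_affine_stationary (X : Matrix (Fin n) (Fin d) ℝ) (y : Vec n)
    (p : unitInterval) {l α : ℝ} (hl0 : 0 < l)
    (hl : ∀ v, l * ‖v‖ ^ 2 ≤ inner ℝ (meanGramOp X p v) v) (hα0 : 0 < α)
    (hα : α * specNorm (gram X) < 2) :
    ∃ π : Measure (Vec d), IsProbabilityMeasure π ∧
      pushLaw (dropoutLaw d p) (affineStep X y p α) π = π ∧
      (∀ q : ℝ, MemLp id (ENNReal.ofReal q) π) ∧
      ∀ π' : Measure (Vec d), IsProbabilityMeasure π' →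
        pushLaw (dropoutLaw d p) (affineStep X y p α) π' = π' → π' = π := by
  have hsq : ∀ w : Vec d, ‖w - α • meanGramOp X p w‖ ^ 2 ≤
      max (1 - l * (α * (2 - α * specNorm (gram X)))) 0 * ‖w‖ ^ 2 := fun w => by
    refine (norm_sq_sub_meanGramOp_le X p hl hα0.le hα.le _).trans ?_
    gcongr
    exact le_max_left _ _
  have hlt := contraction_factor_bounds X hl0 hα0 hα
  refine exists_unique_pushLaw_fixed _ (continuous_affineStep X y p α) (le_max_right _ _)
    hlt (fun m u v => ?_) (fun u v => ?_)
  · rw [affineStep_sub]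
    refine le_of_sq_le_sq ((hsq _).trans ?_) (norm_nonneg _)
    exact mul_le_of_le_one_left (by positivity) hlt.le
  · simp only [affineStep_sub]
    simpa using hsq (u - v)

theorem isStationaryLaw_stationaryLaw {μ : Measure (Mask d)} {f : Mask d → Vec d → Vec d}
    (h : ∃ π, IsStationaryLaw μ f π) : IsStationaryLaw μ f (stationaryLaw μ f) := by
  rw [stationaryLaw, dif_pos h]
  exact h.choose_spec

end Dropout

end DropoutGD

namespace DropoutGD

/-! ### The Lyapunov equation. -/

section Lyapunov

variable {d : ℕ}

/-- Pair the equation with `V` in the Frobenius inner product. Coercivity on the columns gives `⟨G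
V, V⟩ ≥ l ‖V‖²`, and on the rows `⟨V G, V⟩ ≥ 0`. Symmetry of `V` plays no role. -/
theorem lyapunov_injective {G : Matrix (Fin d) (Fin d) ℝ} (hGs : G.transpose = G) {l : ℝ}
    (hl0 : 0 < l) (hl : ∀ v : Vec d, l * ‖v‖ ^ 2 ≤ inner ℝ (app G v) v)
    {V : Matrix (Fin d) (Fin d) ℝ} (hV : V * G + G * V = 0) : V = 0 := by
  have hsq : ∀ v : Vec d, ‖v‖ ^ 2 = ∑ i, v i ^ 2 := fun v => EuclideanSpace.real_norm_sq_eq v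
  have h1 : ∑ j, l * ∑ i, V i j ^ 2 ≤ ∑ j, ∑ i, (G * V) i j * V i j :=
    Finset.sum_le_sum fun j _ => by
      have h := hl (WithLp.toLp 2 fun i => V i j)
      rw [hsq, inner_eq_sum] at h
      simpa [app_apply, Matrix.mul_apply] using h
  have h2 : 0 ≤ ∑ i, ∑ j, (V * G) i j * V i j :=
    Finset.sum_nonneg fun i _ => by
      have h := hl (WithLp.toLp 2 fun j => V i j)
      have h0 : 0 ≤ l * ‖(WithLp.toLp 2 fun j => V i j : Vec d)‖ ^ 2 := by positivity
      have h' := h0.trans h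
      rw [inner_eq_sum] at h'
      refine h'.trans (le_of_eq (Finset.sum_congr rfl fun j _ => ?_))
      rw [app_apply, Matrix.mul_apply]
      congr 1
      refine Finset.sum_congr rfl fun k _ => ?_
      have : G j k = G k j := by conv_lhs => rw [← hGs, Matrix.transpose_apply]
      simp [this, mul_comm]
  rw [Finset.sum_comm] at h2
  have h3 : ∑ j, ∑ i, (V * G) i j * V i j + ∑ j, ∑ i, (G * V) i j * V i j = 0 := by
    rw [← Finset.sum_add_distrib]
    refine Finset.sum_eq_zero fun j _ => ?_
    rw [← Finset.sum_add_distrib]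
    refine Finset.sum_eq_zero fun i _ => ?_
    rw [← add_mul, ← Matrix.add_apply, hV]
    simp
  rw [← Finset.mul_sum] at h1
  have h4 : ∑ j, ∑ i, V i j ^ 2 ≤ 0 := by
    by_contra hcon
    have := mul_pos hl0 (not_le.1 hcon)
    linarith
  have h5 : ∑ j, ∑ i, V i j ^ 2 = 0 :=
    le_antisymm h4 (Finset.sum_nonneg fun j _ => Finset.sum_nonneg fun i _ => sq_nonneg _)
  ext i j
  have h6 := (Finset.sum_eq_zero_iff_of_nonneg fun j _ =>
    Finset.sum_nonneg fun i _ => sq_nonneg (V i j)).1 h5 j (Finset.mem_univ _)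
  have h7 := (Finset.sum_eq_zero_iff_of_nonneg fun i _ => sq_nonneg (V i j)).1 h6 i
    (Finset.mem_univ _)
  simpa using h7

/-- The Lyapunov operator `V ↦ V G + G V`. -/
def lyapunovMap (G : Matrix (Fin d) (Fin d) ℝ) :
    Matrix (Fin d) (Fin d) ℝ →ₗ[ℝ] Matrix (Fin d) (Fin d) ℝ where
  toFun V := V * G + G * V
  map_add' U V := by rw [add_mul, mul_add]; abel
  map_smul' c V := by simp [smul_add]

/-- The Lyapunov operator as a linear isomorphism. -/
theorem exists_lyapunovEquiv {G : Matrix (Fin d) (Fin d) ℝ} (hGs : G.transpose = G) {l : ℝ}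
    (hl0 : 0 < l) (hl : ∀ v : Vec d, l * ‖v‖ ^ 2 ≤ inner ℝ (app G v) v) :
    ∃ e : Matrix (Fin d) (Fin d) ℝ ≃ₗ[ℝ] Matrix (Fin d) (Fin d) ℝ,
      ∀ V, e V = V * G + G * V := by
  refine ⟨LinearEquiv.ofInjectiveEndo (lyapunovMap G) ?_, fun V => rfl⟩
  rw [← LinearMap.ker_eq_bot, LinearMap.ker_eq_bot']
  exact fun V hV => lyapunov_injective hGs hl0 hl hV

/-- Approximate solutions of a Lyapunov equation converge to the solution. -/
theorem tendsto_of_perturbed_lyapunov {G S : Matrix (Fin d) (Fin d) ℝ}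
    (e : Matrix (Fin d) (Fin d) ℝ ≃ₗ[ℝ] Matrix (Fin d) (Fin d) ℝ)
    (he : ∀ V, e V = V * G + G * V) {Ξ : ℝ → Matrix (Fin d) (Fin d) ℝ} {C : ℝ}
    (hΞ : ∀ᶠ α in 𝓝[>] (0 : ℝ), Ξ α * G + G * Ξ α = S + α • (G * Ξ α * G))
    (hC : ∀ᶠ α in 𝓝[>] (0 : ℝ), ∀ i j, |Ξ α i j| ≤ C) :
    Tendsto Ξ (𝓝[>] 0) (𝓝 (e.symm S)) := by
  -- The bound on `Ξ` makes the perturbation vanish; then `Ξ α` is the image of a convergent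
  -- right-hand side under the inverse operator, continuous in finite dimension.
  have hα : Tendsto (fun α : ℝ => α) (𝓝[>] 0) (𝓝 0) := tendsto_nhdsWithin_of_tendsto_nhds tendsto_id
  have h1 : Tendsto (fun α : ℝ => S + α • (G * Ξ α * G)) (𝓝[>] 0) (𝓝 S) := by
    have h2 : Tendsto (fun α : ℝ => α • (G * Ξ α * G)) (𝓝[>] 0) (𝓝 0) := by
      have h4 : Tendsto (fun α : ℝ => α • Ξ α) (𝓝[>] 0) (𝓝 0) := by
        refine tendsto_pi_nhds.2 fun i => tendsto_pi_nhds.2 fun j => ?_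
        have hb : Tendsto (fun α : ℝ => |α| * C) (𝓝[>] 0) (𝓝 0) := by
          simpa using hα.abs.mul_const C
        refine squeeze_zero_norm' ?_ hb
        filter_upwards [hC] with α h
        simp only [Matrix.smul_apply, smul_eq_mul, norm_mul, Real.norm_eq_abs]
        gcongr
        exact h i j
      have h5 : Continuous fun V : Matrix (Fin d) (Fin d) ℝ => G * V * G := by fun_prop
      have h6 := (h5.tendsto 0).comp h4
      simpa [Function.comp_def] using h6
    simpa using h2.const_add S
  have h3 : Continuous e.symm := e.symm.toLinearMap.continuous_of_finiteDimensional
  refine ((h3.tendsto S).comp h1).congr' ?_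
  filter_upwards [hΞ] with α h
  rw [Function.comp_apply, ← h, ← he, LinearEquiv.symm_apply_apply]

end Lyapunov

/-! ### Second moments of the stationary affine recursion. -/

section SecondMoments

variable {n d : ℕ}

theorem memLp_coord {ζ : Measure (Vec d)} (hζ2 : MemLp id 2 ζ) (i : Fin d) :
    MemLp (fun z : Vec d => z i) 2 ζ :=
  hζ2.of_le (by fun_prop : Measurable fun z : Vec d => z i).aestronglyMeasurable
    (ae_of_all _ fun z => PiLp.norm_apply_le z i)

theorem integrable_coord_mul {ζ : Measure (Vec d)} (hζ2 : MemLp id 2 ζ) (i j : Fin d) :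
    Integrable (fun z : Vec d => z i * z j) ζ :=
  (memLp_coord hζ2 i).integrable_mul (memLp_coord hζ2 j)

variable (X : Matrix (Fin n) (Fin d) ℝ) (y : Vec n) (p : unitInterval)

theorem scaledStep_meanGramOp_apply (α : ℝ) (m : Mask d) (z : Vec d) (i : Fin d) :
    scaledStep (fun _ => meanGramOp X p) (noise X y p) α m z i =
      app (1 - α • ((p : ℝ) • shrink p (gram X))) z i + √α * noise X y p m i := by
  rw [scaledStep, meanGramOp_apply, sub_app, one_app, smul_app α]
  rfl

variable {X y p}

/-- The mean `e` satisfies `e = (I - α G) e`, hence `G e = 0`, and coercivity forces `e = 0`. The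
covariance is therefore the second moment matrix. -/
theorem integral_coord_eq_zero {l α : ℝ} (hl0 : 0 < l)
    (hl : ∀ v, l * ‖v‖ ^ 2 ≤ inner ℝ (meanGramOp X p v) v) (hα0 : 0 < α)
    {ζ : Measure (Vec d)} [IsProbabilityMeasure ζ]
    (hζ : pushLaw (dropoutLaw d p) (scaledStep (fun _ => meanGramOp X p) (noise X y p) α) ζ = ζ)
    (hζ2 : MemLp id 2 ζ) (i : Fin d) : ∫ z, z i ∂ζ = 0 := by
  have hid : Integrable (fun z : Vec d => z) ζ := hζ2.integrable (by norm_num)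
  have hci : ∀ i, Integrable (fun z : Vec d => z i) ζ := fun i =>
    (memLp_coord hζ2 i).integrable (by norm_num)
  set e : Vec d := WithLp.toLp 2 fun i => ∫ z, z i ∂ζ with he
  have hstep : ∀ i, e i = app (1 - α • ((p : ℝ) • shrink p (gram X))) e i := fun i => by
    have h1 : ∫ z, z i ∂ζ = ∫ z, app (1 - α • ((p : ℝ) • shrink p (gram X))) z i ∂ζ := by
      conv_lhs => rw [← hζ, integral_pushLaw _ (continuous_scaledStep _ _ α) ζ
        (by rw [hζ]; exact hci i)]
      congr 1; ext z
      simp only [scaledStep_meanGramOp_apply]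
      rw [integral_add (integrable_of_finite' _ _) (integrable_of_finite' _ _),
        integral_const_mul, integral_noise_apply]
      simp
    change ∫ z, z i ∂ζ = _
    rw [h1]
    simp only [app_apply]
    rw [integral_finsetSum _ fun j _ => (hci j).const_mul _]
    exact Finset.sum_congr rfl fun j _ => integral_const_mul _ _
  have hG : meanGramOp X p e = 0 := by
    have h2 : e = app (1 - α • ((p : ℝ) • shrink p (gram X))) e := by ext i; exact hstep i
    rw [sub_app, one_app, smul_app α, ← meanGramOp_apply] at h2
    have h3 : α • meanGramOp X p e = 0 := sub_eq_self.1 h2.symm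
    exact (smul_eq_zero.1 h3).resolve_left hα0.ne'
  have h4 := hl e
  rw [hG, inner_zero_left] at h4
  have h5 : ‖e‖ ^ 2 = 0 := le_antisymm (nonpos_of_mul_nonpos_right h4 hl0) (by positivity)
  have h6 : e = 0 := norm_eq_zero.1 (pow_eq_zero_iff two_ne_zero |>.1 h5)
  have h7 : e i = 0 := by rw [h6]; rfl
  exact h7

/-- The second moments of the stationary law of the affine recursion. -/
theorem moment_matrix_eq {α : ℝ} (hα0 : 0 ≤ α)
    {ζ : Measure (Vec d)} [IsProbabilityMeasure ζ]
    (hζ : pushLaw (dropoutLaw d p) (scaledStep (fun _ => meanGramOp X p) (noise X y p) α) ζ = ζ)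
    (hζ2 : MemLp id 2 ζ) :
    (Matrix.of fun i j => ∫ z, z i * z j ∂ζ) =
      (1 - α • ((p : ℝ) • shrink p (gram X))) * (Matrix.of fun i j => ∫ z, z i * z j ∂ζ) *
        (1 - α • ((p : ℝ) • shrink p (gram X))).transpose + α • noiseCov X y p := by
  set B := 1 - α • ((p : ℝ) • shrink p (gram X)) with hB
  ext i j
  have hint := integrable_coord_mul hζ2
  have hBB : Integrable (fun z : Vec d => app B z i * app B z j) ζ := by
    simp only [app_apply, Finset.sum_mul, Finset.mul_sum]
    refine integrable_finsetSum _ fun k _ => integrable_finsetSum _ fun q _ => ?_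
    refine ((hint q k).const_mul (B i q * B j k)).congr (ae_of_all _ fun z => ?_)
    ring
  have h1 : ∫ z, z i * z j ∂ζ = ∫ z, (app B z i * app B z j + α * noiseCov X y p i j) ∂ζ := by
    conv_lhs => rw [← hζ, integral_pushLaw _ (continuous_scaledStep _ _ α) ζ
        (by rw [hζ]; exact hint i j)]
    congr 1; ext z
    simp only [scaledStep_meanGramOp_apply, ← hB]
    have e : ∀ m, (app B z i + √α * noise X y p m i) * (app B z j + √α * noise X y p m j) =
        app B z i * app B z j + (app B z i * √α) * noise X y p m j +
          (app B z j * √α) * noise X y p m i + α * (noise X y p m i * noise X y p m j) := fun m => by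
      have : √α * √α = α := Real.mul_self_sqrt hα0
      linear_combination (noise X y p m i * noise X y p m j) * this
    simp only [e]
    rw [integral_add (integrable_of_finite' _ _) (integrable_of_finite' _ _),
      integral_add (integrable_of_finite' _ _) (integrable_of_finite' _ _),
      integral_add (integrable_of_finite' _ _) (integrable_of_finite' _ _),
      integral_const]
    simp only [integral_const_mul, integral_noise_apply, noiseCov_apply]
    simp
  rw [Matrix.of_apply, h1, integral_add hBB (integrable_const _)]
  simp only [integral_const, probReal_univ, one_mul, Matrix.add_apply, Matrix.smul_apply,
    smul_eq_mul, add_left_inj]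
  simp only [app_apply, Matrix.mul_apply, Matrix.of_apply, Matrix.transpose_apply, Finset.sum_mul,
    Finset.mul_sum]
  have hBz : ∀ k q, Integrable (fun z : Vec d => B i q * z q * (B j k * z k)) ζ := fun k q =>
    ((hint q k).const_mul (B i q * B j k)).congr (ae_of_all _ fun z => by ring)
  rw [integral_finsetSum _ fun k _ => integrable_finsetSum _ fun q _ => hBz k q]
  refine Finset.sum_congr rfl fun k _ => ?_
  rw [integral_finsetSum _ fun q _ => hBz k q]
  refine Finset.sum_congr rfl fun q _ => ?_
  rw [← integral_const_mul, ← integral_mul_const]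
  congr 1; ext z; ring

variable (X y p)

/-- The stationary law of the affine recursion, centered and divided by `√α`. -/
noncomputable def scaledAffineLaw (α : ℝ) : Measure (Vec d) :=
  (affineLaw X y p α).map (rescale (ridge X y p) α)

variable {X y p}

theorem affineLaw_spec {l α : ℝ} (hl0 : 0 < l)
    (hl : ∀ v, l * ‖v‖ ^ 2 ≤ inner ℝ (meanGramOp X p v) v) (hα0 : 0 < α)
    (hα : α * specNorm (gram X) < 2) :
    IsProbabilityMeasure (affineLaw X y p α) ∧
      pushLaw (dropoutLaw d p) (affineStep X y p α) (affineLaw X y p α) = affineLaw X y p α ∧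
      MemLp id 2 (affineLaw X y p α) := by
  obtain ⟨π, h1, h2, h3, h4⟩ := exists_unique_affine_stationary X y p hl0 hl hα0 hα
  have hs := isStationaryLaw_stationaryLaw (μ := dropoutLaw d p) (f := affineStep X y p α)
    ⟨π, h1, h2⟩
  have he := h4 _ hs.1 hs.2
  refine ⟨hs.1, hs.2, ?_⟩
  rw [affineLaw, he]
  simpa using h3 2

theorem scaledAffineLaw_spec {l α : ℝ} (hl0 : 0 < l)
    (hl : ∀ v, l * ‖v‖ ^ 2 ≤ inner ℝ (meanGramOp X p v) v) (hα0 : 0 < α)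
    (hα : α * specNorm (gram X) < 2) :
    IsProbabilityMeasure (scaledAffineLaw X y p α) ∧
      pushLaw (dropoutLaw d p) (scaledStep (fun _ => meanGramOp X p) (noise X y p) α)
        (scaledAffineLaw X y p α) = scaledAffineLaw X y p α ∧
      MemLp id 2 (scaledAffineLaw X y p α) := by
  obtain ⟨h1, h2, h3⟩ := affineLaw_spec (y := y) hl0 hl hα0 hα
  unfold scaledAffineLaw
  refine ⟨Measure.isProbabilityMeasure_map (continuous_rescale _ _).aemeasurable, ?_,
    memLp_rescale _ _ h3⟩
  refine pushLaw_rescale (dropoutLaw d p) (f := affineStep X y p α)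
    (continuous_affineStep X y p α) (M := fun _ => meanGramOp X p) (h := noise X y p)
      (fun m u => ?_) h2
  rw [affineStep_sub_ridge X y p α m u, meanGramOp_apply]

theorem integral_scaledAffineLaw {f : Vec d → ℝ} (hf : Measurable f) (α : ℝ) :
    ∫ z, f z ∂(scaledAffineLaw X y p α) =
      ∫ u, f ((√α)⁻¹ • (u - ridge X y p)) ∂(affineLaw X y p α) :=
  integral_map (continuous_rescale _ _).aemeasurable hf.aestronglyMeasurable

theorem Xi_apply {l α : ℝ} (hl0 : 0 < l)
    (hl : ∀ v, l * ‖v‖ ^ 2 ≤ inner ℝ (meanGramOp X p v) v) (hα0 : 0 < α)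
    (hα : α * specNorm (gram X) < 2) (i j : Fin d) :
    Xi X y p α i j = ∫ z, z i * z j ∂(scaledAffineLaw X y p α) := by
  obtain ⟨h1, h2, h3⟩ := scaledAffineLaw_spec (y := y) hl0 hl hα0 hα
  have hm : ∀ i, ∫ u, ((√α)⁻¹ • (u - ridge X y p)) i ∂(affineLaw X y p α) = 0 := fun i => by
    rw [← integral_scaledAffineLaw (f := fun z => z i) (by fun_prop)]
    exact integral_coord_eq_zero hl0 hl hα0 h2 h3 i
  rw [Xi, covMat, Matrix.of_apply, covariance, hm, hm,
    integral_scaledAffineLaw (f := fun z => z i * z j) (by fun_prop)]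
  simp only [sub_zero]

theorem Xi_apply_eq_div {l α : ℝ} (hl0 : 0 < l)
    (hl : ∀ v, l * ‖v‖ ^ 2 ≤ inner ℝ (meanGramOp X p v) v) (hα0 : 0 < α)
    (hα : α * specNorm (gram X) < 2) (i j : Fin d) :
    Xi X y p α i j =
      (∫ u, (u i - ridge X y p i) * (u j - ridge X y p j) ∂(affineLaw X y p α)) / α := by
  rw [Xi_apply hl0 hl hα0 hα, integral_scaledAffineLaw (f := fun z => z i * z j) (by fun_prop),
    ← integral_div]
  congr 1; ext u
  have : (√α)⁻¹ * (√α)⁻¹ = α⁻¹ := by rw [← mul_inv, Real.mul_self_sqrt hα0.le]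
  simp only [PiLp.smul_apply, PiLp.sub_apply, smul_eq_mul]
  rw [div_eq_mul_inv, ← this]
  ring

/-- In the stationarity relation `V = (I - α G) V (I - α G) + α S` the terms of order 0 cancel, and
the rest is divided by `α`. -/
theorem Xi_equation {l α : ℝ} (hl0 : 0 < l)
    (hl : ∀ v, l * ‖v‖ ^ 2 ≤ inner ℝ (meanGramOp X p v) v) (hα0 : 0 < α)
    (hα : α * specNorm (gram X) < 2) :
    Xi X y p α * ((p : ℝ) • shrink p (gram X)) + ((p : ℝ) • shrink p (gram X)) * Xi X y p α =
      noiseCov X y p +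
        α • (((p : ℝ) • shrink p (gram X)) * Xi X y p α * ((p : ℝ) • shrink p (gram X))) := by
  obtain ⟨h1, h2, h3⟩ := scaledAffineLaw_spec (y := y) hl0 hl hα0 hα
  have h := moment_matrix_eq hα0.le h2 h3
  have he : (Matrix.of fun i j => ∫ z, z i * z j ∂(scaledAffineLaw X y p α)) = Xi X y p α := by
    ext i j; exact (Xi_apply hl0 hl hα0 hα i j).symm
  rw [he] at h
  have hs : ((p : ℝ) • shrink p (gram X)).transpose = (p : ℝ) • shrink p (gram X) := by
    rw [Matrix.transpose_smul, shrink_transpose (gram_transpose X)]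
  set G := (p : ℝ) • shrink p (gram X) with hG
  set V := Xi X y p α
  set S := noiseCov X y p
  rw [Matrix.transpose_sub, Matrix.transpose_one, Matrix.transpose_smul, hs] at h
  have h4 : α • (V * G + G * V) = α • (S + α • (G * V * G)) := by
    have e : (1 - α • G) * V * (1 - α • G) = V - α • (V * G + G * V) + α • (α • (G * V * G)) := by
      simp only [sub_mul, mul_sub, one_mul, mul_one, smul_mul_assoc, mul_smul_comm, smul_add,
        smul_sub]
      abel
    rw [e] at h
    have h5 : V - (V - α • (V * G + G * V) + α • (α • (G * V * G)) + α • S) = 0 := sub_eq_zero.2 h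
    rw [smul_add α S, ← sub_eq_zero, ← h5]
    generalize α • (V * G + G * V) = a
    generalize α • (α • (G * V * G)) = b
    abel
  exact smul_right_injective _ hα0.ne' h4

/-- The affine recursion is the linear model with constant `M = G`, so the uniform second moment
bound applies. With `α ‖𝕏‖ ≤ 1` the contraction factor is at most `1 - l α`. -/
theorem abs_Xi_apply_le {l α K : ℝ} (hl0 : 0 < l)
    (hl : ∀ v, l * ‖v‖ ^ 2 ≤ inner ℝ (meanGramOp X p v) v) (hα0 : 0 < α) (hα1 : α ≤ 1)
    (hα : α * specNorm (gram X) ≤ 1) (hK : 1 ≤ K) (hGK : ‖meanGramOp X p‖ ≤ K)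
    (hh : ∀ m, ‖noise X y p m‖ ≤ K) (i j : Fin d) :
    |Xi X y p α i j| ≤ 2 / l * (K ^ 2 + 2 * K ^ 4 / l) := by
  obtain ⟨h1, h2, h3⟩ := scaledAffineLaw_spec (y := y) hl0 hl hα0 (by linarith)
  rw [Xi_apply hl0 hl hα0 (by linarith)]
  refine le_trans ?_ (integral_norm_sq_stationary_le (dropoutLaw d p) hK (fun _ => hGK) hh
    (integral_inner_noise p X y) hα0 hα1 hl0 (fun v => ?_) h2 h3)
  · refine (norm_integral_le_integral_norm (fun z : Vec d => z i * z j)).trans ?_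
    refine integral_mono (integrable_coord_mul h3 i j).norm (integrable_norm_sq h3) fun z => ?_
    simp only [norm_mul, sq]
    exact mul_le_mul (PiLp.norm_apply_le z i) (PiLp.norm_apply_le z j) (norm_nonneg _)
      (norm_nonneg _)
  · have h := norm_sq_sub_meanGramOp_le X p hl hα0.le (by linarith) v
    simp only [integral_const, probReal_univ, one_smul]
    refine h.trans ?_
    gcongr
    nlinarith [mul_nonneg hl0.le hα0.le]

theorem Xi_posSemidef {l α : ℝ} (hl0 : 0 < l)
    (hl : ∀ v, l * ‖v‖ ^ 2 ≤ inner ℝ (meanGramOp X p v) v) (hα0 : 0 < α)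
    (hα : α * specNorm (gram X) < 2) : (Xi X y p α).PosSemidef := by
  obtain ⟨h1, h2, h3⟩ := scaledAffineLaw_spec (y := y) hl0 hl hα0 hα
  refine Matrix.PosSemidef.of_dotProduct_mulVec_nonneg ?_ fun x => ?_
  · ext i j
    rw [Matrix.conjTranspose_apply, Xi_apply hl0 hl hα0 hα, Xi_apply hl0 hl hα0 hα]
    simp [mul_comm]
  · have e : star x ⬝ᵥ Matrix.mulVec (Xi X y p α) x =
        ∫ z, (∑ i, x i * z i) ^ 2 ∂(scaledAffineLaw X y p α) := by
      simp only [dotProduct, Matrix.mulVec, Xi_apply hl0 hl hα0 hα, sq, Finset.sum_mul,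
        Finset.mul_sum, star_trivial]
      have hxz : ∀ i j, Integrable (fun z : Vec d => x j * z j * (x i * z i))
          (scaledAffineLaw X y p α) := fun i j =>
        ((integrable_coord_mul h3 j i).const_mul (x j * x i)).congr (ae_of_all _ fun z => by ring)
      rw [integral_finsetSum _ fun i _ => integrable_finsetSum _ fun j _ => hxz i j]
      refine Finset.sum_congr rfl fun i _ => ?_
      rw [integral_finsetSum _ fun j _ => hxz i j]
      refine Finset.sum_congr rfl fun j _ => ?_
      rw [← integral_mul_const, ← integral_const_mul]
      congr 1; ext z; ring
    rw [e]
    exact integral_nonneg fun z => sq_nonneg _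

theorem posSemidef_of_tendsto {F : Filter ℝ} [F.NeBot] {A : ℝ → Matrix (Fin d) (Fin d) ℝ}
    {B : Matrix (Fin d) (Fin d) ℝ} (h : Tendsto A F (𝓝 B)) (hA : ∀ᶠ α in F, (A α).PosSemidef) :
    B.PosSemidef := by
  refine Matrix.PosSemidef.of_dotProduct_mulVec_nonneg ?_ fun x => ?_
  · have h1 : Tendsto (fun α => (A α).conjTranspose) F (𝓝 B.conjTranspose) :=
      ((continuous_id.matrix_conjTranspose).tendsto B).comp h
    refine tendsto_nhds_unique (h1.congr' ?_) h
    filter_upwards [hA] with α hα using hα.1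
  · have h1 : Continuous fun V : Matrix (Fin d) (Fin d) ℝ => star x ⬝ᵥ Matrix.mulVec V x := by
      fun_prop
    refine ge_of_tendsto ((h1.tendsto B).comp h) ?_
    filter_upwards [hA] with α hα using hα.dotProduct_mulVec_nonneg x

end SecondMoments

end DropoutGD

namespace DropoutGD

/-! ### The contraction coefficient `r_{α,q}`. -/

section Contraction

variable {n d : ℕ} {X : Matrix (Fin n) (Fin d) ℝ} {y : Vec n} {p : unitInterval}

theorem app_one_sub_eq (α : ℝ) (m : Mask d) (v : Vec d) :
    app (1 - α • (maskMat m * gram X * maskMat m)) v = v - α • maskGramOp X m v := by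
  rw [sub_app, one_app, smul_app]; rfl

theorem contraction_nonneg (α q : ℝ) : 0 ≤ contraction X p α q :=
  Real.rpow_nonneg (Real.iSup_nonneg fun _ => integral_nonneg fun _ => by positivity) _

/-- Homogeneity reduces to unit vectors, and Jensen passes from the first moment to the moment of
order `q`. -/
theorem integral_norm_gdStep_sub_le_contraction {α q : ℝ} (hα0 : 0 ≤ α)
    (hα : α * specNorm (gram X) ≤ 2) (hq : 1 ≤ q) (u v : Vec d) :
    ∫ m, ‖gdStep X y α m u - gdStep X y α m v‖ ∂(dropoutLaw d p) ≤
      contraction X p α q * ‖u - v‖ := by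
  simp only [gdStep_sub]
  set w := u - v with hw
  rcases eq_or_ne w 0 with h0 | h0
  · simp [h0]
  have hw0 : 0 < ‖w‖ := norm_pos_iff.2 h0
  set A : Mask d → Vec d → Vec d := fun m v => v - α • maskGramOp X m v with hA
  have hle : ∀ m v, ‖A m v‖ ≤ ‖v‖ := fun m v => norm_sub_smul_mask_gram_le X hα0 hα m v
  let e : Metric.sphere (0 : Vec d) 1 := ⟨‖w‖⁻¹ • w, by
    rw [mem_sphere_zero_iff_norm, norm_smul, norm_inv, norm_norm, inv_mul_cancel₀ hw0.ne']⟩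
  have hAe : ∀ m, A m w = ‖w‖ • A m e.1 := fun m => by
    have : w = ‖w‖ • e.1 := by simp [e, smul_smul, hw0.ne']
    conv_lhs => rw [this]
    simp only [hA, map_smul, smul_sub, smul_comm α]
  have h1 : ∫ m, ‖A m w‖ ∂(dropoutLaw d p) = ‖w‖ * ∫ m, ‖A m e.1‖ ∂(dropoutLaw d p) := by
    rw [← integral_const_mul]
    congr 1; ext m
    rw [hAe, norm_smul, norm_norm]
  have h2 := integral_le_rpow_inv (dropoutLaw d p) (fun m => norm_nonneg (A m e.1))
    (integrable_of_finite' _ _) hq (integrable_of_finite' _ _)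
  -- A real supremum dominates its family only if the family is bounded; here nonexpansiveness
  -- bounds it by 1.
  have hbdd : BddAbove (Set.range fun v : Metric.sphere (0 : Vec d) 1 =>
      ∫ m, ‖app (1 - α • (maskMat m * gram X * maskMat m)) v.1‖ ^ q ∂(dropoutLaw d p)) := by
    refine ⟨1, ?_⟩
    rintro _ ⟨v, rfl⟩
    have hv : ‖v.1‖ = 1 := mem_sphere_zero_iff_norm.1 v.2
    calc _ ≤ ∫ _, (1 : ℝ) ∂(dropoutLaw d p) := by
          refine integral_mono (integrable_of_finite' _ _) (integrable_of_finite' _ _) fun m => ?_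
          simp only [app_one_sub_eq]
          exact Real.rpow_le_one (norm_nonneg _) ((hle m v.1).trans hv.le) (by linarith)
      _ = 1 := by simp
  have h3 := le_ciSup hbdd e
  simp only [app_one_sub_eq] at h3
  rw [h1, mul_comm]
  refine mul_le_mul_of_nonneg_right (h2.trans ?_) hw0.le
  rw [contraction]
  simp only [app_one_sub_eq]
  exact Real.rpow_le_rpow (integral_nonneg fun m => by positivity) h3 (by positivity)

theorem contraction_two_le {l α : ℝ} (hl0 : 0 < l)
    (hl : ∀ v, l * ‖v‖ ^ 2 ≤ inner ℝ (meanGramOp X p v) v) (hα0 : 0 ≤ α)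
    (hα : α * specNorm (gram X) ≤ 1) (hlα : α * l ≤ 1) :
    contraction X p α 2 ≤ Real.exp (-(l * α / 2)) := by
  have h1 : (⨆ v : Metric.sphere (0 : Vec d) 1,
      ∫ m, ‖app (1 - α • (maskMat m * gram X * maskMat m)) v.1‖ ^ (2 : ℝ) ∂(dropoutLaw d p)) ≤
      1 - l * α := by
    -- The bound must be nonnegative because a supremum over an empty sphere (`d = 0`) is 0; `hlα`
    -- ensures this.
    refine Real.iSup_le (fun v => ?_) (by linarith)
    have hv : ‖v.1‖ = 1 := mem_sphere_zero_iff_norm.1 v.2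
    simp only [app_one_sub_eq, Real.rpow_two]
    refine (integral_norm_sq_sub_maskGramOp_le X p hl hα0 (by linarith) v.1).trans ?_
    rw [hv]
    nlinarith [mul_nonneg hl0.le hα0]
  calc contraction X p α 2 ≤ (1 - l * α) ^ (1 / (2 : ℝ)) :=
        Real.rpow_le_rpow (Real.iSup_nonneg fun _ => integral_nonneg fun _ => by positivity) h1
          (by norm_num)
    _ ≤ (Real.exp (-(l * α))) ^ (1 / (2 : ℝ)) :=
        Real.rpow_le_rpow (by linarith) (by linarith [Real.add_one_le_exp (-(l * α))]) (by norm_num)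
    _ = _ := by rw [← Real.exp_mul]; congr 1; ring

end Contraction

/-! ### Gaussian limit of the rescaled stationary law. -/

section Stationary

variable {n d : ℕ} {X : Matrix (Fin n) (Fin d) ℝ} {y : Vec n} {p : unitInterval}

theorem gdLaw_spec {l α : ℝ} (hl0 : 0 < l)
    (hl : ∀ v, l * ‖v‖ ^ 2 ≤ inner ℝ (meanGramOp X p v) v) (hα0 : 0 < α)
    (hα : α * specNorm (gram X) < 2) :
    IsProbabilityMeasure (gdLaw X y p α) ∧
      pushLaw (dropoutLaw d p) (gdStep X y α) (gdLaw X y p α) = gdLaw X y p α ∧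
      ∀ q : ℝ, MemLp id (ENNReal.ofReal q) (gdLaw X y p α) := by
  obtain ⟨π, h1, h2, h3, h4⟩ := exists_unique_gd_stationary X y p hl0 hl hα0 hα
  have hs := isStationaryLaw_stationaryLaw (μ := dropoutLaw d p) (f := gdStep X y α) ⟨π, h1, h2⟩
  have he := h4 _ hs.1 hs.2
  refine ⟨hs.1, hs.2, ?_⟩
  rw [gdLaw, he]
  exact h3

variable (X y p)

/-- The stationary law of gradient descent with dropout, centered and divided by `√α`. -/
noncomputable def scaledGdLaw (α : ℝ) : Measure (Vec d) :=
  (gdLaw X y p α).map (rescale (ridge X y p) α)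

variable {X y p}

theorem scaledGdLaw_spec (hp0 : 0 < (p : ℝ)) (hp1 : (p : ℝ) < 1) (hX : ∀ l, ∃ i, X i l ≠ 0)
    {l α : ℝ} (hl0 : 0 < l)
    (hl : ∀ v, l * ‖v‖ ^ 2 ≤ inner ℝ (meanGramOp X p v) v) (hα0 : 0 < α)
    (hα : α * specNorm (gram X) < 2) :
    IsProbabilityMeasure (scaledGdLaw X y p α) ∧
      pushLaw (dropoutLaw d p) (scaledStep (maskGramOp X) (noise X y p) α)
        (scaledGdLaw X y p α) = scaledGdLaw X y p α ∧
      MemLp id 2 (scaledGdLaw X y p α) := by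
  obtain ⟨h1, h2, h3⟩ := gdLaw_spec (y := y) hl0 hl hα0 hα
  have h4 : MemLp id 2 (gdLaw X y p α) := by simpa using h3 2
  unfold scaledGdLaw
  refine ⟨Measure.isProbabilityMeasure_map (continuous_rescale _ _).aemeasurable, ?_,
    memLp_rescale _ _ h4⟩
  refine pushLaw_rescale (dropoutLaw d p) (f := gdStep X y α)
    (continuous_gdStep X y α) (M := maskGramOp X) (h := noise X y p) (fun m u => ?_) h2
  rw [gdStep_sub_ridge X y hp0 hp1 hX α m u, maskGramOp_apply]

variable (X y p) in
theorem exists_uniform_bound (Q : Vec d →L[ℝ] Vec d) :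
    ∃ K : ℝ, 1 ≤ K ∧ (∀ m, ‖maskGramOp X m‖ ≤ K) ∧ (∀ m, ‖noise X y p m‖ ≤ K) ∧
      ‖meanGramOp X p‖ ≤ K ∧ ‖Q‖ ≤ K := by
  obtain ⟨a, ha⟩ := (Set.finite_range fun m : Mask d => ‖maskGramOp X m‖).bddAbove
  obtain ⟨b, hb⟩ := (Set.finite_range fun m : Mask d => ‖noise X y p m‖).bddAbove
  refine ⟨max 1 (max (max a b) (max ‖meanGramOp X p‖ ‖Q‖)), le_max_left _ _, fun m => ?_,
    fun m => ?_, ?_, ?_⟩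
  · exact (ha ⟨m, rfl⟩).trans (by simp)
  · exact (hb ⟨m, rfl⟩).trans (by simp)
  · simp
  · simp

theorem eventually_mul_le_one (c : ℝ) : ∀ᶠ α in 𝓝[>] (0 : ℝ), α * c ≤ 1 := by
  have h : Tendsto (fun α : ℝ => α * c) (𝓝[>] 0) (𝓝 0) := by
    have : Tendsto (fun α : ℝ => α * c) (𝓝 0) (𝓝 (0 * c)) := tendsto_id.mul_const c
    rw [zero_mul] at this
    exact tendsto_nhdsWithin_of_tendsto_nhds this
  exact (h.eventually (gt_mem_nhds one_pos)).mono fun _ h => le_of_lt h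

theorem tendsto_sqrt_mul (c : ℝ) : Tendsto (fun α : ℝ => √α * c) (𝓝[>] 0) (𝓝 0) := by
  have : Tendsto (fun α : ℝ => √α * c) (𝓝 0) (𝓝 (√0 * c)) :=
    (Real.continuous_sqrt.tendsto 0).mul_const c
  rw [Real.sqrt_zero, zero_mul] at this
  exact tendsto_nhdsWithin_of_tendsto_nhds this

theorem integral_norm_sq_scaledGdLaw_le (hp0 : 0 < (p : ℝ)) (hp1 : (p : ℝ) < 1)
    (hX : ∀ l, ∃ i, X i l ≠ 0) {l α K : ℝ} (hl0 : 0 < l)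
    (hl : ∀ v, l * ‖v‖ ^ 2 ≤ inner ℝ (meanGramOp X p v) v) (hα0 : 0 < α) (hα1 : α ≤ 1)
    (hα : α * specNorm (gram X) ≤ 1) (hK : 1 ≤ K) (hM : ∀ m, ‖maskGramOp X m‖ ≤ K)
    (hh : ∀ m, ‖noise X y p m‖ ≤ K) :
    ∫ z, ‖z‖ ^ 2 ∂(scaledGdLaw X y p α) ≤ 2 / l * (K ^ 2 + 2 * K ^ 4 / l) := by
  obtain ⟨h1, h2, h3⟩ := scaledGdLaw_spec (y := y) hp0 hp1 hX hl0 hl hα0 (by linarith)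
  refine integral_norm_sq_stationary_le (dropoutLaw d p) hK hM hh
    (integral_inner_noise p X y) hα0 hα1 hl0 (fun v => ?_) h2 h3
  refine (integral_norm_sq_sub_maskGramOp_le X p hl hα0.le (by linarith) v).trans ?_
  gcongr
  nlinarith [mul_nonneg hl0.le hα0.le]

theorem tendsto_charFun_scaledGdLaw (hp0 : 0 < (p : ℝ)) (hp1 : (p : ℝ) < 1)
    (hX : ∀ l, ∃ i, X i l ≠ 0) {l : ℝ} (hl0 : 0 < l)
    (hl : ∀ v, l * ‖v‖ ^ 2 ≤ inner ℝ (meanGramOp X p v) v) {V : Matrix (Fin d) (Fin d) ℝ}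
    (hV : V.PosSemidef)
    (hlyap : V * ((p : ℝ) • shrink p (gram X)) + ((p : ℝ) • shrink p (gram X)) * V =
      noiseCov X y p) (t : Vec d) :
    Tendsto (fun α => charFun (scaledGdLaw X y p α) t) (𝓝[>] 0)
      (𝓝 (Real.exp (-(inner ℝ t (app V t) / 2)) : ℝ)) := by
  obtain ⟨K, hK, hM, hh, hGK, hQK⟩ :=
    exists_uniform_bound X y p (Matrix.toEuclideanCLM (𝕜 := ℝ) V)
  have hpos : ∀ t : Vec d, 0 ≤ inner ℝ t (app V t) := fun t => by
    have := hV.dotProduct_mulVec_nonneg t.ofLp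
    rw [inner_eq_sum]
    simpa [dotProduct, app] using this
  have hly : ∀ t : Vec d, inner ℝ t (app V (meanGramOp X p t)) +
      inner ℝ (meanGramOp X p t) (app V t) =
        ∫ m, (inner ℝ (noise X y p m) t) ^ 2 ∂(dropoutLaw d p) := fun t => by
    rw [integral_inner_noise_sq, ← hlyap, add_app, inner_add_right, app_mul, app_mul,
      inner_meanGramOp_comm]
    rfl
  set C := 2 / l * (K ^ 2 + 2 * K ^ 4 / l) with hC
  rw [tendsto_iff_norm_sub_tendsto_zero]
  refine squeeze_zero' (Eventually.of_forall fun _ => norm_nonneg _) ?_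
    (tendsto_sqrt_mul ((15 * K ^ 3 * (1 + ‖t‖) * (1 + C) + K ^ 6 * (‖t‖ ^ 2 + 1)) *
      ‖t‖ ^ 2 / (l / 2)))
  filter_upwards [self_mem_nhdsWithin, eventually_mul_le_one 1,
    eventually_mul_le_one (specNorm (gram X)), eventually_mul_le_one l,
    eventually_mul_le_one (K ^ 3 * ‖t‖ ^ 2)] with α hα0 hα1 hαL hαl hαt
  have hα0 : 0 < α := hα0
  rw [mul_one] at hα1
  obtain ⟨h1, h2, h3⟩ := scaledGdLaw_spec (y := y) hp0 hp1 hX hl0 hl hα0 (by linarith)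
  refine norm_charFun_sub_exp_le (dropoutLaw d p) hK hM hh hGK
    (fun t z => integral_inner_maskGramOp X p t z) (integral_inner_noise p X y)
    (Q := Matrix.toEuclideanCLM (𝕜 := ℝ) V) hQK hpos hly hα0 hα1 (half_pos hl0) (by linarith)
    (fun t => ?_) h2 h3
    (integral_norm_sq_scaledGdLaw_le hp0 hp1 hX hl0 hl hα0 hα1 hαL hK hM hh) t hαt
  -- The available bound is on the squared norm, with factor `1 - l α ≤ (1 - l α / 2)²`; hence `l /
  -- 2` as the contraction rate.
  refine le_of_sq_le_sq ?_ (mul_nonneg (by linarith) (norm_nonneg _))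
  refine (norm_sq_sub_meanGramOp_le X p hl hα0.le (by linarith) t).trans ?_
  rw [mul_pow]
  gcongr
  nlinarith [mul_nonneg hl0.le hα0.le, sq_nonneg (l * α)]

end Stationary

/-! ### Convergence in distribution for both kinds of start. -/

section Convergence

variable {n d : ℕ} {X : Matrix (Fin n) (Fin d) ℝ} {y : Vec n} {p : unitInterval}

theorem tendstoInDistribution_of_charFun {Ω : Type*} [MeasurableSpace Ω] {P : Measure Ω}
    [IsProbabilityMeasure P] {Y : ℝ → Ω → Vec d} (hY : ∀ α, AEMeasurable (Y α) P)
    {V : Matrix (Fin d) (Fin d) ℝ} (hV : V.PosSemidef)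
    (h : ∀ t : Vec d, Tendsto (fun α => charFun (P.map (Y α)) t) (𝓝[>] 0)
      (𝓝 (Real.exp (-(inner ℝ t (app V t) / 2)) : ℝ))) :
    TendstoInDistribution Y (𝓝[>] 0) id (fun _ => P) (multivariateGaussian 0 V) where
  forall_aemeasurable := hY
  aemeasurable_limit := aemeasurable_id
  tendsto := by
    -- The filter `𝓝[>] 0` is countably generated, so Lévy's theorem for sequences is enough.
    refine tendsto_of_seq_tendsto fun u hu => ?_
    refine ProbabilityMeasure.tendsto_of_tendsto_charFun fun t => ?_
    have e : charFun ((multivariateGaussian (0 : Vec d) V).map id) t =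
        (Real.exp (-(inner ℝ t (app V t) / 2)) : ℝ) := by
      rw [Measure.map_id, charFun_multivariateGaussian hV, app_eq_toEuclideanCLM,
        Matrix.inner_toEuclideanCLM]
      simp
    have h1 := (h t).comp hu
    rw [← e] at h1
    exact h1

theorem gdIter_eq_randIter (α : ℝ) (D : ℕ → Mask d) (u : Vec d) (k : ℕ) :
    gdIter X y α D u k = randIter (gdStep X y α) D u k := by
  induction k with
  | zero => rfl
  | succ k ih => rw [gdIter, randIter, ih]

theorem scaledError_eq_rescale (α : ℝ) (D : ℕ → Mask d) (u : Vec d) (k : ℕ) :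
    scaledError X y p α D u k = rescale (ridge X y p) α (randIter (gdStep X y α) D u k) := by
  rw [← gdIter_eq_randIter]; rfl

variable {Ω : Type*} [MeasurableSpace Ω] {P : Measure Ω} [IsProbabilityMeasure P]
  {D : ℕ → Ω → Mask d}

theorem aemeasurable_scaledError (hD : IsDropoutSeq p D P) {b : Ω → Vec d} (hb : Measurable b)
    (α : ℝ) (k : ℕ) :
    AEMeasurable (fun ω => scaledError X y p α (fun j => D j ω) (b ω) k) P := by
  simp only [scaledError_eq_rescale]
  exact (continuous_rescale _ _).measurable.comp_aemeasurable
    (aemeasurable_randIter (continuous_gdStep X y α) (fun k => (hD.1 k).aemeasurable) hb k)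

theorem map_scaledError (hD : IsDropoutSeq p D P) {b : Ω → Vec d} (hb : Measurable b)
    (hbD : IndepFun b (fun ω k => D k ω) P) (α : ℝ) (k : ℕ) :
    P.map (fun ω => scaledError X y p α (fun j => D j ω) (b ω) k) =
      ((pushLaw (dropoutLaw d p) (gdStep X y α))^[k] (P.map b)).map (rescale (ridge X y p) α) := by
  have hm : ∀ k, AEMeasurable (D k) P := fun k => (hD.1 k).aemeasurable
  rw [← map_randIter (dropoutLaw d p) (continuous_gdStep X y α) hm (fun k => (hD.1 k).map_eq)
    hD.2 hb hbD k, AEMeasurable.map_map_of_aemeasurable (continuous_rescale _ _).aemeasurable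
    (aemeasurable_randIter (continuous_gdStep X y α) hm hb k)]
  simp only [scaledError_eq_rescale]
  rfl

/-- If `𝕏 = 0`, then `X` kills every basis vector and has zero columns. Positivity ensures that the
interval of step sizes contains all small `α > 0`. -/
theorem specNorm_gram_pos (hX : ∀ l, ∃ i, X i l ≠ 0) (hd : 0 < d) : 0 < specNorm (gram X) := by
  refine lt_of_le_of_ne (specNorm_nonneg _) fun h0 => ?_
  let i : Fin d := ⟨0, hd⟩
  set v : Vec d := EuclideanSpace.single i 1
  have h1 := norm_sq_app_gram_le X v
  have h2 : ‖app (gram X) v‖ = 0 := by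
    rw [← h0, zero_mul] at h1
    exact pow_eq_zero_iff two_ne_zero |>.1 (le_antisymm h1 (by positivity))
  have h3 := inner_app_gram X v
  rw [norm_eq_zero.1 h2, inner_zero_left] at h3
  have h4 : app X v = 0 := norm_eq_zero.1 (pow_eq_zero_iff two_ne_zero |>.1 h3.symm)
  obtain ⟨j, hj⟩ := hX i
  refine hj ?_
  have h5 : app X v j = 0 := by rw [h4]; rfl
  rw [app_apply] at h5
  simpa [v, PiLp.single_apply] using h5

theorem mul_specNorm_lt_two {α : ℝ} (hα : α ∈ Set.Ioo 0 (2 / specNorm (gram X))) :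
    α * specNorm (gram X) < 2 := by
  rcases (specNorm_nonneg (gram X)).eq_or_lt with h | h
  · rw [← h, mul_zero]; norm_num
  · exact (lt_div_iff₀ h).1 hα.2

theorem tendsto_charFun_stationary_start (hp0 : 0 < (p : ℝ)) (hp1 : (p : ℝ) < 1)
    (hX : ∀ l, ∃ i, X i l ≠ 0) {l : ℝ} (hl0 : 0 < l)
    (hl : ∀ v, l * ‖v‖ ^ 2 ≤ inner ℝ (meanGramOp X p v) v) {V : Matrix (Fin d) (Fin d) ℝ}
    (hV : V.PosSemidef)
    (hlyap : V * ((p : ℝ) • shrink p (gram X)) + ((p : ℝ) • shrink p (gram X)) * V =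
      noiseCov X y p) (hD : IsDropoutSeq p D P) {b : ℝ → Ω → Vec d} (hb : ∀ α, Measurable (b α))
    (hbD : ∀ α ∈ Set.Ioo 0 (2 / specNorm (gram X)),
      P.map (b α) = gdLaw X y p α ∧ IndepFun (b α) (fun ω k => D k ω) P) (k : ℕ) (t : Vec d) :
    Tendsto (fun α => charFun (P.map
        (fun ω => scaledError X y p α (fun j => D j ω) (b α ω) k)) t) (𝓝[>] 0)
      (𝓝 (Real.exp (-(inner ℝ t (app V t) / 2)) : ℝ)) := by
  -- For `d = 0` the spectral norm is 0 and `2 / 0 = 0`, so the interval is empty and `hbD` says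
  -- nothing; but then only `t = 0` occurs.
  rcases Nat.eq_zero_or_pos d with rfl | hd
  · have ht : t = 0 := Subsingleton.elim _ _
    subst ht
    have h1 : ∀ α, charFun (P.map
        (fun ω => scaledError X y p α (fun j => D j ω) (b α ω) k)) 0 = 1 := fun α => by
      have := Measure.isProbabilityMeasure_map (aemeasurable_scaledError (X := X) (y := y) hD
        (hb α) α k)
      simp
    simp only [h1]
    simp
  · refine (tendsto_charFun_scaledGdLaw hp0 hp1 hX hl0 hl hV hlyap t).congr' ?_
    have hL := specNorm_gram_pos hX hd
    filter_upwards [self_mem_nhdsWithin, eventually_mul_le_one (specNorm (gram X))] with α hα0 hα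
    have hα0 : 0 < α := hα0
    have hmem : α ∈ Set.Ioo 0 (2 / specNorm (gram X)) :=
      ⟨hα0, (lt_div_iff₀ hL).2 (by linarith)⟩
    obtain ⟨e1, e2⟩ := hbD α hmem
    obtain ⟨-, h2, -⟩ := gdLaw_spec (y := y) hl0 hl hα0 (by linarith : α * specNorm (gram X) < 2)
    rw [map_scaledError hD (hb α) e2 α k, e1, Function.iterate_fixed h2]
    rfl

theorem charFun_map_rescale (β : Vec d) (α : ℝ) (π : Measure (Vec d)) (t : Vec d) :
    charFun (π.map (rescale β α)) t =
      ∫ u, Complex.exp ((inner ℝ (rescale β α u) t : ℝ) * Complex.I) ∂π := by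
  rw [charFun_apply, integral_map (continuous_rescale β α).aemeasurable]
  exact Continuous.aestronglyMeasurable (by fun_prop)

/-- The chain from `b` is compared with the stationary one under common masks. The character
composed with the rescaling has Lipschitz constant `‖t‖ / √α`, and Jensen replaces the mean distance
by the one in `L^q`. -/
theorem norm_charFun_fixed_start_sub_le {l α q : ℝ} (hl0 : 0 < l)
    (hl : ∀ v, l * ‖v‖ ^ 2 ≤ inner ℝ (meanGramOp X p v) v) (hα0 : 0 < α)
    (hα : α * specNorm (gram X) < 2) (hq : 1 ≤ q) (hD : IsDropoutSeq p D P) (b : Vec d) (k : ℕ)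
    (t : Vec d) :
    ‖charFun (P.map (fun ω => scaledError X y p α (fun j => D j ω) b k)) t -
      charFun (scaledGdLaw X y p α) t‖ ≤
      ‖t‖ * (contraction X p α q ^ k *
        (∫ u, ‖b - u‖ ^ q ∂(gdLaw X y p α)) ^ (1 / q) / Real.sqrt α) := by
  obtain ⟨h1, h2, h3⟩ := gdLaw_spec (y := y) hl0 hl hα0 hα
  have hmem : MemLp (fun u => b - u) (ENNReal.ofReal q) (gdLaw X y p α) :=
    (memLp_const b).sub (h3 q)
  have hmem1 : MemLp (fun u => b - u) 1 (gdLaw X y p α) :=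
    hmem.mono_exponent (by simpa using hq)
  have hint : Integrable (fun u => ‖b - u‖) (gdLaw X y p α) :=
    (memLp_one_iff_integrable.1 hmem1).norm
  have hintq : Integrable (fun u => ‖b - u‖ ^ q) (gdLaw X y p α) := by
    have := hmem.integrable_norm_rpow (by simpa using (by linarith : 0 < q)) ENNReal.ofReal_ne_top
    rwa [ENNReal.toReal_ofReal (by linarith)] at this
  have hr0 : 0 ≤ (√α)⁻¹ := by positivity
  set f : Vec d → ℂ := fun u =>
    Complex.exp ((inner ℝ (rescale (ridge X y p) α u) t : ℝ) * Complex.I) with hf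
  have hL : ∀ u v, ‖f u - f v‖ ≤ ‖t‖ * (√α)⁻¹ * ‖u - v‖ := fun u v => by
    refine (norm_exp_inner_sub_le t _ _).trans (le_of_eq ?_)
    rw [rescale, rescale, ← smul_sub, norm_smul, Real.norm_of_nonneg hr0, sub_sub_sub_cancel_right]
    ring
  have hC : ∀ u, ‖f u‖ ≤ 1 := fun u => (Complex.norm_exp_ofReal_mul_I _).le
  have hmain := norm_integral_pushLaw_iterate_sub_le (dropoutLaw d p) (continuous_gdStep X y α)
    (contraction_nonneg (X := X) (p := p) α q)
    (integral_norm_gdStep_sub_le_contraction hα0.le hα.le hq) k (gdLaw X y p α) b hint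
    (mul_nonneg (norm_nonneg t) hr0) hL hC
  have hlaw := map_scaledError (X := X) (y := y) hD (b := fun _ => b) measurable_const
    (indepFun_const_left b _) α k
  rw [Measure.map_const, measure_univ, one_smul] at hlaw
  rw [hlaw, scaledGdLaw, charFun_map_rescale, charFun_map_rescale]
  rw [Function.iterate_fixed h2] at hmain
  refine hmain.trans ?_
  have h4 := integral_le_rpow_inv (gdLaw X y p α) (fun u => norm_nonneg (b - u)) hint hq hintq
  calc ‖t‖ * (√α)⁻¹ * contraction X p α q ^ k * ∫ u, ‖b - u‖ ∂(gdLaw X y p α) ≤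
        ‖t‖ * (√α)⁻¹ * contraction X p α q ^ k *
          (∫ u, ‖b - u‖ ^ q ∂(gdLaw X y p α)) ^ (1 / q) := by
        have := contraction_nonneg (X := X) (p := p) α q
        gcongr
    _ = _ := by ring

theorem tendsto_charFun_fixed_start (hp0 : 0 < (p : ℝ)) (hp1 : (p : ℝ) < 1)
    (hX : ∀ l, ∃ i, X i l ≠ 0) {l : ℝ} (hl0 : 0 < l)
    (hl : ∀ v, l * ‖v‖ ^ 2 ≤ inner ℝ (meanGramOp X p v) v) {V : Matrix (Fin d) (Fin d) ℝ}
    (hV : V.PosSemidef)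
    (hlyap : V * ((p : ℝ) • shrink p (gram X)) + ((p : ℝ) • shrink p (gram X)) * V =
      noiseCov X y p) (hD : IsDropoutSeq p D P) (b : Vec d) (k : ℝ → ℕ) {q : ℝ} (hq : 1 ≤ q)
    (hk : Tendsto (fun α => contraction X p α q ^ k α *
          (∫ u, ‖b - u‖ ^ q ∂(gdLaw X y p α)) ^ (1 / q) / Real.sqrt α) (𝓝[>] 0) (𝓝 0))
    (t : Vec d) :
    Tendsto (fun α => charFun (P.map
        (fun ω => scaledError X y p α (fun j => D j ω) b (k α))) t) (𝓝[>] 0)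
      (𝓝 (Real.exp (-(inner ℝ t (app V t) / 2)) : ℝ)) := by
  have h1 := tendsto_charFun_scaledGdLaw hp0 hp1 hX hl0 hl hV hlyap t
  have h2 : Tendsto (fun α => charFun (P.map
        (fun ω => scaledError X y p α (fun j => D j ω) b (k α))) t -
        charFun (scaledGdLaw X y p α) t) (𝓝[>] 0) (𝓝 0) := by
    have h3 := hk.const_mul ‖t‖
    rw [mul_zero] at h3
    refine squeeze_zero_norm' ?_ h3
    filter_upwards [self_mem_nhdsWithin, eventually_mul_le_one (specNorm (gram X))] with α hα0 hα
    exact norm_charFun_fixed_start_sub_le hl0 hl hα0 (by linarith) hq hD b (k α) t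
  simpa using h2.add h1

/-- For `α ≤ 1` rescaling only increases distances to `β̃`, so the uniform bound on the rescaled law
controls the original one. -/
theorem integral_norm_sub_sq_gdLaw_le {l α C : ℝ} (hl0 : 0 < l)
    (hl : ∀ v, l * ‖v‖ ^ 2 ≤ inner ℝ (meanGramOp X p v) v) (hα0 : 0 < α) (hα1 : α ≤ 1)
    (hα : α * specNorm (gram X) < 2) (hC : ∫ z, ‖z‖ ^ 2 ∂(scaledGdLaw X y p α) ≤ C) (b : Vec d) :
    ∫ u, ‖b - u‖ ^ 2 ∂(gdLaw X y p α) ≤ 2 * ‖b - ridge X y p‖ ^ 2 + 2 * C := by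
  obtain ⟨h1, h2, h3⟩ := gdLaw_spec (y := y) hl0 hl hα0 hα
  have h4 : MemLp id 2 (gdLaw X y p α) := by simpa using h3 2
  have hint : Integrable (fun z => ‖rescale (ridge X y p) α z‖ ^ 2) (gdLaw X y p α) :=
    ((h4.sub (memLp_const (ridge X y p))).const_smul ((√α)⁻¹)).integrable_norm_pow (by norm_num)
  have e : ∫ z, ‖z‖ ^ 2 ∂(scaledGdLaw X y p α) =
      ∫ u, ‖rescale (ridge X y p) α u‖ ^ 2 ∂(gdLaw X y p α) :=
    integral_map (continuous_rescale _ _).aemeasurable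
      (Continuous.aestronglyMeasurable (by fun_prop))
  have hC0 : 0 ≤ C := le_trans (integral_nonneg fun z => by positivity) hC
  rw [e] at hC
  calc ∫ u, ‖b - u‖ ^ 2 ∂(gdLaw X y p α) ≤
      ∫ u, (2 * ‖b - ridge X y p‖ ^ 2 + 2 * ‖rescale (ridge X y p) α u‖ ^ 2)
        ∂(gdLaw X y p α) := by
        refine integral_mono_of_nonneg (ae_of_all _ fun u => by positivity)
          ((integrable_const _).add (hint.const_mul 2)) (ae_of_all _ fun u => ?_)
        have h5 : ‖u - ridge X y p‖ ^ 2 ≤ ‖rescale (ridge X y p) α u‖ ^ 2 := by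
          rw [rescale, norm_smul, mul_pow, norm_inv, inv_pow, Real.norm_eq_abs, sq_abs,
            Real.sq_sqrt hα0.le]
          exact le_mul_of_one_le_left (by positivity) ((one_le_inv₀ hα0).2 hα1)
        have h6 : ‖b - u‖ ≤ ‖b - ridge X y p‖ + ‖u - ridge X y p‖ := by
          have := norm_sub_le (b - ridge X y p) (u - ridge X y p)
          rwa [sub_sub_sub_cancel_right] at this
        have h7 : ‖b - u‖ ^ 2 ≤ (‖b - ridge X y p‖ + ‖u - ridge X y p‖) ^ 2 := by gcongr
        simp only
        nlinarith [sq_nonneg (‖b - ridge X y p‖ - ‖u - ridge X y p‖)]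
    _ = 2 * ‖b - ridge X y p‖ ^ 2 +
        2 * ∫ u, ‖rescale (ridge X y p) α u‖ ^ 2 ∂(gdLaw X y p α) := by
        rw [integral_add (integrable_const _) (hint.const_mul 2), integral_const]
        simp [integral_const_mul]
    _ ≤ _ := by gcongr

/-- Once `α k ≥ (2 / l) log(1/α)`, the bound `r_{α,2} ≤ exp(-l α / 2)` gives `r_{α,2}^k ≤ α`. The
remaining integral is bounded, and `α / √α = √α` tends to 0. -/
theorem tendsto_contraction_pow_of_log (hp0 : 0 < (p : ℝ)) (hp1 : (p : ℝ) < 1)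
    (hX : ∀ l, ∃ i, X i l ≠ 0) {l : ℝ} (hl0 : 0 < l)
    (hl : ∀ v, l * ‖v‖ ^ 2 ≤ inner ℝ (meanGramOp X p v) v) (b : Vec d) (k : ℝ → ℕ)
    (hk : Tendsto (fun α => α * k α / Real.log (1 / α)) (𝓝[>] 0) atTop) :
    Tendsto (fun α => contraction X p α 2 ^ k α *
      (∫ u, ‖b - u‖ ^ (2 : ℝ) ∂(gdLaw X y p α)) ^ (1 / (2 : ℝ)) / Real.sqrt α) (𝓝[>] 0) (𝓝 0) := by
  obtain ⟨K, hK, hM, hh, -, -⟩ := exists_uniform_bound X y p (0 : Vec d →L[ℝ] Vec d)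
  set C := 2 / l * (K ^ 2 + 2 * K ^ 4 / l) with hC
  set C' := (2 * ‖b - ridge X y p‖ ^ 2 + 2 * C) ^ (1 / (2 : ℝ)) with hC'
  refine squeeze_zero' (Eventually.of_forall fun α => ?_) ?_ (tendsto_sqrt_mul C')
  · have h1 := contraction_nonneg (X := X) (p := p) α 2
    have h2 : 0 ≤ ∫ u, ‖b - u‖ ^ (2 : ℝ) ∂(gdLaw X y p α) := integral_nonneg fun u => by positivity
    positivity
  filter_upwards [self_mem_nhdsWithin, eventually_mul_le_one 2,
    eventually_mul_le_one (specNorm (gram X)), eventually_mul_le_one l,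
    hk.eventually_ge_atTop (2 / l)] with α hα0 hα2 hαL hαl hkα
  have hα0 : 0 < α := hα0
  -- Strictness, from `2 α ≤ 1`, is needed for `log(1/α)` to be positive.
  have hα1 : α < 1 := by linarith
  have hlog : 0 < Real.log (1 / α) := Real.log_pos (by rw [one_lt_div hα0]; exact hα1)
  have h1 : contraction X p α 2 ^ k α ≤ α := by
    calc contraction X p α 2 ^ k α ≤ Real.exp (-(l * α / 2)) ^ k α :=
          pow_le_pow_left₀ (contraction_nonneg _ _) (contraction_two_le hl0 hl hα0.le hαL hαl) _
      _ = Real.exp (-(l / 2 * (α * k α))) := by rw [← Real.exp_nat_mul]; congr 1; ring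
      _ ≤ Real.exp (-Real.log (1 / α)) := by
          refine Real.exp_le_exp.2 (neg_le_neg ?_)
          rw [le_div_iff₀ hlog] at hkα
          have := mul_le_mul_of_nonneg_left hkα (half_pos hl0).le
          have e : l / 2 * (2 / l * Real.log (1 / α)) = Real.log (1 / α) := by field_simp
          linarith
      _ = α := by rw [one_div, Real.log_inv, neg_neg, Real.exp_log hα0]
  have h2 : (∫ u, ‖b - u‖ ^ (2 : ℝ) ∂(gdLaw X y p α)) ^ (1 / (2 : ℝ)) ≤ C' := by
    refine Real.rpow_le_rpow (integral_nonneg fun u => by positivity) ?_ (by norm_num)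
    simp only [Real.rpow_two]
    exact integral_norm_sub_sq_gdLaw_le hl0 hl hα0 hα1.le (by linarith)
      (integral_norm_sq_scaledGdLaw_le hp0 hp1 hX hl0 hl hα0 hα1.le hαL hK hM hh) b
  calc contraction X p α 2 ^ k α *
      (∫ u, ‖b - u‖ ^ (2 : ℝ) ∂(gdLaw X y p α)) ^ (1 / (2 : ℝ)) / √α ≤ α * C' / √α := by
        gcongr
    _ = √α * C' := by
        rw [mul_comm, mul_div_assoc, Real.div_sqrt, mul_comm]

end Convergence

end DropoutGD

/-! ### Assembly of the theorem. -/

open DropoutGD in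
theorem mainTheorem7 {n d : ℕ} (X : Matrix (Fin n) (Fin d) ℝ) (y : Vec n)
    (p : unitInterval) (hp0 : 0 < (p : ℝ)) (hp1 : (p : ℝ) < 1)
    (hX : ∀ l, ∃ i, X i l ≠ 0)
    (hoff : ∀ l, ∃ m, m ≠ l ∧ gram X l m ≠ 0)
    {Ω : Type*} [MeasurableSpace Ω] (P : Measure Ω) [IsProbabilityMeasure P]
    (D : ℕ → Ω → Mask d) (hD : IsDropoutSeq p D P) :
    -- both recursions have exactly one stationary law, and `Ξ(α)` is a second moment matrix
    (∀ α ∈ Set.Ioo 0 (2 / specNorm (gram X)),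
      (∃! π, IsStationaryLaw (dropoutLaw d p) (gdStep X y α) π) ∧
      (∃! ν, IsStationaryLaw (dropoutLaw d p) (affineStep X y p α) ν) ∧
      MemLp id 2 (affineLaw X y p α) ∧
      ∀ i j, Xi X y p α i j =
        (∫ u, (u i - ridge X y p i) * (u j - ridge X y p j) ∂(affineLaw X y p α)) / α) ∧
    ∃ Xi0 : Matrix (Fin d) (Fin d) ℝ,
      -- `Ξ(0)` is the limit of `Ξ(α)` and the unique solution of the Lyapunov equation
      Tendsto (fun α => Xi X y p α) (𝓝[>] 0) (𝓝 Xi0) ∧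
      Xi0.PosSemidef ∧
      (∀ V : Matrix (Fin d) (Fin d) ℝ,
        V * ((p : ℝ) • shrink p (gram X)) + ((p : ℝ) • shrink p (gram X)) * V = noiseCov X y p ↔
          V = Xi0) ∧
      -- stationary initialization: every `k`
      (∀ b0 : ℝ → Ω → Vec d, (∀ α, Measurable (b0 α)) →
        (∀ α ∈ Set.Ioo 0 (2 / specNorm (gram X)),
          P.map (b0 α) = gdLaw X y p α ∧ IndepFun (b0 α) (fun ω k => D k ω) P) →
        ∀ k : ℕ,
          TendstoInDistribution
            (fun (α : ℝ) ω => scaledError X y p α (fun j => D j ω) (b0 α ω) k)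
            (𝓝[>] 0) id (fun _ => P) (multivariateGaussian 0 Xi0)) ∧
      -- fixed initial vector: every `k(α)` at which the influence of the start is `o(√α)`
      (∀ (b0 : Vec d) (k : ℝ → ℕ) (q : ℝ), 1 < q →
        Tendsto (fun α => contraction X p α q ^ k α *
          (∫ u, ‖b0 - u‖ ^ q ∂(gdLaw X y p α)) ^ (1 / q) / Real.sqrt α) (𝓝[>] 0) (𝓝 0) →
        TendstoInDistribution
          (fun (α : ℝ) ω => scaledError X y p α (fun j => D j ω) b0 (k α))
          (𝓝[>] 0) id (fun _ => P) (multivariateGaussian 0 Xi0)) ∧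
      -- in particular every `k(α)` that grows faster than `log(1/α) / α`
      (∀ (b0 : Vec d) (k : ℝ → ℕ),
        Tendsto (fun α => α * k α / Real.log (1 / α)) (𝓝[>] 0) atTop →
        TendstoInDistribution
          (fun (α : ℝ) ω => scaledError X y p α (fun j => D j ω) b0 (k α))
          (𝓝[>] 0) id (fun _ => P) (multivariateGaussian 0 Xi0)) := by
  obtain ⟨l, hl0, hl⟩ : ∃ l > 0, ∀ v : Vec d, l * ‖v‖ ^ 2 ≤ inner ℝ (meanGramOp X p v) v :=
    exists_coercive X hp0 hp1 hX
  have hGs : ((p : ℝ) • shrink p (gram X)).transpose = (p : ℝ) • shrink p (gram X) := by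
    rw [Matrix.transpose_smul, shrink_transpose (gram_transpose X)]
  obtain ⟨e, he⟩ := exists_lyapunovEquiv hGs hl0 hl
  have hlim : Tendsto (fun α => Xi X y p α) (𝓝[>] 0) (𝓝 (e.symm (noiseCov X y p))) := by
    obtain ⟨K, hK, -, hh, hGK, -⟩ := exists_uniform_bound X y p (0 : Vec d →L[ℝ] Vec d)
    refine tendsto_of_perturbed_lyapunov e he (C := 2 / l * (K ^ 2 + 2 * K ^ 4 / l)) ?_ ?_
    · filter_upwards [self_mem_nhdsWithin, eventually_mul_le_one (specNorm (gram X))] with α hα0 hα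
      exact Xi_equation hl0 hl hα0 (by linarith)
    · filter_upwards [self_mem_nhdsWithin, eventually_mul_le_one 1,
        eventually_mul_le_one (specNorm (gram X))] with α hα0 hα1 hα i j
      exact abs_Xi_apply_le hl0 hl hα0 (by linarith) hα hK hGK hh i j
  -- Positivity is inherited from the covariances `Ξ(α)`; it makes `multivariateGaussian 0 Xi0` have
  -- the expected characteristic function.
  have hpsd : (e.symm (noiseCov X y p)).PosSemidef := by
    refine posSemidef_of_tendsto hlim ?_
    filter_upwards [self_mem_nhdsWithin, eventually_mul_le_one (specNorm (gram X))] with α hα0 hα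
    exact Xi_posSemidef hl0 hl hα0 (by linarith)
  have hlyap := he (e.symm (noiseCov X y p))
  rw [e.apply_symm_apply] at hlyap
  have hmeas : ∀ (b : Vec d) (k : ℝ → ℕ) (α : ℝ),
      AEMeasurable (fun ω => scaledError X y p α (fun j => D j ω) b (k α)) P := fun b k α =>
    aemeasurable_scaledError hD (b := fun _ => b) measurable_const α (k α)
  refine ⟨fun α hα => ?_, e.symm (noiseCov X y p), hlim, hpsd, fun V => ?_, ?_, ?_, ?_⟩
  · have hα2 := mul_specNorm_lt_two hα
    refine ⟨?_, ?_, (affineLaw_spec hl0 hl hα.1 hα2).2.2, Xi_apply_eq_div hl0 hl hα.1 hα2⟩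
    · obtain ⟨π, h1, h2, -, h3⟩ := exists_unique_gd_stationary X y p hl0 hl hα.1 hα2
      exact ⟨π, ⟨h1, h2⟩, fun π' h' => h3 π' h'.1 h'.2⟩
    · obtain ⟨π, h1, h2, -, h3⟩ := exists_unique_affine_stationary X y p hl0 hl hα.1 hα2
      exact ⟨π, ⟨h1, h2⟩, fun π' h' => h3 π' h'.1 h'.2⟩
  · rw [← he, LinearEquiv.eq_symm_apply]
  · intro b0 hb hbD k
    exact tendstoInDistribution_of_charFun (fun α => aemeasurable_scaledError hD (hb α) α k) hpsd
      (tendsto_charFun_stationary_start hp0 hp1 hX hl0 hl hpsd hlyap.symm hD hb hbD k)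
  · intro b0 k q hq hk
    exact tendstoInDistribution_of_charFun (hmeas b0 k) hpsd
      (tendsto_charFun_fixed_start hp0 hp1 hX hl0 hl hpsd hlyap.symm hD b0 k hq.le hk)
  · intro b0 k hk
    exact tendstoInDistribution_of_charFun (hmeas b0 k) hpsd
      (tendsto_charFun_fixed_start hp0 hp1 hX hl0 hl hpsd hlyap.symm hD b0 k one_le_two
        (tendsto_contraction_pow_of_log hp0 hp1 hX hl0 hl b0 k hk))
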